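/- **Setting.** Fix $\tau,\alpha\in(0,1)$ and dimensions $J,d_w,d_\phi$. At stage $n=1,2,\dots$ there are observations $D_{i,j}=(y_{i,j},X_{i,j},W_{i,j},Z_{i,j})$, $i\le n_j$, in $J$ clusters ($J$ fixed; $y,X$ scalar, $W\in\mathbb R^{d_w}$; all quantities may depend on the stage; $N_n=\sum_j n_j$ is the total sample size). $\mathbb P_{n,j}$ is the average over cluster $j$, $\overline{\mathbb P}_{n,j}$ the average of the expectations over cluster $j$, $\overline{\mathbb P}_n$ the average of the expectations over the whole sample. Let $\beta_n=\beta_0+\mu_\beta/r_n$, $\gamma_n=\gamma_0+\mu_\gamma/r_n$ with a rate $r_n\to\infty$, and $\varepsilon_{i,j}=y_{i,j}-X_{i,j}\beta_n-W_{i,j}^\top\gamma_n$. Let $\Phi_{i,j}\in\mathbb R^{d_\phi}$ and $V_{i,j}\ge 0$ be functions of $(W_{i,j},Z_{i,j})$ with estimators $\hat\Phi_{i,j}$, $\hat V_{i,j}\ge0$ (random functions of $(W_{i,j},Z_{i,j})$), $\Psi=(W^\top,\Phi^\top)^\top$, $\hat\Psi=(W^\top,\hat\Phi^\top)^\top$,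 $f(D,b,r,t)=(\tau-1\{y-Xb-W^\top r-\Phi^\top t\le0\})\Psi V$, and $\hat f$ the same with $\hat\Phi,\hat V$. Expectations of $\hat f$ are expectations of $f$ evaluated at $f=\hat f$. Let $\rho_\tau(u)=u(\tau-1\{u\le0\})$. **Estimators.** $\hat{\mathcal Q}_n(b,r,t)=N_n^{-1}\sum_j\sum_i\rho_\tau(y_{i,j}-X_{i,j}b-W_{i,j}^\top r-\hat\Phi_{i,j}^\top t)\hat V_{i,j}$; $(\hat\gamma(b),\hat\theta(b))$ minimizes $\hat{\mathcal Q}_n(b,\cdot,\cdot)$; $\hat\beta$ minimizes $\|\hat\theta(b)\|_{\hat A_1}$ over $b\in\mathcal B$; $\hat\gamma=\hat\gamma(\hat\beta)$, $\hat\gamma^r=\hat\gamma(\beta_0)$. For $g\in\mathbf G=\{-1,1\}^J$, $(\hat\gamma^*_g(b),\hat\theta_g^*(b))$ minimizes $N_n\hat{\mathcal Q}_n(b,r,t)-\sum_jg_j\sum_i\hat f(D_{i,j},\beta_0,\hat\gamma^r,0)^\top(r^\top,t^\top)^\top$ over $(r,t)$, $\hat\beta^*_g$ minimizes $\|\hat\theta^*_g(b)\|_{\hat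 A_1}$ over $b\in\mathcal B$, and $\hat\gamma^*_g=\hat\gamma^*_g(\hat\beta^*_g)$. Here $\|u\|_A=(u^\top Au)^{1/2}$, and each estimator is a minimizer with probability approaching one. **Tests.** For a scalar weight $\hat A_2$ let $T_n=\|\hat\beta-\beta_0\|_{\hat A_2}$, $T_n^*(g)=\|\hat\beta_g^*-\hat\beta\|_{\hat A_2}$. With $\omega=(0,I_{d_\phi})$ and $\hat f_g^*(D_{i,j})=g_j\hat f(D_{i,j},\beta_0,\hat\gamma^r,0)+\hat f(D_{i,j},\hat\beta_g^*,\hat\gamma_g^*,0)-\hat f(D_{i,j},\hat\beta,\hat\gamma,0)$ let $$\hat\Omega=\frac1{N_n}\sum_{j}\Big(\omega\sum_i\hat f(D_{i,j},\hat\beta,\hat\gamma,0)\Big)\Big(\omega\sum_i\hat f(D_{i,j},\hat\beta,\hat\gamma,0)\Big)^\top,\qquad \hat\Omega_g^*=\frac1{N_n}\sum_{j}\Big(\omega\sum_i\hat f_g^*(D_{i,j})\Big)\Big(\omega\sum_i\hat f_g^*(D_{i,j})\Big)^\top,$$ $\hat A_{CR}=(\hat G^\top\hat\Omega\hat G)^{-1}$,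 $\hat A^*_{CR,g}=(\hat G^\top\hat\Omega^*_g\hat G)^{-1}$, $T_{CR,n}=\|\hat\beta-\beta_0\|_{\hat A_{CR}}$, $T^*_{CR,n}(g)=\|\hat\beta_g^*-\hat\beta\|_{\hat A^*_{CR,g}}$. Let $\hat c_n(1-\alpha)$ and $\hat c_{CR,n}(1-\alpha)$ be the $\lceil2^J(1-\alpha)\rceil$-th smallest of the values $T^*_n(g)$, respectively $T^*_{CR,n}(g)$, $g\in\mathbf G$, and $\phi_n=1\{T_n>\hat c_n(1-\alpha)\}$, $\phi_n^{cr}=1\{T_{CR,n}>\hat c_{CR,n}(1-\alpha)\}$. **Assumptions on the model** (statements about $n$ are for large $n$). 1. $\mathbb P(y_{i,j}\le X_{i,j}\beta_n+W_{i,j}^\top\gamma_n\mid W_{i,j},Z_{i,j})=\tau$; $\mathcal B\subset\mathbb R$ is compact and convex, $\beta_n\in\operatorname{int}\mathcal B$; $y_{i,j}$ has a conditional density given $(X_{i,j},W_{i,j},Z_{i,j})$, bounded by a constant; $\sup_{n,i,j}\mathbb E\|\Psi_{i,j}\|^{2+a}<\infty$ for some $a>0$; all expectations below are finite. With $\Pi_n(b,r,t)=\overline{\mathbb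 P}_nf(D_{i,j},b,r,t)$ there are compact convex sets $\mathcal R\subset\mathbb R^{d_w}$, $\Theta\subset\mathbb R^{d_\phi}$ such that $\partial\Pi_n/\partial(r^\top,t^\top)$ is continuous and has full column rank, uniformly in $n$ and over $\mathcal B\times\mathcal R\times\Theta$. 2. (i) Let $\mathcal Q_n(b,r,t)=\overline{\mathbb P}_n\rho_\tau(y_{i,j}-X_{i,j}b-W_{i,j}^\top r-\Phi_{i,j}^\top t)V_{i,j}$ and $\mathcal Q_\infty=\lim\mathcal Q_n$. For each $b\in\mathcal B$, $\mathcal Q_n(b,\cdot,\cdot)$ and $\mathcal Q_\infty(b,\cdot,\cdot)$ have unique minimizers, continuous in $b$, those of $\mathcal Q_n$ in $\operatorname{int}(\mathcal R\times\Theta)$; for each $(r,t)$, $\sup_{b\in\mathcal B}|\mathcal Q_n-\mathcal Q_\infty|=o(1)$ and $\sup_{b\in\mathcal B}|\hat{\mathcal Q}_n-\mathcal Q_n|=o_p(1)$. (ii) For every $\varepsilon>0$, $\lim_{\delta\to0}\limsup_n\mathbb P\big(\sup\|r_n(\mathbb P_{n,j}-\overline{\mathbb P}_{n,j})(\hat f(D_{i,j},\beta_n+v_b,\gamma_n+v_r,v_t)-f(D_{i,j},\beta_n,\gamma_n,0))\|\ge\varepsilon\big)=0$,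 the supremum being over $j$ and $\|(v_b,v_r,v_t)\|\le\delta$. (iii) With $\hat\delta_{i,j}(v)=X_{i,j}v_b+W_{i,j}^\top v_r+\hat\Phi_{i,j}^\top v_t$ and $f_\varepsilon$ the conditional density of $\varepsilon_{i,j}$ given $(X_{i,j},W_{i,j},Z_{i,j})$, the matrices $\overline{\mathbb P}_{n,j}f_\varepsilon(\hat\delta_{i,j}(v))\hat\Psi\hat\Psi^\top\hat V$ and $\overline{\mathbb P}_{n,j}f_\varepsilon(\hat\delta_{i,j}(v))\hat\Psi X\hat V$ converge, in the same sense ($\lim_{\delta\to0}\limsup_n\mathbb P(\sup\ge\varepsilon)=0$), to $Q_{\Psi,\Psi,j}=\lim\overline{\mathbb P}_{n,j}f_\varepsilon(0)\Psi\Psi^\top V$ and $Q_{\Psi,X,j}=\lim\overline{\mathbb P}_{n,j}f_\varepsilon(0)\Psi XV$. (iv) $r_n=O(\sqrt{N_n})$ and $r_n\|\mathbb P_{n,j}f(D_{i,j},\beta_n,\gamma_n,0)\|=O_p(1)$ for every $j$. (v) $N_n\to\infty$, $n_j/N_n\to\xi_j>0$. (vi) $Q_{\Psi,\Psi}=\sum_j\xi_jQ_{\Psi,\Psi,j}$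 is positive definite. 3. The $W,\Phi$ block of $Q_{\Psi,\Psi,j}$ is zero for every $j$. There are Gaussian vectors $\mathcal Z_j\sim N(0,\Sigma_j)$, independent across $j$, with $\Sigma_j$ positive definite, such that $r_n\mathbb P_{n,j}(\tau-1\{\varepsilon_{i,j}\le0\})\Phi_{i,j}V_{i,j}-\mathcal Z_j\to0$ in probability. 4. $\partial\Pi_n(b,r,0)/\partial(b,r^\top)$ is continuous and has full column rank, uniformly in $n$ and over $\mathcal B\times\mathcal R$; the limit $\Pi_\infty(b,r)=\lim\Pi_n(b,r,0)$ exists, and it maps $\mathcal B\times\mathcal R$ openly onto its image, which is simply connected. $\hat A_1\to A_1$ in probability with $A_1$ symmetric positive definite, and $Q_{\Phi,X}^\top Q_{\Phi,\Phi}^{-1}A_1Q_{\Phi,\Phi}^{-1}Q_{\Phi,X}>0$, where $Q_{\Phi,X,j}=\omega Q_{\Psi,X,j}$, $Q_{\Phi,X}=\sum_j\xi_jQ_{\Phi,X,j}$ and $Q_{\Phi,\Phi}$ is the lower right block of $Q_{\Psi,\Psi}$. 5. $\hat G\to G$ in probability, $G\ne0$. Let $$\tilde\Gamma=\big[Q_{\Phi,X}^\top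 Q_{\Phi,\Phi}^{-1}A_1Q_{\Phi,\Phi}^{-1}Q_{\Phi,X}\big]^{-1}Q_{\Phi,X}^\top Q_{\Phi,\Phi}^{-1}A_1Q_{\Phi,\Phi}^{-1},\qquad a_j=\tilde\Gamma Q_{\Phi,X,j},\qquad b_j=G^\top Q_{\Phi,X,j},$$ $v_j^\top=-[\xi_1,\dots,\xi_J]\otimes(b_j\tilde\Gamma)+[0,\dots,0,G^\top,0,\dots,0]$ with $G^\top$ in the $j$-th block. The matrix $[v_1,\dots,v_J]$ has rank greater than $1$. 6. There is a set $\mathcal J_s\subseteq\{1,\dots,J\}$ with $\min(|a_j|,|b_j|)>0$ for $j\in\mathcal J_s$, $a_j=b_j=0$ for $j\notin\mathcal J_s$, and $\lceil2^J(1-\alpha)\rceil\le2^J-2^{J-|\mathcal J_s|+1}$. **Theorem.** Under these assumptions suppose that for some constant $c_0>0$ the set $\mathbf G(c_0)=\{g\in\mathbf G:|\sum_jg_j\xi_ja_j|\ge c_0\}$ satisfies $$|\mathbf G(c_0)|>2^J-\lceil2^J(1-\alpha)\rceil .$$ Then for every $\delta>0$ there is a constant $c_\mu>0$, depending only on $\delta$,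 $\tau$, $\alpha$, $c_0$, $\mathcal J_s$, the dimensions $J,d_w,d_\phi$ and the limits $(\xi_j,Q_{\Psi,\Psi,j},Q_{\Psi,X,j},\Sigma_j)_j$, $A_1$, $G$, such that in every such model with $|\mu_\beta|>c_\mu$, $$\liminf_{n\to\infty}\mathbb P(\phi_n^{cr}\ge\phi_n)\ge1-\delta .$$ -/

import Mathlib

open MeasureTheory ProbabilityTheory Filter Topology Matrix

namespace IVQR

/-! ## Vectors, norms, quantiles, modes of convergence -/

/-- Column vectors of length `d`. -/
abbrev Vec (d : ℕ) := Fin d → ℝ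

/-- Index set of the coordinates of `Ψ = (W, Φ)`. -/
abbrev Idx (dw dphi : ℕ) := Fin dw ⊕ Fin dphi

/-- The Euclidean norm of a vector. -/
noncomputable def norm2 {ι : Type*} [Fintype ι] (v : ι → ℝ) : ℝ := ‖WithLp.toLp 2 v‖

open scoped Matrix.Norms.L2Operator in
/-- The operator norm of a matrix with respect to the Euclidean norms. -/
noncomputable def opNorm {ι κ : Type*} [Fintype ι] [Fintype κ] [DecidableEq κ]
    (A : Matrix ι κ ℝ) : ℝ := ‖A‖

/-- The weighted norm `‖u‖_A = (uᵀ A u)^(1/2)`. -/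
noncomputable def wnorm {ι : Type*} [Fintype ι] (A : Matrix ι ι ℝ) (u : ι → ℝ) : ℝ :=
  Real.sqrt (u ⬝ᵥ A *ᵥ u)

/-- The weighted norm `‖u‖_a = (u a u)^(1/2)` of a scalar `u`. -/
noncomputable def wabs (a u : ℝ) : ℝ := Real.sqrt (u * a * u)

/-- The `q`-quantile of a finite family of reals (with multiplicity), that is the smallest `x` such
that at least the fraction `q` of the family is `≤ x`.  For `0 < q ≤ 1` this is the
`⌈q * N⌉`-th order statistic of the family, `N` being the number of its members. -/
noncomputable def quantile {ι : Type*} [Fintype ι] (T : ι → ℝ) (q : ℝ) : ℝ :=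
  sInf {x : ℝ | q * (Fintype.card ι : ℝ) ≤ ((Finset.univ.filter fun g => T g ≤ x).card : ℝ)}

/-- The check function `ρ_τ(u) = u (τ - 1{u ≤ 0})`. -/
noncomputable def rho (τ u : ℝ) : ℝ := u * (τ - if u ≤ 0 then 1 else 0)

/-- The group `G = {-1, 1}^J` of sign vectors. -/
abbrev Signs (J : ℕ) := Fin J → ℤˣ

/-- The `j`-th sign as a real number. -/
def sgn {J : ℕ} (g : Signs J) (j : Fin J) : ℝ := ((g j : ℤ) : ℝ)

/-- The events `E n` hold with probability approaching one. -/
def WPA1 {Ω : Type*} [MeasurableSpace Ω] (P : Measure Ω) (E : ℕ → Set Ω) : Prop :=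
  Tendsto (fun n => P (E n)ᶜ) atTop (𝓝 0)

/-- `x n = O_p(1)`. -/
def BoundedInProb {Ω : Type*} [MeasurableSpace Ω] (P : Measure Ω) (x : ℕ → Ω → ℝ) : Prop :=
  ∀ ε : ℝ, 0 < ε → ∃ C : ℝ, limsup (fun n => P {ω | C ≤ |x n ω|}) atTop ≤ ENNReal.ofReal ε

/-- `x n = o_p(1)`. -/
def SmallInProb {Ω : Type*} [MeasurableSpace Ω] (P : Measure Ω) (x : ℕ → Ω → ℝ) : Prop :=
  ∀ ε : ℝ, 0 < ε → Tendsto (fun n => P {ω | ε ≤ |x n ω|}) atTop (𝓝 0)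

/-- On `S`, the Jacobian of `H n a e` with respect to `e` exists, is continuous in `(a, e)` uniformly
in `n`, and has full column rank uniformly in `n` and over `S` (for large `n`); the last property is
`λ_min(DᵀD) ≥ c > 0` for the Jacobian matrices `D`, written as a lower bound for `‖D u‖ / ‖u‖`. -/
def UniformJacobian {A E F : Type*} [PseudoMetricSpace A] [NormedAddCommGroup E] [NormedSpace ℝ E]
    [NormedAddCommGroup F] [NormedSpace ℝ F] (H : ℕ → A → E → F) (S : Set (A × E)) : Prop :=
  (∀ᶠ n in atTop, ∀ p ∈ S, DifferentiableAt ℝ (H n p.1) p.2) ∧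
  (∀ ε : ℝ, 0 < ε → ∃ η : ℝ, 0 < η ∧ ∀ᶠ n in atTop, ∀ p ∈ S, ∀ q ∈ S, dist p q < η →
    ‖fderiv ℝ (H n p.1) p.2 - fderiv ℝ (H n q.1) q.2‖ < ε) ∧
  (∃ c : ℝ, 0 < c ∧ ∀ᶠ n in atTop, ∀ p ∈ S, ∀ u : E, c * ‖u‖ ≤ ‖fderiv ℝ (H n p.1) p.2 u‖)

/-- `F`, restricted to `S`, is an open map onto its image `F '' S`. -/
def OpenOntoImage {E F : Type*} [TopologicalSpace E] [TopologicalSpace F] (f : E → F) (S : Set E) :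
    Prop :=
  ∀ U : Set E, IsOpen U → ∃ V : Set F, IsOpen V ∧ f '' (S ∩ U) = f '' S ∩ V

/-! ## The deterministic limits and the cluster strengths -/

/-- The deterministic limits at the given quantile index: cluster shares `ξ_j`, cluster Jacobians
`Q_{Ψ,Ψ,j}` and `Q_{Ψ,X,j}`, the limit `A₁` of the weighting matrix, the limit `G` of `Ĝ`, and the
covariance matrices `Σ_j` of the cluster scores. -/
structure Limits (J dw dphi : ℕ) where
  xi : Fin J → ℝ
  QPsiPsi : Fin J → Matrix (Idx dw dphi) (Idx dw dphi) ℝ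
  QPsiX : Fin J → Idx dw dphi → ℝ
  A1 : Matrix (Fin dphi) (Fin dphi) ℝ
  G : Vec dphi
  Sig : Fin J → Matrix (Fin dphi) (Fin dphi) ℝ

namespace Limits

variable {J dw dphi : ℕ} (L : Limits J dw dphi)

/-- `Q_{Ψ,Ψ} = ∑ ξ_j Q_{Ψ,Ψ,j}`. -/
def QPP : Matrix (Idx dw dphi) (Idx dw dphi) ℝ := ∑ j, L.xi j • L.QPsiPsi j

/-- `Q_{Φ,Φ}`, the lower right block of `Q_{Ψ,Ψ}`. -/
def QPhiPhi : Matrix (Fin dphi) (Fin dphi) ℝ := L.QPP.toBlocks₂₂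

/-- `Q_{Φ,X,j}`, the lower part of `Q_{Ψ,X,j}`. -/
def QPhiXj (j : Fin J) : Vec dphi := fun l => L.QPsiX j (Sum.inr l)

/-- `Q_{Φ,X} = ∑ ξ_j Q_{Φ,X,j}`. -/
def QPhiX : Vec dphi := ∑ j, L.xi j • L.QPhiXj j

/-- The row vector `Q_{Φ,X}ᵀ Q_{Φ,Φ}⁻¹ A₁ Q_{Φ,Φ}⁻¹`. -/
noncomputable def gammaNum : Vec dphi := L.QPhiX ᵥ* (L.QPhiPhi⁻¹ * L.A1 * L.QPhiPhi⁻¹)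

/-- The scalar `Q_{Φ,X}ᵀ Q_{Φ,Φ}⁻¹ A₁ Q_{Φ,Φ}⁻¹ Q_{Φ,X}`. -/
noncomputable def strength : ℝ := L.gammaNum ⬝ᵥ L.QPhiX

/-- The row vector `Γ̃ = (Q_{Φ,X}ᵀ Q_{Φ,Φ}⁻¹ A₁ Q_{Φ,Φ}⁻¹ Q_{Φ,X})⁻¹ Q_{Φ,X}ᵀ Q_{Φ,Φ}⁻¹ A₁ Q_{Φ,Φ}⁻¹`. -/
noncomputable def gammaT : Vec dphi := L.strength⁻¹ • L.gammaNum

/-- `a_j = Γ̃ Q_{Φ,X,j}`. -/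
noncomputable def a (j : Fin J) : ℝ := L.gammaT ⬝ᵥ L.QPhiXj j

/-- `b_j = Gᵀ Q_{Φ,X,j}`. -/
def b (j : Fin J) : ℝ := L.G ⬝ᵥ L.QPhiXj j

/-- The matrix `[v_1, …, v_J]` of size `(d_φ J) × J`, where
`v_jᵀ = -(ξ_1, …, ξ_J) ⊗ (b_j Γ̃) + (0, …, 0, Gᵀ, 0, …, 0)` with `Gᵀ` in the `j`-th block. -/
noncomputable def vmat : Matrix (Fin J × Fin dphi) (Fin J) ℝ :=
  Matrix.of fun p j => -(L.xi p.1 * (L.b j * L.gammaT p.2)) + if p.1 = j then L.G p.2 else 0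

/-- The conditions on the deterministic limits. -/
structure Regular : Prop where
  xi_pos : ∀ j, 0 < L.xi j
  QPP_posDef : L.QPP.PosDef
  orthogonality : ∀ j, (L.QPsiPsi j).toBlocks₁₂ = 0
  A1_posDef : L.A1.PosDef
  strength_pos : 0 < L.strength
  Sig_posDef : ∀ j, (L.Sig j).PosDef
  G_ne : 0 < L.G ⬝ᵥ L.G
  rank_vmat : 1 < L.vmat.rank

/-- `Js` is the set of strong clusters: `|a_j|` and `|b_j|` are bounded away from zero on it, vanish
outside of it, and `⌈|G| (1 - α)⌉ ≤ |G| - 2^(J - J_s + 1)` with `J_s = |Js|`, `|G| = 2^J`. -/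
structure StrongClusters (Js : Finset (Fin J)) (α : ℝ) : Prop where
  strong : ∃ c : ℝ, 0 < c ∧ ∀ j ∈ Js, c ≤ min |L.a j| |L.b j|
  weak : ∀ j, j ∉ Js → L.a j = 0 ∧ L.b j = 0
  enough : ⌈(2 : ℝ) ^ J * (1 - α)⌉₊ + 2 ^ (J - Js.card + 1) ≤ 2 ^ J

/-- `G(c₀) = {g : |∑ g_j ξ_j a_j| ≥ c₀}`. -/
noncomputable def Gset (c₀ : ℝ) : Finset (Signs J) :=
  Finset.univ.filter fun g => c₀ ≤ |∑ j, sgn g j * L.xi j * L.a j|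

end Limits

/-! ## Data and estimators -/

/-- `f_τ` for one observation: `(τ - 1{y - x b - wᵀ r - φᵀ t ≤ 0}) (w, φ) v`. -/
noncomputable def score {dw dphi : ℕ} (τ y x : ℝ) (w : Vec dw) (phi : Vec dphi) (v : ℝ)
    (b : ℝ) (r : Vec dw) (t : Vec dphi) : Idx dw dphi → ℝ :=
  fun k => (τ - if y - x * b - w ⬝ᵥ r - phi ⬝ᵥ t ≤ 0 then 1 else 0) * Sum.elim w phi k * v

/-- A triangular array of clustered data, its population objects and the estimators, at one quantile
index.  `n` indexes the stages of the asymptotics; at stage `n` the `j`-th of the `J` clusters has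
`size n j` observations `(y, X, W, Z)`. -/
structure Model (J dw dphi dz : ℕ) (Ω : Type*) where
  /-- cluster sizes `n_j` -/
  size : ℕ → Fin J → ℕ
  y : ∀ (n : ℕ) (j : Fin J), Fin (size n j) → Ω → ℝ
  X : ∀ (n : ℕ) (j : Fin J), Fin (size n j) → Ω → ℝ
  W : ∀ (n : ℕ) (j : Fin J), Fin (size n j) → Ω → Vec dw
  Z : ∀ (n : ℕ) (j : Fin J), Fin (size n j) → Ω → Vec dz
  /-- the convergence rate `r_n` of the score -/
  rate : ℕ → ℝ
  /-- `β_0` -/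
  beta0 : ℝ
  /-- the local parameter `μ_β` -/
  muBeta : ℝ
  gamma0 : Vec dw
  muGamma : Vec dw
  /-- the parameter sets `ℬ`, `ℛ`, `Θ` -/
  B : Set ℝ
  R : Set (Vec dw)
  Theta : Set (Vec dphi)
  /-- the instrument `Φ(W, Z)` and the weight `V(W, Z)` -/
  Phi : ℕ → Fin J → Vec dw → Vec dz → Vec dphi
  V : ℕ → Fin J → Vec dw → Vec dz → ℝ
  /-- their estimators, which are random functions of `(W, Z)` -/
  PhiHat : ℕ → Fin J → Ω → Vec dw → Vec dz → Vec dphi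
  VHat : ℕ → Fin J → Ω → Vec dw → Vec dz → ℝ
  /-- `dens n j i s (x, w, z)` is the conditional density of `y` at `s` given `(X, W, Z) = (x, w, z)` -/
  dens : ∀ (n : ℕ) (j : Fin J), Fin (size n j) → ℝ → ℝ × Vec dw × Vec dz → ℝ
  /-- the limit of the population objective -/
  Qinf : ℝ → Vec dw → Vec dphi → ℝ
  /-- minimizers of the population objectives -/
  gammaN : ℕ → ℝ → Vec dw
  thetaN : ℕ → ℝ → Vec dphi
  gammaInf : ℝ → Vec dw
  thetaInf : ℝ → Vec dphi
  /-- the limit of `Π(b, r, 0)` as a function of `(b, r)` -/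
  PiInf : ℝ × Vec dw → Idx dw dphi → ℝ
  /-- the estimators `γ̂(b)`, `θ̂(b)`, `β̂` -/
  gammaHat : ℕ → Ω → ℝ → Vec dw
  thetaHat : ℕ → Ω → ℝ → Vec dphi
  betaHat : ℕ → Ω → ℝ
  /-- the bootstrap estimators `γ̂*_g(b)`, `θ̂*_g(b)`, `β̂*_g` -/
  gammaStar : ℕ → Signs J → Ω → ℝ → Vec dw
  thetaStar : ℕ → Signs J → Ω → ℝ → Vec dphi
  betaStar : ℕ → Signs J → Ω → ℝ
  /-- the weights `Â₁`, `Â₂`, `Ĝ` -/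
  A1Hat : ℕ → Ω → Matrix (Fin dphi) (Fin dphi) ℝ
  A2Hat : ℕ → Ω → ℝ
  GHat : ℕ → Ω → Vec dphi
  /-- the versions of the Gaussian vectors `𝒵_j` -/
  gauss : ℕ → Fin J → Ω → EuclideanSpace ℝ (Fin dphi)

namespace Model

variable {J dw dphi dz : ℕ} {Ω : Type*} (M : Model J dw dphi dz Ω)

/-- The total sample size. -/
def total (n : ℕ) : ℕ := ∑ j, M.size n j

/-- `β_n = β_0 + μ_β / r_n`. -/
noncomputable def betaN (n : ℕ) : ℝ := M.beta0 + M.muBeta / M.rate n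

/-- `γ_n = γ_0 + μ_γ / r_n`, the true coefficient of the controls. -/
noncomputable def gammaTrue (n : ℕ) : Vec dw := M.gamma0 + (M.rate n)⁻¹ • M.muGamma

/-- The vector `(X, W, Z)` of an observation. -/
def XWZ (n : ℕ) (j : Fin J) (i : Fin (M.size n j)) (ω : Ω) : ℝ × Vec dw × Vec dz :=
  (M.X n j i ω, M.W n j i ω, M.Z n j i ω)

/-- `Φ_{i,j}`. -/
def phi (n : ℕ) (j : Fin J) (i : Fin (M.size n j)) (ω : Ω) : Vec dphi :=
  M.Phi n j (M.W n j i ω) (M.Z n j i ω)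

/-- `V_{i,j}`. -/
def v (n : ℕ) (j : Fin J) (i : Fin (M.size n j)) (ω : Ω) : ℝ :=
  M.V n j (M.W n j i ω) (M.Z n j i ω)

/-- `Ψ_{i,j} = (W_{i,j}, Φ_{i,j})`. -/
def psi (n : ℕ) (j : Fin J) (i : Fin (M.size n j)) (ω : Ω) : Idx dw dphi → ℝ :=
  Sum.elim (M.W n j i ω) (M.phi n j i ω)

/-- The function `Φ̂` estimated from the sample point `ω`, at the `(W, Z)` of the sample point `ω'`. -/
def phiHat (n : ℕ) (j : Fin J) (i : Fin (M.size n j)) (ω ω' : Ω) : Vec dphi :=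
  M.PhiHat n j ω (M.W n j i ω') (M.Z n j i ω')

/-- The function `V̂` estimated from the sample point `ω`, at the `(W, Z)` of the sample point `ω'`. -/
def vHat (n : ℕ) (j : Fin J) (i : Fin (M.size n j)) (ω ω' : Ω) : ℝ :=
  M.VHat n j ω (M.W n j i ω') (M.Z n j i ω')

/-- `Ψ̂ = (W, Φ̂)`. -/
def psiHat (n : ℕ) (j : Fin J) (i : Fin (M.size n j)) (ω ω' : Ω) : Idx dw dphi → ℝ :=
  Sum.elim (M.W n j i ω') (M.phiHat n j i ω ω')

/-- `f_τ(D_{i,j}, b, r, t)`. -/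
noncomputable def f (τ : ℝ) (n : ℕ) (j : Fin J) (i : Fin (M.size n j)) (ω : Ω)
    (b : ℝ) (r : Vec dw) (t : Vec dphi) : Idx dw dphi → ℝ :=
  score τ (M.y n j i ω) (M.X n j i ω) (M.W n j i ω) (M.phi n j i ω) (M.v n j i ω) b r t

/-- `f̂_τ(D_{i,j}, b, r, t)`, the functions `Φ̂`, `V̂` being estimated from `ω` and the observation
`D_{i,j}` being that of `ω'`. -/
noncomputable def fHat (τ : ℝ) (n : ℕ) (j : Fin J) (i : Fin (M.size n j)) (ω ω' : Ω)
    (b : ℝ) (r : Vec dw) (t : Vec dphi) : Idx dw dphi → ℝ :=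
  score τ (M.y n j i ω') (M.X n j i ω') (M.W n j i ω') (M.phiHat n j i ω ω')
    (M.vHat n j i ω ω') b r t

/-- The cluster average `ℙ_{n,j} f_τ`. -/
noncomputable def emp (τ : ℝ) (n : ℕ) (j : Fin J) (ω : Ω)
    (b : ℝ) (r : Vec dw) (t : Vec dphi) : Idx dw dphi → ℝ :=
  fun k => (M.size n j : ℝ)⁻¹ * ∑ i, M.f τ n j i ω b r t k

/-- The cluster average `ℙ_{n,j} f̂_τ`. -/
noncomputable def empHat (τ : ℝ) (n : ℕ) (j : Fin J) (ω : Ω)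
    (b : ℝ) (r : Vec dw) (t : Vec dphi) : Idx dw dphi → ℝ :=
  fun k => (M.size n j : ℝ)⁻¹ * ∑ i, M.fHat τ n j i ω ω b r t k

/-- `f_{ε_{i,j}}(e | X, W, Z)`, where `ε = y - X β_n - Wᵀ γ_n`. -/
noncomputable def epsDens (n : ℕ) (j : Fin J) (i : Fin (M.size n j)) (ω : Ω) (e : ℝ) : ℝ :=
  M.dens n j i (e + M.X n j i ω * M.betaN n + M.W n j i ω ⬝ᵥ M.gammaTrue n) (M.XWZ n j i ω)

/-- `∑_j ∑_i ρ_τ(y - X b - Wᵀ r - Φ̂ᵀ t) V̂`. -/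
noncomputable def objective (τ : ℝ) (n : ℕ) (ω : Ω) (b : ℝ) (r : Vec dw) (t : Vec dphi) : ℝ :=
  ∑ j, ∑ i, rho τ (M.y n j i ω - M.X n j i ω * b - M.W n j i ω ⬝ᵥ r - M.phiHat n j i ω ω ⬝ᵥ t)
    * M.vHat n j i ω ω

/-- The null-restricted estimator `γ̂^r = γ̂(β_0)`. -/
def gammaR (n : ℕ) (ω : Ω) : Vec dw := M.gammaHat n ω M.beta0

/-- The bootstrap objective: `objective - ∑_j g_j ∑_i f̂_τ(D_{i,j}, β_0, γ̂^r, 0)ᵀ (r, t)`. -/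
noncomputable def objectiveStar (τ : ℝ) (n : ℕ) (g : Signs J) (ω : Ω)
    (b : ℝ) (r : Vec dw) (t : Vec dphi) : ℝ :=
  M.objective τ n ω b r t
    - ∑ j, sgn g j * ∑ i, M.fHat τ n j i ω ω M.beta0 (M.gammaR n ω) 0 ⬝ᵥ Sum.elim r t

/-- `γ̂ = γ̂(β̂)`. -/
def gammaFin (n : ℕ) (ω : Ω) : Vec dw := M.gammaHat n ω (M.betaHat n ω)

/-- `γ̂*_g = γ̂*_g(β̂*_g)`. -/
def gammaStarFin (n : ℕ) (g : Signs J) (ω : Ω) : Vec dw := M.gammaStar n g ω (M.betaStar n g ω)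

/-! ### Test statistics -/

/-- `T_n = ‖β̂ - β_0‖_{Â₂}`. -/
noncomputable def T (n : ℕ) (ω : Ω) : ℝ := wabs (M.A2Hat n ω) (M.betaHat n ω - M.beta0)

/-- `T*_n(g) = ‖β̂*_g - β̂‖_{Â₂}`. -/
noncomputable def TStar (n : ℕ) (g : Signs J) (ω : Ω) : ℝ :=
  wabs (M.A2Hat n ω) (M.betaStar n g ω - M.betaHat n ω)

/-- `ω ∑_i f̂_τ(D_{i,j}, β̂, γ̂, 0)`: the `Φ`-part of the cluster score. -/
noncomputable def clusterScore (τ : ℝ) (n : ℕ) (j : Fin J) (ω : Ω) : Vec dphi :=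
  fun l => ∑ i, M.fHat τ n j i ω ω (M.betaHat n ω) (M.gammaFin n ω) 0 (Sum.inr l)

/-- `ω ∑_i f̂*_{τ,g}(D_{i,j})`, where `f̂*_{τ,g}(D) = g_j f̂_τ(D, β_0, γ̂^r, 0) + f̂_τ(D, β̂*_g, γ̂*_g, 0)
- f̂_τ(D, β̂, γ̂, 0)`. -/
noncomputable def clusterScoreStar (τ : ℝ) (n : ℕ) (g : Signs J) (j : Fin J) (ω : Ω) : Vec dphi :=
  fun l => ∑ i, (sgn g j * M.fHat τ n j i ω ω M.beta0 (M.gammaR n ω) 0 (Sum.inr l)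
    + M.fHat τ n j i ω ω (M.betaStar n g ω) (M.gammaStarFin n g ω) 0 (Sum.inr l)
    - M.fHat τ n j i ω ω (M.betaHat n ω) (M.gammaFin n ω) 0 (Sum.inr l))

/-- `Ω̂ = n⁻¹ ∑_j s_j s_jᵀ` with the cluster scores `s_j`. -/
noncomputable def OmegaHat (τ : ℝ) (n : ℕ) (ω : Ω) : Matrix (Fin dphi) (Fin dphi) ℝ :=
  (M.total n : ℝ)⁻¹ • ∑ j, vecMulVec (M.clusterScore τ n j ω) (M.clusterScore τ n j ω)

/-- `Ω̂*_g`, the bootstrap counterpart of `Ω̂`. -/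
noncomputable def OmegaStar (τ : ℝ) (n : ℕ) (g : Signs J) (ω : Ω) :
    Matrix (Fin dphi) (Fin dphi) ℝ :=
  (M.total n : ℝ)⁻¹ •
    ∑ j, vecMulVec (M.clusterScoreStar τ n g j ω) (M.clusterScoreStar τ n g j ω)

/-- `Â_CR = (Ĝᵀ Ω̂ Ĝ)⁻¹`. -/
noncomputable def ACR (τ : ℝ) (n : ℕ) (ω : Ω) : ℝ :=
  (M.GHat n ω ⬝ᵥ M.OmegaHat τ n ω *ᵥ M.GHat n ω)⁻¹

/-- `Â*_{CR,g} = (Ĝᵀ Ω̂*_g Ĝ)⁻¹`. -/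
noncomputable def ACRStar (τ : ℝ) (n : ℕ) (g : Signs J) (ω : Ω) : ℝ :=
  (M.GHat n ω ⬝ᵥ M.OmegaStar τ n g ω *ᵥ M.GHat n ω)⁻¹

/-- `T_{CR,n} = ‖β̂ - β_0‖_{Â_CR}`. -/
noncomputable def TCR (τ : ℝ) (n : ℕ) (ω : Ω) : ℝ :=
  wabs (M.ACR τ n ω) (M.betaHat n ω - M.beta0)

/-- `T*_{CR,n}(g) = ‖β̂*_g - β̂‖_{Â*_{CR,g}}`. -/
noncomputable def TCRStar (τ : ℝ) (n : ℕ) (g : Signs J) (ω : Ω) : ℝ :=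
  wabs (M.ACRStar τ n g ω) (M.betaStar n g ω - M.betaHat n ω)

/-- The unstudentized test `φ_n = 1{T_n > ĉ_n(1 - α)}`. -/
noncomputable def test (α : ℝ) (n : ℕ) (ω : Ω) : ℕ :=
  if quantile (fun g => M.TStar n g ω) (1 - α) < M.T n ω then 1 else 0

/-- The test studentized by the cluster-robust variance estimator,
`φ^cr_n = 1{T_{CR,n} > ĉ_{CR,n}(1 - α)}`. -/
noncomputable def testCR (τ α : ℝ) (n : ℕ) (ω : Ω) : ℕ :=
  if quantile (fun g => M.TCRStar τ n g ω) (1 - α) < M.TCR τ n ω then 1 else 0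

/-! ### Expectations -/

variable [MeasurableSpace Ω] (P : Measure Ω)

/-- `ℙ̄_{n,j} f_τ`. -/
noncomputable def pop (τ : ℝ) (n : ℕ) (j : Fin J)
    (b : ℝ) (r : Vec dw) (t : Vec dphi) : Idx dw dphi → ℝ :=
  fun k => (M.size n j : ℝ)⁻¹ * ∑ i, ∫ ω, M.f τ n j i ω b r t k ∂P

/-- `ℙ̄_{n,j} f̂_τ`, the expectation `E f` being taken first and evaluated at `f = f̂` afterwards. -/
noncomputable def popHat (τ : ℝ) (n : ℕ) (j : Fin J) (ω : Ω)
    (b : ℝ) (r : Vec dw) (t : Vec dphi) : Idx dw dphi → ℝ :=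
  fun k => (M.size n j : ℝ)⁻¹ * ∑ i, ∫ ω', M.fHat τ n j i ω ω' b r t k ∂P

/-- `Π(b, r, t) = ℙ̄_n f_τ(D_{i,j}, b, r, t)`. -/
noncomputable def PiN (τ : ℝ) (n : ℕ) (b : ℝ) (r : Vec dw) (t : Vec dphi) : Idx dw dphi → ℝ :=
  fun k => (M.total n : ℝ)⁻¹ * ∑ j, ∑ i, ∫ ω, M.f τ n j i ω b r t k ∂P

/-- The summand `ρ_τ(y - X b - Wᵀ r - Φᵀ t) V` of the population objective. -/
noncomputable def loss (τ : ℝ) (n : ℕ) (j : Fin J) (i : Fin (M.size n j)) (ω : Ω)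
    (b : ℝ) (r : Vec dw) (t : Vec dphi) : ℝ :=
  rho τ (M.y n j i ω - M.X n j i ω * b - M.W n j i ω ⬝ᵥ r - M.phi n j i ω ⬝ᵥ t) * M.v n j i ω

/-- The population objective `𝒬_n(b, r, t)`. -/
noncomputable def QN (τ : ℝ) (n : ℕ) (b : ℝ) (r : Vec dw) (t : Vec dphi) : ℝ :=
  (M.total n : ℝ)⁻¹ * ∑ j, ∑ i, ∫ ω, M.loss τ n j i ω b r t ∂P

/-- The sample objective `𝒬̂_n(b, r, t)`. -/
noncomputable def QHat (τ : ℝ) (n : ℕ) (ω : Ω) (b : ℝ) (r : Vec dw) (t : Vec dphi) : ℝ :=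
  (M.total n : ℝ)⁻¹ * M.objective τ n ω b r t

/-- `ℙ̄_{n,j} f_ε(0 | X, W, Z) Ψ Ψᵀ V`. -/
noncomputable def jacPsi (n : ℕ) (j : Fin J) : Matrix (Idx dw dphi) (Idx dw dphi) ℝ :=
  Matrix.of fun k l => (M.size n j : ℝ)⁻¹ *
    ∑ i, ∫ ω, M.epsDens n j i ω 0 * M.psi n j i ω k * M.psi n j i ω l * M.v n j i ω ∂P

/-- `ℙ̄_{n,j} f_ε(0 | X, W, Z) Ψ X V`. -/
noncomputable def jacX (n : ℕ) (j : Fin J) : Idx dw dphi → ℝ :=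
  fun k => (M.size n j : ℝ)⁻¹ *
    ∑ i, ∫ ω, M.epsDens n j i ω 0 * M.psi n j i ω k * M.X n j i ω * M.v n j i ω ∂P

/-- `δ_{i,j}(v) = X v_b + Wᵀ v_r + Φ̂ᵀ v_t`. -/
def shift (n : ℕ) (j : Fin J) (i : Fin (M.size n j)) (ω ω' : Ω)
    (vb : ℝ) (vr : Vec dw) (vt : Vec dphi) : ℝ :=
  M.X n j i ω' * vb + M.W n j i ω' ⬝ᵥ vr + M.phiHat n j i ω ω' ⬝ᵥ vt

/-- `ℙ̄_{n,j} f_ε(δ(v) | X, W, Z) Ψ̂ Ψ̂ᵀ V̂`. -/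
noncomputable def jacPsiHat (n : ℕ) (j : Fin J) (ω : Ω) (vb : ℝ) (vr : Vec dw) (vt : Vec dphi) :
    Matrix (Idx dw dphi) (Idx dw dphi) ℝ :=
  Matrix.of fun k l => (M.size n j : ℝ)⁻¹ *
    ∑ i, ∫ ω', M.epsDens n j i ω' (M.shift n j i ω ω' vb vr vt)
      * M.psiHat n j i ω ω' k * M.psiHat n j i ω ω' l * M.vHat n j i ω ω' ∂P

/-- `ℙ̄_{n,j} f_ε(δ(v) | X, W, Z) Ψ̂ X V̂`. -/
noncomputable def jacXHat (n : ℕ) (j : Fin J) (ω : Ω) (vb : ℝ) (vr : Vec dw) (vt : Vec dphi) :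
    Idx dw dphi → ℝ :=
  fun k => (M.size n j : ℝ)⁻¹ *
    ∑ i, ∫ ω', M.epsDens n j i ω' (M.shift n j i ω ω' vb vr vt)
      * M.psiHat n j i ω ω' k * M.X n j i ω' * M.vHat n j i ω ω' ∂P

/-- `‖(v_b, v_r, v_t)‖₂ ≤ δ`. -/
def InBall (δ : ℝ) (vb : ℝ) (vr : Vec dw) (vt : Vec dphi) : Prop :=
  vb ^ 2 + vr ⬝ᵥ vr + vt ⬝ᵥ vt ≤ δ ^ 2

/-! ### Assumptions -/

/-- Data, instruments, weights and the statistics formed from them are measurable; the weights are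
nonnegative. -/
structure Meas : Prop where
  y : ∀ n j i, Measurable (M.y n j i)
  X : ∀ n j i, Measurable (M.X n j i)
  W : ∀ n j i, Measurable (M.W n j i)
  Z : ∀ n j i, Measurable (M.Z n j i)
  Phi : ∀ n j, Measurable fun p : Vec dw × Vec dz => M.Phi n j p.1 p.2
  V : ∀ n j, Measurable fun p : Vec dw × Vec dz => M.V n j p.1 p.2
  V_nonneg : ∀ n j w z, 0 ≤ M.V n j w z
  PhiHat : ∀ n j, Measurable fun p : Ω × Vec dw × Vec dz => M.PhiHat n j p.1 p.2.1 p.2.2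
  VHat : ∀ n j, Measurable fun p : Ω × Vec dw × Vec dz => M.VHat n j p.1 p.2.1 p.2.2
  VHat_nonneg : ∀ n j ω w z, 0 ≤ M.VHat n j ω w z
  betaHat : ∀ n, Measurable (M.betaHat n)
  gammaFin : ∀ n, Measurable (M.gammaFin n)
  gammaR : ∀ n, Measurable (M.gammaR n)
  betaStar : ∀ n g, Measurable (M.betaStar n g)
  gammaStarFin : ∀ n g, Measurable (M.gammaStarFin n g)
  A2Hat : ∀ n, Measurable (M.A2Hat n)
  GHat : ∀ n, Measurable (M.GHat n)

/-- With probability approaching one, the estimators solve the minimization problems that define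
them. -/
structure IsEstimator (τ : ℝ) : Prop where
  quantreg : WPA1 P fun n => {ω | ∀ b ∈ M.B, ∀ r t,
    M.objective τ n ω b (M.gammaHat n ω b) (M.thetaHat n ω b) ≤ M.objective τ n ω b r t}
  beta : WPA1 P fun n => {ω | M.betaHat n ω ∈ M.B ∧ ∀ b ∈ M.B,
    wnorm (M.A1Hat n ω) (M.thetaHat n ω (M.betaHat n ω)) ≤ wnorm (M.A1Hat n ω) (M.thetaHat n ω b)}
  quantregStar : ∀ g, WPA1 P fun n => {ω | ∀ b ∈ M.B, ∀ r t,
    M.objectiveStar τ n g ω b (M.gammaStar n g ω b) (M.thetaStar n g ω b)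
      ≤ M.objectiveStar τ n g ω b r t}
  betaStar : ∀ g, WPA1 P fun n => {ω | M.betaStar n g ω ∈ M.B ∧ ∀ b ∈ M.B,
    wnorm (M.A1Hat n ω) (M.thetaStar n g ω (M.betaStar n g ω))
      ≤ wnorm (M.A1Hat n ω) (M.thetaStar n g ω b)}

/-- The quantile restriction, the parameter space, the conditional density, and the population
Jacobian with respect to `(r, t)`. -/
structure Basic (τ : ℝ) : Prop where
  quantile_restriction : ∀ n j (i : Fin (M.size n j)),
    P[({ω | M.y n j i ω ≤ M.X n j i ω * M.betaN n + M.W n j i ω ⬝ᵥ M.gammaTrue n}.indicator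
        fun _ => (1 : ℝ)) |
      MeasurableSpace.comap (fun ω => (M.W n j i ω, M.Z n j i ω)) inferInstance]
      =ᵐ[P] fun _ => τ
  B_compact : IsCompact M.B
  B_convex : Convex ℝ M.B
  beta_mem : ∀ᶠ n in atTop, M.betaN n ∈ interior M.B
  dens_measurable : ∀ n j (i : Fin (M.size n j)),
    Measurable fun p : (ℝ × Vec dw × Vec dz) × ℝ => M.dens n j i p.2 p.1
  dens_nonneg : ∀ n j (i : Fin (M.size n j)) s x, 0 ≤ M.dens n j i s x
  dens_law : ∀ n j (i : Fin (M.size n j)),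
    P.map (fun ω => (M.XWZ n j i ω, M.y n j i ω))
      = ((P.map (M.XWZ n j i)).prod volume).withDensity
          fun p => ENNReal.ofReal (M.dens n j i p.2 p.1)
  dens_bounded : ∃ C : ℝ, ∀ n j (i : Fin (M.size n j)) s x, M.dens n j i s x ≤ C
  R_compact : IsCompact M.R
  R_convex : Convex ℝ M.R
  Theta_compact : IsCompact M.Theta
  Theta_convex : Convex ℝ M.Theta
  jacobian : UniformJacobian
    (fun n (b : ℝ) (p : Vec dw × Vec dphi) => M.PiN P τ n b p.1 p.2) (M.B ×ˢ (M.R ×ˢ M.Theta))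
  moment : ∃ a : ℝ, 0 < a ∧ ∃ C : NNReal, ∀ n j (i : Fin (M.size n j)),
    ∫⁻ ω, ENNReal.ofReal (norm2 (M.psi n j i ω) ^ (2 + a)) ∂P ≤ C

/-- The expectations that occur in the other conditions are finite. -/
structure FiniteExpectations (τ : ℝ) : Prop where
  loss : ∀ n j (i : Fin (M.size n j)) b r t, Integrable (fun ω => M.loss τ n j i ω b r t) P
  psi_sq : ∀ n j (i : Fin (M.size n j)),
    Integrable (fun ω => norm2 (M.psi n j i ω) ^ 2 * M.v n j i ω) P
  psi_X : ∀ n j (i : Fin (M.size n j)),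
    Integrable (fun ω => norm2 (M.psi n j i ω) * |M.X n j i ω| * M.v n j i ω) P
  psiHat : ∀ n j (i : Fin (M.size n j)), ∀ᵐ ω ∂P,
    Integrable (fun ω' => norm2 (M.psiHat n j i ω ω') * M.vHat n j i ω ω') P
  psiHat_sq : ∀ n j (i : Fin (M.size n j)), ∀ᵐ ω ∂P,
    Integrable (fun ω' => norm2 (M.psiHat n j i ω ω') ^ 2 * M.vHat n j i ω ω') P
  psiHat_X : ∀ n j (i : Fin (M.size n j)), ∀ᵐ ω ∂P,
    Integrable (fun ω' => norm2 (M.psiHat n j i ω ω') * |M.X n j i ω'| * M.vHat n j i ω ω') P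

/-- Asymptotic behaviour of the objectives, the scores, the Jacobians and the cluster sizes. -/
structure Asymptotics (τ : ℝ) (L : Limits J dw dphi) : Prop where
  /-- unique minimizers of the population objectives -/
  min_n : ∀ᶠ n in atTop, ∀ b ∈ M.B, ∀ r t, (r, t) ≠ (M.gammaN n b, M.thetaN n b) →
    M.QN P τ n b (M.gammaN n b) (M.thetaN n b) < M.QN P τ n b r t
  min_inf : ∀ b ∈ M.B, ∀ r t, (r, t) ≠ (M.gammaInf b, M.thetaInf b) →
    M.Qinf b (M.gammaInf b) (M.thetaInf b) < M.Qinf b r t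
  cont_n : ∀ᶠ n in atTop, ContinuousOn (fun b => (M.gammaN n b, M.thetaN n b)) M.B
  cont_inf : ContinuousOn (fun b => (M.gammaInf b, M.thetaInf b)) M.B
  min_mem : ∀ᶠ n in atTop, ∀ b ∈ M.B, (M.gammaN n b, M.thetaN n b) ∈ interior (M.R ×ˢ M.Theta)
  /-- uniform convergence of the objectives over `b` -/
  obj_pop : ∀ r t, TendstoUniformlyOn (fun n b => M.QN P τ n b r t) (fun b => M.Qinf b r t)
    atTop M.B
  obj_sample : ∀ r t, ∀ ε : ℝ, 0 < ε → Tendsto (fun n => P {ω | ∃ b ∈ M.B,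
    ε ≤ |M.QHat τ n ω b r t - M.QN P τ n b r t|}) atTop (𝓝 0)
  /-- stochastic equicontinuity -/
  equicont : ∀ ε : ℝ, 0 < ε → Tendsto (fun δ : ℝ => limsup (fun n => P {ω | ∃ j vb vr vt,
      InBall (dw := dw) (dphi := dphi) δ vb vr vt ∧
      ε ≤ norm2 (M.rate n •
        ((M.empHat τ n j ω (M.betaN n + vb) (M.gammaTrue n + vr) vt
            - M.emp τ n j ω (M.betaN n) (M.gammaTrue n) 0)
          - (M.popHat P τ n j ω (M.betaN n + vb) (M.gammaTrue n + vr) vt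
            - M.pop P τ n j (M.betaN n) (M.gammaTrue n) 0)))}) atTop) (𝓝[>] 0) (𝓝 0)
  /-- local uniform consistency of the Jacobians -/
  jacPsiHat : ∀ ε : ℝ, 0 < ε → Tendsto (fun δ : ℝ => limsup (fun n => P {ω | ∃ j vb vr vt,
      InBall (dw := dw) (dphi := dphi) δ vb vr vt ∧
      ε ≤ opNorm (M.jacPsiHat P n j ω vb vr vt - L.QPsiPsi j)}) atTop) (𝓝[>] 0) (𝓝 0)
  jacXHat : ∀ ε : ℝ, 0 < ε → Tendsto (fun δ : ℝ => limsup (fun n => P {ω | ∃ j vb vr vt,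
      InBall (dw := dw) (dphi := dphi) δ vb vr vt ∧
      ε ≤ norm2 (M.jacXHat P n j ω vb vr vt - L.QPsiX j)}) atTop) (𝓝[>] 0) (𝓝 0)
  jacPsi : ∀ j, Tendsto (fun n => M.jacPsi P n j) atTop (𝓝 (L.QPsiPsi j))
  jacX : ∀ j, Tendsto (fun n => M.jacX P n j) atTop (𝓝 (L.QPsiX j))
  /-- the rate of the cluster scores -/
  rate_tendsto : Tendsto M.rate atTop atTop
  rate_le : M.rate =O[atTop] fun n => Real.sqrt (M.total n)
  score_rate : ∀ j, BoundedInProb P fun n ω =>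
    M.rate n * norm2 (M.emp τ n j ω (M.betaN n) (M.gammaTrue n) 0)
  /-- a fixed number of large clusters -/
  total_tendsto : Tendsto M.total atTop atTop
  share : ∀ j, Tendsto (fun n => (M.size n j : ℝ) / (M.total n : ℝ)) atTop (𝓝 (L.xi j))

/-- Joint asymptotic normality of the scores `ℙ_{n,j} f̃_τ`, the `Φ`-parts of `ℙ_{n,j} f_τ`, with
independent Gaussian limits across clusters. -/
structure Normality (τ : ℝ) (L : Limits J dw dphi) : Prop where
  measurable : ∀ n j, Measurable (M.gauss n j)
  law : ∀ n j, P.map (M.gauss n j) = multivariateGaussian 0 (L.Sig j)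
  indep : ∀ n, iIndepFun (fun j => M.gauss n j) P
  approx : ∀ j, SmallInProb P fun n ω =>
    ‖WithLp.toLp 2 (fun l => M.rate n * M.emp τ n j ω (M.betaN n) (M.gammaTrue n) 0 (Sum.inr l))
      - M.gauss n j ω‖

/-- Strong identification. -/
structure StrongIdentification (τ : ℝ) (L : Limits J dw dphi) : Prop where
  jacobian : UniformJacobian
    (fun n (_ : Unit) (p : ℝ × Vec dw) => M.PiN P τ n p.1 p.2 0) (Set.univ ×ˢ (M.B ×ˢ M.R))
  PiInf_lim : ∀ p ∈ M.B ×ˢ M.R, Tendsto (fun n => M.PiN P τ n p.1 p.2 0) atTop (𝓝 (M.PiInf p))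
  image_simplyConnected : SimplyConnectedSpace (M.PiInf '' (M.B ×ˢ M.R))
  openOntoImage : OpenOntoImage M.PiInf (M.B ×ˢ M.R)
  weight : SmallInProb P fun n ω => opNorm (M.A1Hat n ω - L.A1)

/-- Consistency of the weight `Ĝ` in the cluster-robust variance estimator. -/
def WeightConsistent (L : Limits J dw dphi) : Prop :=
  SmallInProb P fun n ω => norm2 (M.GHat n ω - L.G)

/-- All conditions on the data and the estimators. -/
structure Assumptions (τ : ℝ) (L : Limits J dw dphi) : Prop where
  meas : M.Meas
  estimator : M.IsEstimator P τ
  basic : M.Basic P τ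
  finite : M.FiniteExpectations P τ
  asymptotics : M.Asymptotics P τ L
  normality : M.Normality P τ L
  identification : M.StrongIdentification P τ L
  weight : M.WeightConsistent P L

end Model

end IVQR

open IVQR

/-! For a large local parameter the studentized test rejects with probability close to one, and then
`testCR` dominates `test` whatever the latter does. It suffices to bound the bootstrap critical
value by a constant free of `μ_β`, while the studentized statistic grows with `|μ_β|`.

Let `s_j` be the `Φ`-part of the score of cluster `j` at the truth, scaled by `r_n`, and let `k =
r_n (β̂*_g - β̂)`. Since the `W, Φ` blocks vanish, the estimation of `γ` does not affect the
`Φ`-scores to first order. After multiplication by `Gᵀ`, the scaled cluster scores in `Ω̂` are `Gᵀ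
s_j - b_j r_n (β̂ - β_n)`, and those in `Ω̂*_g` are `g_j (Gᵀ s_j + μ_β b_j) - b_j k`, up to
`o_p(1)`.

The scores in `Ω̂` do not involve `μ_β` and are bounded, because `r_n |β̂ - β_n|` is bounded by the
scores (`IsSelector.exists_rate_mul_le`). Hence `√N T_CR`, the ratio of `|μ_β + O(1)|` to a bounded
studentizer, is large. The studentizer must not vanish; this holds because a combination of two
strong cluster scores that eliminates `β̂` is close to a nondegenerate Gaussian variable
(`exists_gauss_bounds`).

For the bootstrap, suppose `g` takes both signs on the strong clusters. Then `g_j μ_β` and `k` have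
opposite signs (weakly) for some strong `j`, so `|g_j μ_β - k| = |μ_β| + |k|`, and the score of that
cluster is at least `c |k|` once `c |μ_β|` dominates the noise. The studentizer is thus at least a
multiple of the numerator `|k|`, and the ratio is bounded (`div_sqrt_sum_le`). The remaining sign
vectors are too few to influence the quantile (`quantile_le_of_nonconstant`).

The expansions rest on consistency, obtained from convexity (`exists_finset_argmin_close`) and
global identification (`injOn_PiInf`), and on linearized first-order conditions
(`IsMinimizer.isLittleO_firstOrder`). The bootstrap estimators minimize the sample objective with an
added linear term of order `1 / r_n`, so the same lemmas cover them. Convergence in probability is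
treated as convergence along the filter `probFilter P A`, where `A n` are events of large
probability on which the scores are bounded; `O_p` and `o_p` become `O` and `o`. -/

namespace IVQR

/-! ### Injectivity from simple connectedness of the image -/

section Topological

/-- A locally injective continuous map from a compact convex set, open onto a simply connected
image, is injective. -/
theorem injOn_of_openOntoImage {E F : Type*} [NormedAddCommGroup E] [NormedSpace ℝ E]
    [TopologicalSpace F] [T2Space F] {S : Set E} (hS : IsCompact S) (hconv : Convex ℝ S)
    {f : E → F} (hf : ContinuousOn f S)
    (hloc : ∃ η : ℝ, 0 < η ∧ ∀ p ∈ S, ∀ q ∈ S, dist p q < η → f p = f q → p = q)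
    (hopen : OpenOntoImage f S) (hsc : SimplyConnectedSpace (f '' S)) : Set.InjOn f S := by
  obtain ⟨η, hη, hloc⟩ := hloc
  have : CompactSpace S := isCompact_iff_compactSpace.mp hS
  let g : S → f '' S := fun x => ⟨f x, Set.mem_image_of_mem f x.2⟩
  have hg : Continuous g := (continuousOn_iff_continuous_domRestrict.mp hf).subtype_mk _
  have hgo : IsOpenMap g := by
    intro U hU
    obtain ⟨U', hU', rfl⟩ := isOpen_induced_iff.mp hU
    obtain ⟨V, hV, hVeq⟩ := hopen U' hU'
    refine isOpen_induced_iff.mpr ⟨V, hV, ?_⟩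
    ext ⟨y, hy⟩
    simp only [Set.mem_preimage, Set.mem_image, Subtype.exists]
    constructor
    · intro hyV
      have : y ∈ f '' (S ∩ U') := by rw [hVeq]; exact ⟨hy, hyV⟩
      obtain ⟨x, ⟨hxS, hxU⟩, hx⟩ := this
      exact ⟨x, hxS, hxU, Subtype.ext hx⟩
    · rintro ⟨x, hxS, hxU, hx⟩
      have h1 : f x = y := congrArg Subtype.val hx
      have : y ∈ f '' (S ∩ U') := ⟨x, ⟨hxS, hxU⟩, h1⟩
      rw [hVeq] at this
      exact this.2
  have hlh : IsLocalHomeomorph g := by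
    rw [isLocalHomeomorph_iff_isOpenEmbedding_restrict]
    intro x
    -- Two points of a ball of radius `η / 2` are less than `η` apart, so `hloc` applies to them.
    refine ⟨Metric.ball x (η / 2), Metric.ball_mem_nhds _ (by positivity), ?_⟩
    refine .of_continuous_injective_isOpenMap ?_ ?_ ?_
    · exact hg.comp continuous_subtype_val
    · rintro ⟨p, hp⟩ ⟨q, hq⟩ hpq
      have h1 : f p = f q := congrArg Subtype.val hpq
      have h2 : dist p q < η := by
        have := dist_triangle_right p q x
        rw [Metric.mem_ball] at hp hq
        linarith
      exact Subtype.ext (Subtype.ext (hloc p p.2 q q.2 h2 h1))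
    · exact hgo.domRestrict Metric.isOpen_ball
  -- A local homeomorphism from a compact space to a Hausdorff space is a covering map.
  have hcov : IsCoveringMap g := isLocalHomeomorph_iff_isCoveringMap.mp hlh
  intro x hx y hy hxy
  have : PathConnectedSpace S := isPathConnected_iff_pathConnectedSpace.mp
    (hconv.isPathConnected ⟨x, hx⟩)
  let γ : Path (⟨x, hx⟩ : S) ⟨y, hy⟩ := PathConnectedSpace.somePath _ _
  have hgxy : g ⟨x, hx⟩ = g ⟨y, hy⟩ := Subtype.ext hxy
  let γ₁ : Path (g ⟨x, hx⟩) (g ⟨x, hx⟩) := (γ.map hg).cast rfl hgxy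
  have hhom : γ₁.Homotopic (Path.refl _) := SimplyConnectedSpace.paths_homotopic _ _
  -- A path joining two points of one fibre maps to a loop, which is null-homotopic. Its lift
  -- therefore ends where the lift of the constant path ends, so the two points coincide.
  have key := hcov.liftPath_apply_one_eq_of_homotopicRel hhom ⟨x, hx⟩ (by simp) (by simp)
  have h1 : γ.toContinuousMap = hcov.liftPath γ₁.toContinuousMap ⟨x, hx⟩ (by simp) := by
    rw [hcov.eq_liftPath_iff']
    refine ⟨?_, by simp⟩
    ext t
    simp [γ₁]
  have h2 : (Path.refl (⟨x, hx⟩ : S)).toContinuousMap =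
      hcov.liftPath (Path.refl (g ⟨x, hx⟩)).toContinuousMap ⟨x, hx⟩ (by simp) := by
    rw [hcov.eq_liftPath_iff']
    refine ⟨?_, by simp⟩
    ext t
    simp
  rw [← h1, ← h2] at key
  simpa using congrArg Subtype.val key.symm

end Topological

/-! ### Stability of minimizers of convex functions -/

section Argmin

variable {ι : Type*} [Fintype ι]

/-- A convex function on `ι → ℝ` that is bounded by `M` at the origin and at the vertices of a cube
is Lipschitz on a smaller ball, with a constant that depends only on `M`. -/
theorem lipschitzOnWith_of_vertices [DecidableEq ι] {f : (ι → ℝ) → ℝ}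
    (hf : ConvexOn ℝ Set.univ f) {R M : ℝ} (h0 : |f 0| ≤ M)
    (hv : ∀ x ∈ Set.pi Set.univ (fun _ : ι => ({-(R + 1), R + 1} : Set ℝ)), |f x| ≤ M) :
    LipschitzOnWith (2 * (3 * M)).toNNReal f (Metric.ball 0 R) := by
  have hup : ∀ x : ι → ℝ, dist x 0 < R + 1 → f x ≤ M := by
    intro x hx
    have hR : 0 ≤ R + 1 := dist_nonneg.trans hx.le
    have hmem : x ∈ convexHull ℝ (Set.pi Set.univ (fun _ : ι => ({-(R + 1), R + 1} : Set ℝ))) := by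
      rw [convexHull_pi]
      intro i _
      rw [convexHull_pair, segment_eq_Icc (by linarith)]
      have := (norm_le_pi_norm x i).trans (by simpa using hx.le)
      rw [Real.norm_eq_abs, abs_le] at this
      exact this
    obtain ⟨y, hy, hxy⟩ := hf.exists_ge_of_mem_convexHull (Set.subset_univ _) hmem
    exact hxy.trans ((le_abs_self _).trans (hv y hy))
  have hM0 : 0 ≤ M := (abs_nonneg _).trans h0
  have := ConvexOn.lipschitzOnWith_of_abs_le (f := f) (x₀ := 0) (r := R + 1) (ε := 1) (M := 3 * M)
    (hf.subset (Set.subset_univ _) (convex_ball _ _)) one_pos ?_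
  · simpa using this
  · intro x hx
    have h1 := hup x hx
    have h2 := hup (-x) (by simpa using hx)
    -- The origin is the midpoint of `x` and `-x`, so `f x ≥ 2 f 0 - f (-x) ≥ -3M`: the upper bound
    -- at the vertices also gives a lower bound.
    have h3 := hf.2 (Set.mem_univ x) (Set.mem_univ (-x))
      (show (0 : ℝ) ≤ 1 / 2 by norm_num) (show (0 : ℝ) ≤ 1 / 2 by norm_num) (by norm_num)
    have h4 : (1 / 2 : ℝ) • x + (1 / 2 : ℝ) • (-x) = 0 := by simp
    rw [h4] at h3
    simp only [smul_eq_mul] at h3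
    have := (abs_le.mp h0).1
    rw [abs_le]
    constructor <;> linarith

/-- Minimizers of convex functions depend continuously on the function, uniformly over a compact
set of parameters; closeness of the functions is only required on a finite set of points. -/
theorem exists_finset_argmin_close [DecidableEq ι] {T : Type*} [TopologicalSpace T] {K : Set T}
    (hK : IsCompact K)
    {q : T → (ι → ℝ) → ℝ} (hconv : ∀ b ∈ K, ConvexOn ℝ Set.univ (q b))
    (hcont : ∀ x, ContinuousOn (fun b => q b x) K) {m : T → ι → ℝ} (hm : ContinuousOn m K)
    (hmin : ∀ b ∈ K, ∀ x, x ≠ m b → q b (m b) < q b x) {ε : ℝ} (hε : 0 < ε) :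
    ∃ (F : Finset (ι → ℝ)) (η : ℝ), 0 < η ∧ ∀ b ∈ K, ∀ f : (ι → ℝ) → ℝ,
      ConvexOn ℝ Set.univ f → (∀ x ∈ F, |f x - q b x| ≤ η) →
      ∀ x, (∀ y, f x ≤ f y) → ‖x - m b‖ < ε := by
  obtain ⟨R₀, hR₀⟩ : ∃ R₀ : ℝ, ∀ b ∈ K, ‖m b‖ ≤ R₀ := by
    obtain ⟨C, hC⟩ := (hK.image_of_continuousOn hm).isBounded.exists_norm_le
    exact ⟨C, fun b hb => hC _ (Set.mem_image_of_mem m hb)⟩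
  set R : ℝ := R₀ + ε + 1 with hR
  set W : Set (ι → ℝ) := Set.pi Set.univ (fun _ : ι => ({-(R + 1), R + 1} : Set ℝ)) with hW
  have hWfin : W.Finite := Set.Finite.pi fun _ => by simp
  -- Closeness at these finitely many points forces every competitor `f` to share one Lipschitz
  -- constant with the family `q`.
  set F₁ : Finset (ι → ℝ) := insert 0 hWfin.toFinset with hF₁
  obtain ⟨M, hM⟩ : ∃ M : ℝ, ∀ x ∈ F₁, ∀ b ∈ K, |q b x| ≤ M := by
    choose C hC using fun x => (hK.image_of_continuousOn (hcont x)).isBounded.exists_norm_le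
    obtain ⟨M, hM⟩ := (F₁.image C).exists_le
    exact ⟨M, fun x hx b hb => (hC x _ (Set.mem_image_of_mem _ hb)).trans
      (hM _ (Finset.mem_image_of_mem _ hx))⟩
  set Lp : NNReal := (2 * (3 * (M + 1))).toNNReal with hLp
  have hlip : ∀ b ∈ K, ∀ f : (ι → ℝ) → ℝ, ConvexOn ℝ Set.univ f →
      (∀ x ∈ F₁, |f x - q b x| ≤ 1) → LipschitzOnWith Lp f (Metric.ball 0 R) := by
    intro b hb f hf hfq
    have h1 : ∀ x ∈ F₁, |f x| ≤ M + 1 := by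
      intro x hx
      have h2 := abs_sub_abs_le_abs_sub (f x) (q b x)
      have := hfq x hx
      have := hM x hx b hb
      linarith
    exact lipschitzOnWith_of_vertices hf (h1 0 (by simp [hF₁]))
      fun x hx => h1 x (Finset.mem_insert_of_mem (hWfin.mem_toFinset.mpr hx))
  have hlipq : ∀ b ∈ K, LipschitzOnWith Lp (q b) (Metric.ball 0 R) :=
    fun b hb => hlip b hb _ (hconv b hb) (by simp)
  -- the gap on spheres around the minimizers
  obtain ⟨gap, hgap, hgapq⟩ : ∃ gap : ℝ, 0 < gap ∧ ∀ b ∈ K, ∀ u : ι → ℝ, ‖u‖ = ε →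
      q b (m b) + gap ≤ q b (m b + u) := by
    have hjoint : ContinuousOn (fun p : T × (ι → ℝ) => q p.1 p.2) (K ×ˢ Metric.ball 0 R) :=
      continuousOn_prod_of_continuousOn_lipschitzOnWith' _ Lp hlipq fun x _ => hcont x
    have hfst : ContinuousOn (fun p : T × (ι → ℝ) => m p.1) (K ×ˢ Metric.sphere 0 ε) :=
      hm.comp continuousOn_fst fun p hp => hp.1
    have hmemball : ∀ b ∈ K, ∀ u : ι → ℝ, ‖u‖ ≤ ε → m b + u ∈ Metric.ball (0 : ι → ℝ) R := by
      intro b hb u hu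
      rw [mem_ball_zero_iff]
      have := norm_add_le (m b) u
      have := hR₀ b hb
      linarith
    have hc : ContinuousOn (fun p : T × (ι → ℝ) => q p.1 (m p.1 + p.2) - q p.1 (m p.1))
        (K ×ˢ Metric.sphere 0 ε) := by
      refine ContinuousOn.sub ?_ ?_
      · refine hjoint.comp (continuousOn_fst.prodMk (hfst.add continuousOn_snd)) ?_
        intro p hp
        exact ⟨hp.1, hmemball _ hp.1 _ (by simpa using hp.2.le)⟩
      · refine hjoint.comp (continuousOn_fst.prodMk hfst) ?_
        intro p hp
        exact ⟨hp.1, by simpa using hmemball _ hp.1 0 (by simpa using hε.le)⟩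
    rcases (K ×ˢ Metric.sphere (0 : ι → ℝ) ε).eq_empty_or_nonempty with he | hne
    · refine ⟨1, one_pos, fun b hb u hu => ?_⟩
      have : (b, u) ∈ K ×ˢ Metric.sphere (0 : ι → ℝ) ε := ⟨hb, by simpa using hu⟩
      rw [he] at this
      exact this.elim
    · obtain ⟨p, hp, hpmin⟩ := (hK.prod (isCompact_sphere 0 ε)).exists_isMinOn hne hc
      refine ⟨q p.1 (m p.1 + p.2) - q p.1 (m p.1), ?_, fun b hb u hu => ?_⟩
      · have : p.2 ≠ 0 := by
          intro h0
          have := hp.2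
          rw [h0] at this
          simp at this
          exact hε.ne this
        exact sub_pos.mpr (hmin _ hp.1 _ (by simpa using this))
      · have := hpmin (show (b, u) ∈ K ×ˢ Metric.sphere (0 : ι → ℝ) ε from ⟨hb, by simpa using hu⟩)
        simp only [Set.mem_ofPred_eq] at this
        linarith
  -- The mesh is chosen so that each function varies by at most `gap / 8` between a point and its
  -- neighbour in the net. Adding the discrepancy on the net gives `3 gap / 8`, and two such errors
  -- are still smaller than `gap`.
  set ρ : ℝ := gap / (8 * (Lp + 1)) with hρ
  have hLp0 : (0 : ℝ) ≤ Lp := Lp.2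
  have hρ0 : 0 < ρ := by positivity
  have hLρ : Lp * ρ ≤ gap / 8 := by
    rw [hρ, mul_div_assoc', div_le_div_iff₀ (by positivity) (by norm_num)]
    nlinarith
  obtain ⟨t, htsub, htfin, ht⟩ := Metric.finite_approx_of_totallyBounded
    ((isCompact_closedBall (0 : ι → ℝ) (R₀ + ε)).totallyBounded) ρ hρ0
  refine ⟨F₁ ∪ htfin.toFinset, min 1 (gap / 8), by positivity, ?_⟩
  intro b hb f hf hfq x hx
  have hlipf := hlip b hb f hf fun y hy =>
    (hfq y (Finset.mem_union_left _ hy)).trans (min_le_left _ _)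
  have hball : ∀ y ∈ Metric.closedBall (0 : ι → ℝ) (R₀ + ε), y ∈ Metric.ball (0 : ι → ℝ) R := by
    intro y hy
    rw [mem_closedBall_zero_iff] at hy
    rw [mem_ball_zero_iff]
    linarith
  have hclose : ∀ y : ι → ℝ, ‖y‖ ≤ R₀ + ε → |f y - q b y| ≤ 3 * (gap / 8) := by
    intro y hy
    have hy' : y ∈ Metric.closedBall (0 : ι → ℝ) (R₀ + ε) := by simpa using hy
    obtain ⟨z, hz, hyz⟩ := Set.mem_iUnion₂.mp (ht hy')
    have hz' := htsub hz
    have h1 := hlipf.dist_le_mul y (hball y hy') z (hball z hz')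
    have h2 := (hlipq b hb).dist_le_mul y (hball y hy') z (hball z hz')
    have h3 := (hfq z (by simp [hz])).trans (min_le_right _ _)
    have h4 : Lp * dist y z ≤ gap / 8 :=
      (mul_le_mul_of_nonneg_left (Metric.mem_ball.mp hyz).le hLp0).trans hLρ
    rw [Real.dist_eq] at h1 h2
    rw [abs_le] at *
    constructor <;> linarith [h1.1, h1.2, h2.1, h2.2, h3.1, h3.2]
  -- By convexity, a minimizer of `f` far from `m b` yields a point at distance exactly `ε` from `m
  -- b` where `f` does not exceed `f (m b)`. This contradicts the gap of `q b` on that sphere.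
  by_contra! hfar
  set d : ℝ := ‖x - m b‖ with hd
  have hd0 : 0 < d := hε.trans_le hfar
  set u : ι → ℝ := (ε / d) • (x - m b) with hu
  have hun : ‖u‖ = ε := by
    rw [hu, norm_smul, ← hd, Real.norm_eq_abs, abs_of_pos (by positivity)]
    field_simp
  have hle1 : ε / d ≤ 1 := (div_le_one hd0).mpr hfar
  have hcomb : m b + u = (1 - ε / d) • m b + (ε / d) • x := by
    rw [hu]; module
  have h1 := hf.2 (Set.mem_univ (m b)) (Set.mem_univ x)
    (show 0 ≤ 1 - ε / d by linarith) (show 0 ≤ ε / d by positivity) (by ring)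
  rw [← hcomb] at h1
  simp only [smul_eq_mul] at h1
  have h2 : f (m b + u) ≤ f (m b) := by
    have := mul_le_mul_of_nonneg_left (hx (m b)) (show 0 ≤ ε / d by positivity)
    nlinarith
  have h3 := hclose (m b) ((hR₀ b hb).trans (by linarith))
  have h4 := hclose (m b + u) ((norm_add_le _ _).trans (by linarith [hR₀ b hb]))
  have h5 := hgapq b hb u hun
  rw [abs_le] at h3 h4
  linarith [h3.1, h3.2, h4.1, h4.2]

end Argmin

/-! ### Functions with equicontinuous derivatives -/

section Jacobian

variable {E F : Type*} [NormedAddCommGroup E] [NormedSpace ℝ E]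
  [NormedAddCommGroup F] [NormedSpace ℝ F]

/-- Increments of a function whose derivative varies little. -/
theorem norm_sub_sub_fderiv_le {H : E → F} {S : Set E} (hS : Convex ℝ S)
    (hd : ∀ p ∈ S, DifferentiableAt ℝ H p) {ε η : ℝ}
    (hη : ∀ p ∈ S, ∀ q ∈ S, dist p q < η → ‖fderiv ℝ H p - fderiv ℝ H q‖ < ε)
    {p q : E} (hp : p ∈ S) (hq : q ∈ S) (hpq : dist p q < η) :
    ‖H q - H p - fderiv ℝ H p (q - p)‖ ≤ ε * ‖q - p‖ := by
  have hball : p ∈ S ∩ Metric.ball p η :=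
    ⟨hp, Metric.mem_ball_self (dist_nonneg.trans_lt hpq)⟩
  have hconv : Convex ℝ (S ∩ Metric.ball p η) := hS.inter (convex_ball _ _)
  refine hconv.norm_image_sub_le_of_norm_hasFDerivWithin_le' (f' := fderiv ℝ H)
    (fun x hx => (hd x hx.1).hasFDerivAt.hasFDerivWithinAt) (fun x hx => ?_) hball
    ⟨hq, by rwa [Metric.mem_ball, dist_comm]⟩
  exact (hη x hx.1 p hp hx.2).le

/-- If the derivatives of `H n` are equicontinuous on a compact convex set with interior points and
`H n` is pointwise bounded, then `H n` is equi-Lipschitz for large `n`. -/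
theorem exists_eventually_lipschitz [FiniteDimensional ℝ E] {H : ℕ → E → F} {S : Set E} (hS : Convex ℝ S)
    (hb : Bornology.IsBounded S) (hne : (interior S).Nonempty)
    (hd : ∀ᶠ n in atTop, ∀ p ∈ S, DifferentiableAt ℝ (H n) p)
    (hc : ∀ ε : ℝ, 0 < ε → ∃ η : ℝ, 0 < η ∧ ∀ᶠ n in atTop, ∀ p ∈ S, ∀ q ∈ S, dist p q < η →
      ‖fderiv ℝ (H n) p - fderiv ℝ (H n) q‖ < ε)
    (hbd : ∀ p ∈ S, ∃ C : ℝ, ∀ᶠ n in atTop, ‖H n p‖ ≤ C) :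
    ∃ C : ℝ, 0 ≤ C ∧ ∀ᶠ n in atTop, ∀ p ∈ S, ∀ q ∈ S, ‖H n q - H n p‖ ≤ C * ‖q - p‖ := by
  obtain ⟨η, hη, hη'⟩ := hc 1 one_pos
  obtain ⟨x₀, hx₀⟩ := hne
  have hx₀S : x₀ ∈ S := interior_subset hx₀
  obtain ⟨ρ, hρ, hρS⟩ := Metric.isOpen_iff.mp isOpen_interior x₀ hx₀
  let B := Module.finBasis ℝ E
  obtain ⟨κ, hκ, hκB⟩ := B.exists_opNorm_le (F := F)
  -- the derivative at the interior point is bounded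
  have hdir : ∀ i, ∃ C : ℝ, ∀ᶠ n in atTop, ‖fderiv ℝ (H n) x₀ (B i)‖ ≤ C := by
    intro i
    set s : ℝ := min ρ η / (2 * (‖B i‖ + 1)) with hs
    have hs0 : 0 < s := by positivity
    have hsB : ‖s • B i‖ < min ρ η := by
      rw [norm_smul, Real.norm_eq_abs, abs_of_pos hs0, hs, div_mul_eq_mul_div,
        div_lt_iff₀ (by positivity)]
      have : 0 < min ρ η := by positivity
      nlinarith [norm_nonneg (B i)]
    have hmem : x₀ + s • B i ∈ S := interior_subset (hρS (by
      rw [Metric.mem_ball, dist_self_add_left]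
      exact hsB.trans_le (min_le_left _ _)))
    obtain ⟨C₁, hC₁⟩ := hbd _ hx₀S
    obtain ⟨C₂, hC₂⟩ := hbd _ hmem
    refine ⟨(C₂ + C₁ + ‖s • B i‖) / s, ?_⟩
    filter_upwards [hd, hη', hC₁, hC₂] with n h1 h2 h3 h4
    have h5 := norm_sub_sub_fderiv_le hS h1 h2 hx₀S hmem (by
      rw [dist_self_add_right]
      exact hsB.trans_le (min_le_right _ _))
    simp only [add_sub_cancel_left, map_smul, one_mul] at h5
    rw [le_div_iff₀ hs0]
    have h6 : ‖s • fderiv ℝ (H n) x₀ (B i)‖ = ‖fderiv ℝ (H n) x₀ (B i)‖ * s := by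
      rw [norm_smul, Real.norm_eq_abs, abs_of_pos hs0, mul_comm]
    rw [← h6]
    have h7 : s • fderiv ℝ (H n) x₀ (B i) = H n (x₀ + s • B i) - H n x₀
        - (H n (x₀ + s • B i) - H n x₀ - s • fderiv ℝ (H n) x₀ (B i)) := by abel
    rw [h7]
    refine (norm_sub_le _ _).trans (add_le_add ((norm_sub_le _ _).trans (add_le_add h4 h3)) h5)
  choose C hC using hdir
  obtain ⟨M, hM⟩ := (Finset.univ.image C).exists_le
  set M' := max M 0 with hM'
  obtain ⟨D, hD⟩ := Metric.isBounded_iff.mp hb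
  -- The segment from `x₀` to any point of `S` is cut into `m + 1` pieces shorter than `η`. The
  -- derivative changes by less than one on each, so the bound at `x₀` propagates with an increase
  -- of at most `m + 1`.
  obtain ⟨m, hm⟩ := exists_nat_gt (D / η)
  have hDm : D < (m + 1 : ℝ) * η := by
    rw [div_lt_iff₀ hη] at hm
    nlinarith
  refine ⟨κ * M' + (m + 1), by positivity, ?_⟩
  filter_upwards [hd, hη', eventually_all.mpr hC] with n h1 h2 h3
  have hx₀n : ‖fderiv ℝ (H n) x₀‖ ≤ κ * M' := hκB (le_max_right _ _) fun i =>
    (h3 i).trans ((hM _ (Finset.mem_image_of_mem _ (Finset.mem_univ i))).trans (le_max_left _ _))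
  have hall : ∀ p ∈ S, ‖fderiv ℝ (H n) p‖ ≤ κ * M' + (m + 1) := by
    intro p hp
    have hstep : ∀ k : ℕ, k ≤ m + 1 →
        ‖fderiv ℝ (H n) (x₀ + ((k : ℝ) / (m + 1)) • (p - x₀)) - fderiv ℝ (H n) x₀‖ ≤ k := by
      have hseg : ∀ k : ℕ, k ≤ m + 1 → x₀ + ((k : ℝ) / (m + 1)) • (p - x₀) ∈ S := by
        intro k hk
        refine hS.add_smul_sub_mem hx₀S hp ⟨by positivity, ?_⟩
        rw [div_le_one (by positivity)]
        exact_mod_cast hk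
      intro k
      induction k with
      | zero => intro _; simp
      | succ k ih =>
        intro hk
        have h4 := ih (by omega)
        have h5 := h2 _ (hseg (k + 1) hk) _ (hseg k (by omega)) (by
          rw [dist_add_left, dist_eq_norm, ← sub_smul, ← sub_div]
          push_cast
          rw [add_sub_cancel_left, norm_smul, Real.norm_eq_abs, abs_of_pos (by positivity),
            div_mul_eq_mul_div, one_mul, div_lt_iff₀ (by positivity), ← dist_eq_norm]
          linarith [hD hp hx₀S])
        have h6 := norm_sub_le_norm_sub_add_norm_sub
          (fderiv ℝ (H n) (x₀ + (((k + 1 : ℕ) : ℝ) / (m + 1)) • (p - x₀)))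
          (fderiv ℝ (H n) (x₀ + ((k : ℝ) / (m + 1)) • (p - x₀))) (fderiv ℝ (H n) x₀)
        push_cast at *
        linarith
    have h4 := hstep (m + 1) le_rfl
    push_cast at h4
    rw [div_self (by positivity), one_smul, add_sub_cancel] at h4
    have h5 := norm_le_insert' (fderiv ℝ (H n) p) (fderiv ℝ (H n) x₀)
    linarith
  intro p hp q hq
  exact hS.norm_image_sub_le_of_norm_fderiv_le (fun x hx => h1 x hx) hall hp hq

end Jacobian

/-! ### Convergence in probability along a filter -/

section ProbFilter

variable {Ω : Type*} [MeasurableSpace Ω]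

/-- The filter of the sets of pairs `(n, ω)` that have probability approaching one within the
events `A n`. -/
def probFilter (P : Measure Ω) (A : ℕ → Set Ω) : Filter (ℕ × Ω) where
  sets := {S | Tendsto (fun n => P (A n ∩ {ω | (n, ω) ∉ S})) atTop (𝓝 0)}
  univ_sets := by simp
  sets_of_superset := by
    intro S T hS hST
    refine tendsto_of_tendsto_of_tendsto_of_le_of_le tendsto_const_nhds hS (fun _ => zero_le)
      fun n => measure_mono ?_
    rintro ω ⟨h1, h2⟩
    exact ⟨h1, fun h => h2 (hST h)⟩
  inter_sets := by
    intro S T hS hT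
    have h := hS.add hT
    rw [add_zero] at h
    refine tendsto_of_tendsto_of_tendsto_of_le_of_le tendsto_const_nhds h (fun _ => zero_le)
      fun n => (measure_mono ?_).trans (measure_union_le _ _)
    rintro ω ⟨h1, h2⟩
    by_cases h3 : (n, ω) ∈ S
    · exact Or.inr ⟨h1, fun h4 => h2 ⟨h3, h4⟩⟩
    · exact Or.inl ⟨h1, h3⟩

variable {P : Measure Ω} {A : ℕ → Set Ω}

theorem eventually_probFilter {p : ℕ × Ω → Prop} :
    (∀ᶠ x in probFilter P A, p x) ↔
      Tendsto (fun n => P (A n ∩ {ω | ¬ p (n, ω)})) atTop (𝓝 0) := Iff.rfl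

theorem eventually_probFilter_of_tendsto {p : ℕ × Ω → Prop}
    (h : Tendsto (fun n => P {ω | ¬ p (n, ω)}) atTop (𝓝 0)) : ∀ᶠ x in probFilter P A, p x :=
  eventually_probFilter.mpr <| tendsto_of_tendsto_of_tendsto_of_le_of_le tendsto_const_nhds h
    (fun _ => zero_le) fun _ => measure_mono Set.inter_subset_right

theorem WPA1.eventually {E : ℕ → Set Ω} (h : WPA1 P E) : ∀ᶠ x in probFilter P A, x.2 ∈ E x.1 :=
  eventually_probFilter_of_tendsto h

theorem SmallInProb.tendsto {x : ℕ → Ω → ℝ} (h : SmallInProb P x) :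
    Tendsto (fun p : ℕ × Ω => x p.1 p.2) (probFilter P A) (𝓝 0) := by
  rw [Metric.tendsto_nhds]
  intro ε hε
  refine eventually_probFilter_of_tendsto ?_
  simpa using h ε hε

/-- This transfers deterministic limits in `n` to the filter. -/
theorem tendsto_fst_probFilter : Tendsto Prod.fst (probFilter P A) atTop := by
  intro s hs
  refine eventually_probFilter_of_tendsto (p := fun x => x.1 ∈ s) ?_
  refine (tendsto_congr' ?_).mpr tendsto_const_nhds
  filter_upwards [hs] with n hn
  simp [hn]

theorem eventually_probFilter_of_ae {p : ℕ × Ω → Prop} (h : ∀ n, ∀ᵐ ω ∂P, p (n, ω)) :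
    ∀ᶠ x in probFilter P A, p x := by
  refine eventually_probFilter_of_tendsto ?_
  have : ∀ n, P {ω | ¬ p (n, ω)} = 0 := fun n => ae_iff.mp (h n)
  simp [this]

theorem eventually_mem_probFilter : ∀ᶠ x in probFilter P A, x.2 ∈ A x.1 := by
  rw [eventually_probFilter]
  have : ∀ n, A n ∩ {ω | ω ∉ A n} = ∅ := fun n => by ext; simp
  simp [this]

/-- Failure events that have small probability locally are negligible along every sequence that
converges. -/
theorem eventually_probFilter_of_local {T : ℝ → ℕ → Set Ω}
    (hT : Tendsto (fun δ => limsup (fun n => P (T δ n)) atTop) (𝓝[>] 0) (𝓝 0))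
    {p : ℕ × Ω → Prop} (h : ∀ δ : ℝ, 0 < δ → ∀ᶠ x in probFilter P A, p x ∨ x.2 ∈ T δ x.1) :
    ∀ᶠ x in probFilter P A, p x := by
  rw [eventually_probFilter, ENNReal.tendsto_nhds_zero]
  intro ε hε
  have hε2 : 0 < ε / 2 := ENNReal.half_pos hε.ne'
  -- The radius `δ` is fixed before `n` grows: the local failure event then costs at most `ε / 2`,
  -- and the arguments eventually lie in the ball of radius `δ`.
  obtain ⟨δ, hδT, hδ⟩ := ((hT.eventually (gt_mem_nhds hε2)).and self_mem_nhdsWithin).exists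
  have h1 := eventually_lt_of_limsup_lt hδT
  have h2 := ENNReal.tendsto_nhds_zero.mp (eventually_probFilter.mp (h δ hδ)) _ hε2
  filter_upwards [h1, h2] with n h3 h4
  calc P (A n ∩ {ω | ¬ p (n, ω)})
      ≤ P (A n ∩ {ω | ¬ (p (n, ω) ∨ ω ∈ T δ n)} ∪ T δ n) := by
        refine measure_mono ?_
        rintro ω ⟨h5, h6⟩
        by_cases h7 : ω ∈ T δ n
        · exact Or.inr h7
        · exact Or.inl ⟨h5, by simpa [h7] using h6⟩
    _ ≤ ε / 2 + ε / 2 := (measure_union_le _ _).trans (add_le_add h4 h3.le)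
    _ = ε := ENNReal.add_halves ε

/-- The budget `δ` is split: one half pays for the complement of `A n`, the other for the failures
inside `A n`, whose probability tends to zero. -/
theorem le_liminf_of_eventually_probFilter [IsProbabilityMeasure P] {E : ℕ → Set Ω}
    (hE : ∀ᶠ x in probFilter P A, x.2 ∈ E x.1) {δ : ℝ} (hδ : 0 < δ)
    (hA : ∀ᶠ n in atTop, P (A n)ᶜ ≤ ENNReal.ofReal (δ / 2)) :
    ENNReal.ofReal (1 - δ) ≤ liminf (fun n => P (E n)) atTop := by
  refine le_liminf_of_le (by isBoundedDefault) ?_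
  have h1 := ENNReal.tendsto_nhds_zero.mp (eventually_probFilter.mp hE) (ENNReal.ofReal (δ / 2))
    (by simpa using hδ)
  filter_upwards [h1, hA] with n h2 h3
  have h4 : P (E n)ᶜ ≤ ENNReal.ofReal δ := by
    calc P (E n)ᶜ ≤ P (A n ∩ {ω | ω ∉ E n} ∪ (A n)ᶜ) := by
          refine measure_mono fun ω hω => ?_
          by_cases h7 : ω ∈ A n
          · exact Or.inl ⟨h7, hω⟩
          · exact Or.inr h7
      _ ≤ ENNReal.ofReal (δ / 2) + ENNReal.ofReal (δ / 2) :=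
          (measure_union_le _ _).trans (add_le_add h2 h3)
      _ = ENNReal.ofReal δ := by
          rw [← ENNReal.ofReal_add (by positivity) (by positivity), add_halves]
  have h5 : 1 ≤ P (E n) + P (E n)ᶜ := by
    rw [← measure_univ (μ := P), ← Set.union_compl_self (E n)]
    exact measure_union_le _ _
  rw [ENNReal.ofReal_sub _ hδ.le, ENNReal.ofReal_one, tsub_le_iff_right]
  exact h5.trans (by gcongr)

theorem BoundedInProb.exists_eventually_le {x : ℕ → Ω → ℝ} (h : BoundedInProb P x) {ε : ℝ}
    (hε : 0 < ε) : ∃ C : ℝ, ∀ᶠ n in atTop, P {ω | C ≤ |x n ω|} ≤ ENNReal.ofReal ε := by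
  obtain ⟨C, hC⟩ := h (ε / 2) (by positivity)
  refine ⟨C, ?_⟩
  have : limsup (fun n => P {ω | C ≤ |x n ω|}) atTop < ENNReal.ofReal ε :=
    hC.trans_lt (by rw [ENNReal.ofReal_lt_ofReal_iff hε]; linarith)
  exact (eventually_lt_of_limsup_lt this).mono fun n hn => hn.le

end ProbFilter

/-! ### Tightness and anti-concentration of Gaussian vectors -/

section Gaussian

theorem exists_measure_norm_ge_le {E : Type*} [NormedAddCommGroup E] [MeasurableSpace E]
    [BorelSpace E] (ν : Measure E) [IsFiniteMeasure ν] {ε : ENNReal} (hε : 0 < ε) :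
    ∃ K : ℝ, 0 < K ∧ ν {x | K ≤ ‖x‖} ≤ ε := by
  have h := tendsto_measure_iInter_atTop (μ := ν) (s := fun n : ℕ => {x : E | (n : ℝ) ≤ ‖x‖})
    (fun n => (measurableSet_le measurable_const measurable_norm).nullMeasurableSet)
    (fun m n hmn x hx => le_trans (by exact_mod_cast hmn) (show (n : ℝ) ≤ ‖x‖ from hx))
    ⟨0, measure_ne_top _ _⟩
  have h0 : (⋂ n : ℕ, {x : E | (n : ℝ) ≤ ‖x‖}) = ∅ := by
    ext x
    obtain ⟨n, hn⟩ := exists_nat_gt ‖x‖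
    simp only [Set.mem_iInter, Set.mem_ofPred_eq, Set.mem_empty_iff_false, iff_false, not_forall,
      not_le]
    exact ⟨n, hn⟩
  rw [h0, measure_empty] at h
  obtain ⟨n, hn, hn0⟩ := ((ENNReal.tendsto_nhds_zero.mp h ε hε).and (eventually_gt_atTop 0)).exists
  exact ⟨n, by exact_mod_cast hn0, hn⟩

/-- Continuity from above along balls shrinking to the origin: the absence of an atom there becomes
a quantitative bound that depends on the law only. -/
theorem exists_measure_norm_lt_le {E : Type*} [NormedAddCommGroup E] [MeasurableSpace E]
    [BorelSpace E] (ν : Measure E) [IsFiniteMeasure ν] (h0 : ν {0} = 0) {ε : ENNReal}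
    (hε : 0 < ε) : ∃ κ : ℝ, 0 < κ ∧ ν {x | ‖x‖ < κ} ≤ ε := by
  have h := tendsto_measure_iInter_atTop (μ := ν)
    (s := fun n : ℕ => {x : E | ‖x‖ < 1 / ((n : ℝ) + 1)})
    (fun n => (measurableSet_lt measurable_norm measurable_const).nullMeasurableSet)
    (fun m n hmn x hx => lt_of_lt_of_le (show ‖x‖ < 1 / ((n : ℝ) + 1) from hx)
      (Nat.one_div_le_one_div hmn))
    ⟨0, measure_ne_top _ _⟩
  have h1 : (⋂ n : ℕ, {x : E | ‖x‖ < 1 / ((n : ℝ) + 1)}) ⊆ {0} := by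
    intro x hx
    simp only [Set.mem_iInter, Set.mem_ofPred_eq] at hx
    rw [Set.mem_singleton_iff, ← norm_le_zero_iff]
    exact ge_of_tendsto' tendsto_one_div_add_atTop_nhds_zero_nat fun n => (hx n).le
  rw [measure_mono_null h1 h0] at h
  obtain ⟨n, hn⟩ := (ENNReal.tendsto_nhds_zero.mp h ε hε).exists
  exact ⟨1 / ((n : ℝ) + 1), by positivity, hn⟩

variable {d : ℕ}

/-- A nondegenerate Gaussian vector does not charge hyperplanes. -/
theorem multivariateGaussian_hyperplane {S : Matrix (Fin d) (Fin d) ℝ} (hS : S.PosDef)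
    {u : EuclideanSpace ℝ (Fin d)} (hu : u ≠ 0) (c : ℝ) :
    multivariateGaussian 0 S {z | inner ℝ u z = c} = 0 := by
  -- The variance of the linear form is `uᵀ S u > 0`, so its law is a nondegenerate real Gaussian,
  -- which has no atoms.
  have hvar : 0 < Var[fun z => inner ℝ u z; multivariateGaussian 0 S] := by
    rw [← covarianceBilin_self IsGaussian.memLp_two_id,
      covarianceBilin_multivariateGaussian hS.posSemidef]
    have := hS.dotProduct_mulVec_pos (x := u.ofLp) (by simpa using hu)
    simpa using this
  have h := IsGaussian.map_eq_gaussianReal (μ := multivariateGaussian 0 S) (innerSL ℝ u)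
  have h2 : {z : EuclideanSpace ℝ (Fin d) | inner ℝ u z = c} = innerSL ℝ u ⁻¹' {c} := by
    ext; simp
  rw [h2, ← Measure.map_apply (by fun_prop) (measurableSet_singleton c), h]
  have hv : (Var[innerSL ℝ u; multivariateGaussian 0 S]).toNNReal ≠ 0 := by
    rw [ne_eq, Real.toNNReal_eq_zero, not_le]
    exact hvar
  have := nullSingletonClass_gaussianReal (μ := ∫ x, innerSL ℝ u x ∂(multivariateGaussian 0 S)) hv
  exact measure_singleton c

/-- A nontrivial linear combination of two independent nondegenerate Gaussian vectors stays away
from zero, with a bound that only depends on their laws. -/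
theorem exists_forall_measure_inner_add_inner_lt_le {S₁ S₂ : Matrix (Fin d) (Fin d) ℝ}
    (hS₁ : S₁.PosDef) {u₁ : EuclideanSpace ℝ (Fin d)} (hu₁ : u₁ ≠ 0)
    (u₂ : EuclideanSpace ℝ (Fin d)) {ε : ENNReal} (hε : 0 < ε) :
    ∃ κ : ℝ, 0 < κ ∧ ∀ (Ω : Type*) [MeasurableSpace Ω] (P : Measure Ω) [IsProbabilityMeasure P]
      (Z₁ Z₂ : Ω → EuclideanSpace ℝ (Fin d)), Measurable Z₁ → Measurable Z₂ →
      P.map Z₁ = multivariateGaussian 0 S₁ → P.map Z₂ = multivariateGaussian 0 S₂ →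
      IndepFun Z₁ Z₂ P → P {ω | |inner ℝ u₁ (Z₁ ω) + inner ℝ u₂ (Z₂ ω)| < κ} ≤ ε := by
  set L : EuclideanSpace ℝ (Fin d) × EuclideanSpace ℝ (Fin d) → ℝ :=
    fun z => inner ℝ u₁ z.1 + inner ℝ u₂ z.2 with hL
  have hLm : Measurable L := by fun_prop
  set ν : Measure ℝ := ((multivariateGaussian 0 S₁).prod (multivariateGaussian 0 S₂)).map L with hν
  have : IsFiniteMeasure ν := by rw [hν]; infer_instance
  have h0 : ν {0} = 0 := by
    rw [hν, Measure.map_apply hLm (measurableSet_singleton 0)]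
    rw [Measure.prod_apply_symm (hLm (measurableSet_singleton 0))]
    -- With the second vector frozen, the zero set is a hyperplane for the first. Only `u₁` has to
    -- be nonzero.
    have : ∀ y, multivariateGaussian 0 S₁ ((fun x => (x, y)) ⁻¹' (L ⁻¹' {0})) = 0 := by
      intro y
      refine measure_mono_null ?_ (multivariateGaussian_hyperplane hS₁ hu₁ (-inner ℝ u₂ y))
      intro x hx
      exact eq_neg_of_add_eq_zero_left (show inner ℝ u₁ x + inner ℝ u₂ y = 0 from hx)
    simp [this]
  obtain ⟨κ, hκ, hle⟩ := exists_measure_norm_lt_le ν h0 hε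
  refine ⟨κ, hκ, fun Ω _ P _ Z₁ Z₂ hm₁ hm₂ h₁ h₂ hi => ?_⟩
  have hlaw : P.map (fun ω => L (Z₁ ω, Z₂ ω)) = ν := by
    rw [hν, ← h₁, ← h₂, ← hi.map_prod_eq_prod_map_map hm₁.aemeasurable hm₂.aemeasurable,
      Measure.map_map hLm (hm₁.prodMk hm₂)]
    rfl
  have hmeas : MeasurableSet {x : ℝ | ‖x‖ < κ} := measurableSet_lt measurable_norm measurable_const
  have hcomp : Measurable fun ω => L (Z₁ ω, Z₂ ω) := hLm.comp (hm₁.prodMk hm₂)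
  rw [← hlaw, Measure.map_apply hcomp hmeas] at hle
  exact hle

end Gaussian

/-! ### The check function -/

section Rho

variable {τ : ℝ}

/-- The check function is the maximum of the lines `τ u` and `(τ - 1) u`. Its convexity,
subgradients and coercivity all follow from this. -/
theorem mul_le_rho (hτ : τ ∈ Set.Ioo (0 : ℝ) 1) {c : ℝ} (hc : c = τ ∨ c = τ - 1) (u : ℝ) :
    c * u ≤ rho τ u := by
  unfold rho
  obtain ⟨h0, h1⟩ := hτ
  split_ifs with h <;> rcases hc with rfl | rfl <;> nlinarith

theorem coeff_eq (u : ℝ) : (τ - if u ≤ 0 then 1 else 0) = τ ∨ (τ - if u ≤ 0 then 1 else 0) = τ - 1 := by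
  split_ifs <;> simp

theorem rho_sub_ge (hτ : τ ∈ Set.Ioo (0 : ℝ) 1) (u h : ℝ) :
    rho τ u - (τ - if u ≤ 0 then 1 else 0) * h ≤ rho τ (u - h) := by
  have h1 := mul_le_rho hτ (coeff_eq (τ := τ) u) (u - h)
  have h2 : rho τ u = (τ - if u ≤ 0 then 1 else 0) * u := mul_comm _ _
  rw [h2]
  linarith

theorem rho_convex (hτ : τ ∈ Set.Ioo (0 : ℝ) 1) : ConvexOn ℝ Set.univ (rho τ) := by
  refine ⟨convex_univ, fun x _ y _ a b ha hb _ => ?_⟩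
  have h2 : rho τ (a • x + b • y) = (τ - if a • x + b • y ≤ 0 then 1 else 0) * (a • x + b • y) :=
    mul_comm _ _
  have hc := coeff_eq (τ := τ) (a • x + b • y)
  rw [h2]
  have h3 := mul_le_mul_of_nonneg_left (mul_le_rho hτ hc x) ha
  have h4 := mul_le_mul_of_nonneg_left (mul_le_rho hτ hc y) hb
  simp only [smul_eq_mul] at *
  linarith

theorem abs_le_rho (hτ : τ ∈ Set.Ioo (0 : ℝ) 1) (u : ℝ) : min τ (1 - τ) * |u| ≤ rho τ u := by
  obtain ⟨h0, h1⟩ := id hτ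
  rcases le_total 0 u with hu | hu
  · rw [abs_of_nonneg hu]
    exact (mul_le_mul_of_nonneg_right (min_le_left _ _) hu).trans (mul_le_rho hτ (Or.inl rfl) u)
  · rw [abs_of_nonpos hu]
    have := mul_le_rho hτ (Or.inr rfl) u
    have := mul_le_mul_of_nonneg_right (min_le_right τ (1 - τ)) (neg_nonneg.mpr hu)
    linarith

theorem abs_coeff_le (hτ : τ ∈ Set.Ioo (0 : ℝ) 1) (u : ℝ) :
    |τ - if u ≤ 0 then 1 else 0| ≤ 1 := by
  obtain ⟨h0, h1⟩ := hτ
  rw [abs_le]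
  split_ifs <;> constructor <;> linarith

end Rho

/-! ### Conditional quantiles and conditional densities -/

section Density

variable {Ω 𝒳 : Type*} [MeasurableSpace Ω] [MeasurableSpace 𝒳] {P : Measure Ω}
  [IsProbabilityMeasure P]

/-- A conditional quantile restriction is an orthogonality condition. -/
theorem integral_quantile_residual_mul_eq_zero {S : Ω → 𝒳} (hS : Measurable S) {E : Set Ω}
    (hE : MeasurableSet E) {τ : ℝ}
    (h : P[E.indicator (fun _ => (1 : ℝ)) | MeasurableSpace.comap S inferInstance]
      =ᵐ[P] fun _ => τ)
    {g : 𝒳 → ℝ} (hg : Measurable g) (hgi : Integrable (fun ω => g (S ω)) P) :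
    ∫ ω, (τ - E.indicator (fun _ => (1 : ℝ)) ω) * g (S ω) ∂P = 0 := by
  have hm : MeasurableSpace.comap S inferInstance ≤ (inferInstance : MeasurableSpace Ω) :=
    hS.comap_le
  have hsm : StronglyMeasurable[MeasurableSpace.comap S inferInstance] (fun ω => g (S ω)) :=
    (hg.comp (comap_measurable S)).stronglyMeasurable
  have hEi : Integrable (E.indicator fun _ => (1 : ℝ)) P := (integrable_const _).indicator hE
  have hEgi : Integrable (E.indicator (fun _ => (1 : ℝ)) * fun ω => g (S ω)) P := by
    have : (E.indicator (fun _ => (1 : ℝ)) * fun ω => g (S ω)) = E.indicator fun ω => g (S ω) := by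
      ext ω
      by_cases hω : ω ∈ E <;> simp [hω]
    rw [this]
    exact hgi.indicator hE
  -- The factor `g (S ·)` is measurable with respect to the conditioning and can be taken out of the
  -- conditional expectation.
  have h1 := condExp_mul_of_stronglyMeasurable_right hsm hEgi hEi
  have h2 : ∫ ω, (E.indicator (fun _ => (1 : ℝ)) * fun ω => g (S ω)) ω ∂P = ∫ ω, τ * g (S ω) ∂P := by
    rw [← integral_condExp hm]
    refine integral_congr_ae ?_
    filter_upwards [h1, h] with ω h3 h4
    rw [h3, Pi.mul_apply, h4]
  have h3 : ∀ ω, (τ - E.indicator (fun _ => (1 : ℝ)) ω) * g (S ω)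
      = τ * g (S ω) - (E.indicator (fun _ => (1 : ℝ)) * fun ω => g (S ω)) ω := by
    intro ω
    rw [Pi.mul_apply]; ring
  simp_rw [h3]
  rw [integral_sub (hgi.const_mul τ) hEgi, h2, sub_self]

theorem integral_indicator_Iic_sub_mul (φ : ℝ → ℝ) (a b : ℝ) :
    ∫ y, ((if y ≤ b then 1 else 0) - if y ≤ a then 1 else 0) * φ y = ∫ y in a..b, φ y := by
  rcases le_total a b with hab | hab
  · rw [intervalIntegral.integral_of_le hab, ← integral_indicator measurableSet_Ioc]
    congr 1
    ext y
    simp only [Set.indicator_apply, Set.mem_Ioc]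
    by_cases h1 : y ≤ a
    · have h2 : y ≤ b := h1.trans hab
      simp [h1, h2, not_lt.mpr h1]
    · by_cases h2 : y ≤ b <;> simp [h1, h2, not_le.mp h1]
  · rw [intervalIntegral.integral_of_ge hab, ← integral_indicator measurableSet_Ioc,
      ← integral_neg]
    congr 1
    ext y
    simp only [Set.indicator_apply, Set.mem_Ioc]
    by_cases h1 : y ≤ b
    · have h2 : y ≤ a := h1.trans hab
      simp [h1, h2, not_lt.mpr h1]
    · by_cases h2 : y ≤ a <;> simp [h1, h2, not_le.mp h1]

/-- Increments of a conditional distribution function, expressed by the conditional density. -/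
theorem integral_increment_eq {U : Ω → 𝒳} (hU : Measurable U) {Y : Ω → ℝ} (hY : Measurable Y)
    {p : ℝ → 𝒳 → ℝ} (hp : Measurable fun q : 𝒳 × ℝ => p q.2 q.1) (hp0 : ∀ s x, 0 ≤ p s x)
    {C : ℝ} (hpC : ∀ s x, p s x ≤ C)
    (hlaw : P.map (fun ω => (U ω, Y ω)) =
      ((P.map U).prod volume).withDensity fun q => ENNReal.ofReal (p q.2 q.1))
    {a d g : 𝒳 → ℝ} (ha : Measurable a) (hd : Measurable d) (hg : Measurable g)
    (hgi : Integrable (fun ω => g (U ω)) P) (hdg : Integrable (fun ω => d (U ω) * g (U ω)) P) :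
    IntervalIntegrable (fun s : ℝ => ∫ ω, p (a (U ω) + s * d (U ω)) (U ω) * (d (U ω) * g (U ω)) ∂P)
      volume 0 1 ∧
    ∫ ω, ((if Y ω ≤ a (U ω) + d (U ω) then 1 else 0) - if Y ω ≤ a (U ω) then 1 else 0) * g (U ω) ∂P
      = ∫ s in (0 : ℝ)..1, ∫ ω, p (a (U ω) + s * d (U ω)) (U ω) * (d (U ω) * g (U ω)) ∂P := by
  set μ : Measure 𝒳 := P.map U with hμ
  have : IsProbabilityMeasure μ := Measure.isProbabilityMeasure_map hU.aemeasurable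
  have hdg' : Integrable (fun x => d x * g x) μ :=
    (integrable_map_measure (hd.mul hg).aestronglyMeasurable hU.aemeasurable).mpr hdg
  -- integrability on the product with `[0, 1]`
  have hprod : Integrable (fun q : 𝒳 × ℝ => p (a q.1 + q.2 * d q.1) q.1 * (d q.1 * g q.1))
      (μ.prod (volume.restrict (Set.Ioc 0 1))) := by
    have h1 : Integrable (fun q : 𝒳 × ℝ => d q.1 * g q.1)
        (μ.prod (volume.restrict (Set.Ioc (0 : ℝ) 1))) := hdg'.comp_fst _
    refine h1.bdd_mul (c := C) ?_ ?_
    · refine Measurable.aestronglyMeasurable ?_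
      exact hp.comp (measurable_fst.prodMk
        ((ha.comp measurable_fst).add (measurable_snd.mul (hd.comp measurable_fst))))
    · refine Eventually.of_forall fun q => ?_
      rw [Real.norm_eq_abs, abs_of_nonneg (hp0 _ _)]
      exact hpC _ _
  have hback : ∀ s : ℝ, ∫ ω, p (a (U ω) + s * d (U ω)) (U ω) * (d (U ω) * g (U ω)) ∂P
      = ∫ x, p (a x + s * d x) x * (d x * g x) ∂μ := by
    intro s
    rw [hμ, integral_map hU.aemeasurable]
    refine Measurable.aestronglyMeasurable ?_
    exact (hp.comp (measurable_id.prodMk (ha.add (measurable_const.mul hd)))).mul (hd.mul hg)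
  simp_rw [hback]
  refine ⟨?_, ?_⟩
  · rw [intervalIntegrable_iff_integrableOn_Ioc_of_le zero_le_one]
    exact hprod.integral_prod_right
  have hsetb : MeasurableSet {q : 𝒳 × ℝ | q.2 ≤ a q.1 + d q.1} := measurableSet_le measurable_snd
    ((ha.comp measurable_fst).add (hd.comp measurable_fst))
  have hseta : MeasurableSet {q : 𝒳 × ℝ | q.2 ≤ a q.1} :=
    measurableSet_le measurable_snd (ha.comp measurable_fst)
  set H : 𝒳 × ℝ → ℝ := fun q =>
    ((if q.2 ≤ a q.1 + d q.1 then 1 else 0) - if q.2 ≤ a q.1 then 1 else 0) * g q.1 with hH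
  have hHm : Measurable H := ((Measurable.ite hsetb measurable_const measurable_const).sub
    (Measurable.ite hseta measurable_const measurable_const)).mul (hg.comp measurable_fst)
  have hUY : Measurable fun ω => (U ω, Y ω) := hU.prodMk hY
  have hHi : Integrable H (P.map fun ω => (U ω, Y ω)) := by
    rw [integrable_map_measure hHm.aestronglyMeasurable hUY.aemeasurable]
    refine hgi.mono (hHm.comp hUY).aestronglyMeasurable (Eventually.of_forall fun ω => ?_)
    simp only [Function.comp, hH, norm_mul]
    refine mul_le_of_le_one_left (norm_nonneg _) ?_
    split_ifs <;> simp
  have hofm : Measurable fun q : 𝒳 × ℝ => ENNReal.ofReal (p q.2 q.1) := hp.ennreal_ofReal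
  have hHi' : Integrable (fun q : 𝒳 × ℝ => p q.2 q.1 * H q) (μ.prod volume) := by
    rw [hlaw, integrable_withDensity_iff_integrable_smul' hofm
      (Eventually.of_forall fun _ => ENNReal.ofReal_lt_top)] at hHi
    refine hHi.congr (Eventually.of_forall fun q => ?_)
    simp [ENNReal.toReal_ofReal (hp0 _ _)]
  have h1 : ∫ ω, H (U ω, Y ω) ∂P = ∫ q, p q.2 q.1 * H q ∂(μ.prod volume) := by
    rw [← integral_map hUY.aemeasurable hHm.aestronglyMeasurable (f := H), hlaw,
      integral_withDensity_eq_integral_toReal_smul hofm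
      (Eventually.of_forall fun _ => ENNReal.ofReal_lt_top)]
    refine integral_congr_ae (Eventually.of_forall fun q => ?_)
    simp [ENNReal.toReal_ofReal (hp0 _ _)]
  have h2 : ∫ ω, ((if Y ω ≤ a (U ω) + d (U ω) then 1 else 0) - if Y ω ≤ a (U ω) then 1 else 0)
      * g (U ω) ∂P = ∫ ω, H (U ω, Y ω) ∂P := rfl
  -- The joint law has density `p` with respect to the law of `U` times Lebesgue measure.
  -- Integrating over `y` first leaves an integral of `p` from `a` to `a + d`, which is to be
  -- written over `[0, 1]`.
  rw [h2, h1, integral_prod _ hHi', intervalIntegral.integral_of_le zero_le_one,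
    ← integral_integral_swap (f := fun x s => p (a x + s * d x) x * (d x * g x)) hprod]
  refine integral_congr_ae (Eventually.of_forall fun x => ?_)
  simp only
  have h3 : ∀ y, p y x * H (x, y)
      = g x * (((if y ≤ a x + d x then 1 else 0) - if y ≤ a x then 1 else 0) * p y x) := by
    intro y
    simp only [hH]
    ring
  simp_rw [h3]
  rw [integral_const_mul, integral_indicator_Iic_sub_mul (fun y => p y x)]
  -- Substitution `y = a + s d`. The form with the factor `d` outside remains valid for `d = 0`.
  have h4 := intervalIntegral.smul_integral_comp_add_mul (a := 0) (b := 1) (fun y => p y x) (d x)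
    (a x)
  simp only [mul_zero, add_zero, mul_one, smul_eq_mul] at h4
  rw [← h4, intervalIntegral.integral_of_le zero_le_one, integral_mul_const]
  have h5 : ∀ s, d x * s = s * d x := fun s => mul_comm _ _
  simp_rw [h5]
  ring

end Density

/-! ### Comparison with the supremum norm -/

theorem abs_apply_le_norm2 {ι : Type*} [Fintype ι] (v : ι → ℝ) (k : ι) : |v k| ≤ norm2 v := by
  simpa [norm2] using PiLp.norm_apply_le (WithLp.toLp 2 v) k

theorem norm2_nonneg {ι : Type*} [Fintype ι] (v : ι → ℝ) : 0 ≤ norm2 v := norm_nonneg _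

theorem norm_le_norm2 {ι : Type*} [Fintype ι] (v : ι → ℝ) : ‖v‖ ≤ norm2 v :=
  (pi_norm_le_iff_of_nonneg (norm2_nonneg v)).mpr fun k => abs_apply_le_norm2 v k

open scoped Matrix.Norms.L2Operator in
theorem abs_apply_le_opNorm {ι κ : Type*} [Fintype ι] [Fintype κ] [DecidableEq κ]
    (A : Matrix ι κ ℝ) (k : ι) (l : κ) : |A k l| ≤ opNorm A := by
  have h1 := Matrix.l2_opNorm_mulVec A (WithLp.toLp 2 (Pi.single (M := fun _ => ℝ) l 1))
  have h2 : ‖WithLp.toLp 2 (Pi.single (M := fun _ => ℝ) l 1)‖ = 1 := by simp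
  rw [h2, mul_one] at h1
  refine le_trans ?_ h1
  have h3 := PiLp.norm_apply_le (WithLp.toLp 2 (A *ᵥ Pi.single l 1)) k
  simpa using h3

theorem measurable_dotProduct {Ω ι : Type*} [MeasurableSpace Ω] [Fintype ι] {f g : Ω → ι → ℝ}
    (hf : Measurable f) (hg : Measurable g) : Measurable fun ω => f ω ⬝ᵥ g ω :=
  Finset.measurable_sum _ fun i _ =>
    ((measurable_pi_apply i).comp hf).mul ((measurable_pi_apply i).comp hg)

/-! ### The joint parameter `z = (r, t)` and measurability -/

namespace Model

variable {J dw dphi dz : ℕ} {Ω : Type*} {M : Model J dw dphi dz Ω}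

theorem score_eq (τ y x : ℝ) (w : Vec dw) (phi : Vec dphi) (v b : ℝ) (z : Idx dw dphi → ℝ)
    (k : Idx dw dphi) :
    score τ y x w phi v b (z ∘ Sum.inl) (z ∘ Sum.inr) k
      = (τ - if y - x * b - Sum.elim w phi ⬝ᵥ z ≤ 0 then 1 else 0) * (Sum.elim w phi k * v) := by
  have h : Sum.elim w phi ⬝ᵥ z = w ⬝ᵥ (z ∘ Sum.inl) + phi ⬝ᵥ (z ∘ Sum.inr) := by
    conv_lhs => rw [← Sum.elim_comp_inl_inr z]
    rw [sumElim_dotProduct_sumElim]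
  rw [score, h, sub_sub (y - x * b), mul_assoc]

theorem loss_eq (τ : ℝ) (n : ℕ) (j : Fin J) (i : Fin (M.size n j)) (ω : Ω) (b : ℝ)
    (z : Idx dw dphi → ℝ) :
    M.loss τ n j i ω b (z ∘ Sum.inl) (z ∘ Sum.inr)
      = rho τ (M.y n j i ω - M.X n j i ω * b - M.psi n j i ω ⬝ᵥ z) * M.v n j i ω := by
  have h : M.psi n j i ω ⬝ᵥ z
      = M.W n j i ω ⬝ᵥ (z ∘ Sum.inl) + M.phi n j i ω ⬝ᵥ (z ∘ Sum.inr) := by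
    conv_lhs => rw [← Sum.elim_comp_inl_inr z]
    rw [psi, sumElim_dotProduct_sumElim]
  rw [loss, h, sub_sub (M.y n j i ω - M.X n j i ω * b)]

theorem f_eq (τ : ℝ) (n : ℕ) (j : Fin J) (i : Fin (M.size n j)) (ω : Ω) (b : ℝ)
    (z : Idx dw dphi → ℝ) (k : Idx dw dphi) :
    M.f τ n j i ω b (z ∘ Sum.inl) (z ∘ Sum.inr) k
      = (τ - if M.y n j i ω - M.X n j i ω * b - M.psi n j i ω ⬝ᵥ z ≤ 0 then 1 else 0)
        * (M.psi n j i ω k * M.v n j i ω) :=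
  score_eq ..

/-- The parameter `(γ_n, 0)`. -/
noncomputable def truth (M : Model J dw dphi dz Ω) (n : ℕ) : Idx dw dphi → ℝ :=
  Sum.elim (M.gammaTrue n) 0

variable [MeasurableSpace Ω]

namespace Meas

variable (hM : M.Meas)
include hM

theorem phi (n : ℕ) (j : Fin J) (i : Fin (M.size n j)) : Measurable (M.phi n j i) :=
  (hM.Phi n j).comp ((hM.W n j i).prodMk (hM.Z n j i))

theorem v (n : ℕ) (j : Fin J) (i : Fin (M.size n j)) : Measurable (M.v n j i) :=
  (hM.V n j).comp ((hM.W n j i).prodMk (hM.Z n j i))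

theorem psi (n : ℕ) (j : Fin J) (i : Fin (M.size n j)) : Measurable (M.psi n j i) := by
  refine measurable_pi_iff.mpr fun k => ?_
  cases k with
  | inl k => exact (measurable_pi_apply k).comp (hM.W n j i)
  | inr k => exact (measurable_pi_apply k).comp (hM.phi n j i)

theorem residual (n : ℕ) (j : Fin J) (i : Fin (M.size n j)) (b : ℝ) (z : Idx dw dphi → ℝ) :
    Measurable fun ω => M.y n j i ω - M.X n j i ω * b - M.psi n j i ω ⬝ᵥ z :=
  ((hM.y n j i).sub ((hM.X n j i).mul_const b)).sub
    (measurable_dotProduct (hM.psi n j i) measurable_const)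

theorem v_nonneg (n : ℕ) (j : Fin J) (i : Fin (M.size n j)) (ω : Ω) : 0 ≤ M.v n j i ω :=
  hM.V_nonneg _ _ _ _

end Meas

/-! ### Population objective, scores and moments -/

section Population

variable {J dw dphi dz : ℕ} {Ω : Type*} {M : Model J dw dphi dz Ω} [MeasurableSpace Ω]
  {P : Measure Ω} {τ : ℝ}

/-- The regression index is the difference of the residuals at `(0, 0)` and at `(b, z)`, and `|u|`
is at most a multiple of `ρ_τ(u)`. Integrability of the two losses therefore suffices, without
moments of `y` itself. -/
theorem integrable_design (hτ : τ ∈ Set.Ioo (0 : ℝ) 1) (hM : M.Meas)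
    (hF : M.FiniteExpectations P τ) (n : ℕ) (j : Fin J) (i : Fin (M.size n j)) (b : ℝ)
    (z : Idx dw dphi → ℝ) :
    Integrable (fun ω => (M.X n j i ω * b + M.psi n j i ω ⬝ᵥ z) * M.v n j i ω) P := by
  have hc : 0 < min τ (1 - τ) := lt_min hτ.1 (by linarith [hτ.2])
  have h0 := hF.loss n j i 0 ((0 : Idx dw dphi → ℝ) ∘ Sum.inl) ((0 : Idx dw dphi → ℝ) ∘ Sum.inr)
  have h1 := hF.loss n j i b (z ∘ Sum.inl) (z ∘ Sum.inr)
  simp_rw [loss_eq] at h0 h1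
  refine ((h0.add h1).const_mul (min τ (1 - τ))⁻¹).mono ?_ (Eventually.of_forall fun ω => ?_)
  · exact ((((hM.X n j i).mul_const b).add
      (measurable_dotProduct (hM.psi n j i) measurable_const)).mul
      (hM.v n j i)).aestronglyMeasurable
  · set u₀ := M.y n j i ω - M.X n j i ω * 0 - M.psi n j i ω ⬝ᵥ 0
    set u₁ := M.y n j i ω - M.X n j i ω * b - M.psi n j i ω ⬝ᵥ z with hu₁
    have hu : M.X n j i ω * b + M.psi n j i ω ⬝ᵥ z = u₀ - u₁ := by
      simp only [u₀, hu₁, dotProduct_zero]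
      ring
    have hv := hM.v_nonneg n j i ω
    have h2 := abs_le_rho hτ u₀
    have h3 := abs_le_rho hτ u₁
    rw [hu, Real.norm_eq_abs, Real.norm_eq_abs, abs_mul, abs_of_nonneg hv]
    refine le_trans ?_ (le_abs_self _)
    rw [Pi.add_apply, ← add_mul, inv_mul_eq_div, le_div_iff₀ hc]
    have h4 : min τ (1 - τ) * |u₀ - u₁| ≤ rho τ u₀ + rho τ u₁ := by
      have := mul_le_mul_of_nonneg_left (abs_sub u₀ u₁) hc.le
      linarith
    have := mul_le_mul_of_nonneg_right h4 hv
    linarith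

theorem integrable_psi_mul_v (hτ : τ ∈ Set.Ioo (0 : ℝ) 1) (hM : M.Meas)
    (hF : M.FiniteExpectations P τ) (n : ℕ) (j : Fin J) (i : Fin (M.size n j))
    (k : Idx dw dphi) : Integrable (fun ω => M.psi n j i ω k * M.v n j i ω) P := by
  simpa using integrable_design hτ hM hF n j i 0 (Pi.single k 1)

theorem integrable_f (hτ : τ ∈ Set.Ioo (0 : ℝ) 1) (hM : M.Meas)
    (hF : M.FiniteExpectations P τ) (n : ℕ) (j : Fin J) (i : Fin (M.size n j)) (b : ℝ)
    (z : Idx dw dphi → ℝ) (k : Idx dw dphi) :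
    Integrable (fun ω => M.f τ n j i ω b (z ∘ Sum.inl) (z ∘ Sum.inr) k) P := by
  simp_rw [f_eq]
  refine (integrable_psi_mul_v hτ hM hF n j i k).bdd_mul (c := 1) ?_
    (Eventually.of_forall fun ω => abs_coeff_le hτ _)
  refine (measurable_const.sub (Measurable.ite ?_ measurable_const
    measurable_const)).aestronglyMeasurable
  exact measurableSet_le (hM.residual n j i b z) measurable_const

/-- The scores are subgradients of the population objective. -/
theorem QN_ge (hτ : τ ∈ Set.Ioo (0 : ℝ) 1) (hM : M.Meas) (hF : M.FiniteExpectations P τ)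
    (n : ℕ) (b : ℝ) (z z' : Idx dw dphi → ℝ) :
    M.QN P τ n b (z ∘ Sum.inl) (z ∘ Sum.inr)
      - M.PiN P τ n b (z ∘ Sum.inl) (z ∘ Sum.inr) ⬝ᵥ (z' - z)
      ≤ M.QN P τ n b (z' ∘ Sum.inl) (z' ∘ Sum.inr) := by
  have h1 : ∀ j i, (∫ ω, M.loss τ n j i ω b (z ∘ Sum.inl) (z ∘ Sum.inr) ∂P)
      - ∑ k, (∫ ω, M.f τ n j i ω b (z ∘ Sum.inl) (z ∘ Sum.inr) k ∂P) * (z' - z) k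
      ≤ ∫ ω, M.loss τ n j i ω b (z' ∘ Sum.inl) (z' ∘ Sum.inr) ∂P := by
    intro j i
    have hfi : ∀ k ∈ Finset.univ, Integrable
        (fun ω => M.f τ n j i ω b (z ∘ Sum.inl) (z ∘ Sum.inr) k * (z' - z) k) P :=
      fun k _ => (integrable_f hτ hM hF n j i b z k).mul_const _
    simp_rw [← integral_mul_const]
    rw [← integral_finsetSum _ hfi,
      ← integral_sub (hF.loss n j i b _ _) (integrable_finsetSum _ hfi)]
    refine integral_mono ((hF.loss n j i b _ _).sub (integrable_finsetSum _ hfi))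
      (hF.loss n j i b _ _) fun ω => ?_
    simp only [loss_eq, f_eq]
    set u := M.y n j i ω - M.X n j i ω * b - M.psi n j i ω ⬝ᵥ z with hu
    have h2 : M.y n j i ω - M.X n j i ω * b - M.psi n j i ω ⬝ᵥ z'
        = u - M.psi n j i ω ⬝ᵥ (z' - z) := by
      rw [dotProduct_sub, hu]; ring
    have h3 : ∑ k, (τ - if u ≤ 0 then 1 else 0) * (M.psi n j i ω k * M.v n j i ω) * (z' - z) k
        = (τ - if u ≤ 0 then 1 else 0) * (M.psi n j i ω ⬝ᵥ (z' - z)) * M.v n j i ω := by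
      rw [dotProduct, Finset.mul_sum, Finset.sum_mul]
      exact Finset.sum_congr rfl fun k _ => by ring
    rw [h2, h3, ← sub_mul]
    exact mul_le_mul_of_nonneg_right (rho_sub_ge hτ _ _) (hM.v_nonneg n j i ω)
  have h4 : M.PiN P τ n b (z ∘ Sum.inl) (z ∘ Sum.inr) ⬝ᵥ (z' - z) = (M.total n : ℝ)⁻¹ *
      ∑ j, ∑ i, ∑ k, (∫ ω, M.f τ n j i ω b (z ∘ Sum.inl) (z ∘ Sum.inr) k ∂P) * (z' - z) k := by
    simp only [PiN, dotProduct, mul_assoc, ← Finset.mul_sum, Finset.sum_mul]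
    congr 1
    rw [Finset.sum_comm]
    exact Finset.sum_congr rfl fun j _ => Finset.sum_comm
  rw [h4, QN, QN, ← mul_sub]
  refine mul_le_mul_of_nonneg_left ?_ (by positivity)
  simp_rw [← Finset.sum_sub_distrib]
  exact Finset.sum_le_sum fun j _ => Finset.sum_le_sum fun i _ => h1 j i

/-- The population objective is jointly convex. -/
theorem QN_convex (hτ : τ ∈ Set.Ioo (0 : ℝ) 1) (hM : M.Meas) (hF : M.FiniteExpectations P τ)
    (n : ℕ) : ConvexOn ℝ Set.univ fun p : ℝ × (Idx dw dphi → ℝ) =>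
      M.QN P τ n p.1 (p.2 ∘ Sum.inl) (p.2 ∘ Sum.inr) := by
  refine ⟨convex_univ, fun p _ q _ a c ha hc hac => ?_⟩
  have h1 : ∀ j i, ∫ ω, M.loss τ n j i ω (a • p + c • q).1 ((a • p + c • q).2 ∘ Sum.inl)
      ((a • p + c • q).2 ∘ Sum.inr) ∂P
      ≤ a * (∫ ω, M.loss τ n j i ω p.1 (p.2 ∘ Sum.inl) (p.2 ∘ Sum.inr) ∂P)
      + c * ∫ ω, M.loss τ n j i ω q.1 (q.2 ∘ Sum.inl) (q.2 ∘ Sum.inr) ∂P := by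
    intro j i
    rw [← integral_const_mul, ← integral_const_mul,
      ← integral_add ((hF.loss n j i _ _ _).const_mul _) ((hF.loss n j i _ _ _).const_mul _)]
    refine integral_mono (hF.loss n j i _ _ _)
      (((hF.loss n j i _ _ _).const_mul _).add ((hF.loss n j i _ _ _).const_mul _)) fun ω => ?_
    simp only [loss_eq]
    have h2 := (rho_convex hτ).2 (Set.mem_univ (M.y n j i ω - M.X n j i ω * p.1
      - M.psi n j i ω ⬝ᵥ p.2)) (Set.mem_univ (M.y n j i ω - M.X n j i ω * q.1
      - M.psi n j i ω ⬝ᵥ q.2)) ha hc hac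
    have h3 : M.y n j i ω - M.X n j i ω * (a • p + c • q).1 - M.psi n j i ω ⬝ᵥ (a • p + c • q).2
        = a • (M.y n j i ω - M.X n j i ω * p.1 - M.psi n j i ω ⬝ᵥ p.2)
          + c • (M.y n j i ω - M.X n j i ω * q.1 - M.psi n j i ω ⬝ᵥ q.2) := by
      simp only [Prod.fst_add, Prod.snd_add, Prod.smul_fst, Prod.smul_snd, dotProduct_add,
        dotProduct_smul, smul_eq_mul]
      linear_combination (-M.y n j i ω) * hac
    rw [h3]
    have := mul_le_mul_of_nonneg_right h2 (hM.v_nonneg n j i ω)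
    simp only [smul_eq_mul] at this ⊢
    linarith
  simp only [QN, smul_eq_mul]
  have h4 := mul_le_mul_of_nonneg_left (Finset.sum_le_sum fun j (_ : j ∈ Finset.univ) =>
    Finset.sum_le_sum fun i (_ : i ∈ Finset.univ) => h1 j i)
    (show (0 : ℝ) ≤ (M.total n : ℝ)⁻¹ by positivity)
  refine h4.trans (le_of_eq ?_)
  simp only [Finset.sum_add_distrib, ← Finset.mul_sum]
  ring

theorem QN_convex_right (hτ : τ ∈ Set.Ioo (0 : ℝ) 1) (hM : M.Meas)
    (hF : M.FiniteExpectations P τ) (n : ℕ) (b : ℝ) :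
    ConvexOn ℝ Set.univ fun z : Idx dw dphi → ℝ =>
      M.QN P τ n b (z ∘ Sum.inl) (z ∘ Sum.inr) := by
  refine ⟨convex_univ, fun p _ q _ a c ha hc hac => ?_⟩
  have e : (b, a • p + c • q) = a • (b, p) + c • (b, q) :=
    Prod.ext (show b = a * b + c * b by rw [← add_mul, hac, one_mul]) rfl
  exact (congrArg (fun p : ℝ × (Idx dw dphi → ℝ) => M.QN P τ n p.1 (p.2 ∘ Sum.inl)
    (p.2 ∘ Sum.inr)) e).trans_le
    ((QN_convex hτ hM hF n).2 (Set.mem_univ (b, p)) (Set.mem_univ (b, q)) ha hc hac)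

/-- A finite convex function on a finite-dimensional space is continuous; this is the purpose of
convexity jointly in `b` and `z`. -/
theorem QN_continuous (hτ : τ ∈ Set.Ioo (0 : ℝ) 1) (hM : M.Meas)
    (hF : M.FiniteExpectations P τ) (n : ℕ) (z : Idx dw dphi → ℝ) :
    Continuous fun b => M.QN P τ n b (z ∘ Sum.inl) (z ∘ Sum.inr) := by
  have h : Continuous fun p : ℝ × (Idx dw dphi → ℝ) =>
      M.QN P τ n p.1 (p.2 ∘ Sum.inl) (p.2 ∘ Sum.inr) :=
    continuousOn_univ.mp ((QN_convex hτ hM hF n).continuousOn isOpen_univ)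
  have h2 : Continuous fun b : ℝ => (b, z) := by fun_prop
  have h3 := h.comp h2
  simpa only [Function.comp_def] using h3

variable [IsProbabilityMeasure P]

theorem integral_true_score_mul_eq_zero (hM : M.Meas) (hB : M.Basic P τ) (n : ℕ) (j : Fin J)
    (i : Fin (M.size n j)) {g : Vec dw × Vec dz → ℝ} (hg : Measurable g)
    (hgi : Integrable (fun ω => g (M.W n j i ω, M.Z n j i ω)) P) :
    ∫ ω, (τ - if M.y n j i ω ≤ M.X n j i ω * M.betaN n + M.W n j i ω ⬝ᵥ M.gammaTrue n then 1 else 0)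
      * g (M.W n j i ω, M.Z n j i ω) ∂P = 0 := by
  have hE : MeasurableSet {ω | M.y n j i ω ≤ M.X n j i ω * M.betaN n
      + M.W n j i ω ⬝ᵥ M.gammaTrue n} :=
    measurableSet_le (hM.y n j i) (((hM.X n j i).mul_const _).add
      (measurable_dotProduct (hM.W n j i) measurable_const))
  have h := integral_quantile_residual_mul_eq_zero ((hM.W n j i).prodMk (hM.Z n j i)) hE
    (hB.quantile_restriction n j i) hg hgi
  simpa only [Set.indicator_apply, Set.mem_ofPred_eq] using h

theorem integral_f_truth (hτ : τ ∈ Set.Ioo (0 : ℝ) 1) (hM : M.Meas) (hB : M.Basic P τ)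
    (hF : M.FiniteExpectations P τ) (n : ℕ) (j : Fin J) (i : Fin (M.size n j))
    (k : Idx dw dphi) : ∫ ω, M.f τ n j i ω (M.betaN n) (M.gammaTrue n) 0 k ∂P = 0 := by
  have hg : Measurable fun p : Vec dw × Vec dz =>
      Sum.elim p.1 (M.Phi n j p.1 p.2) k * M.V n j p.1 p.2 := by
    refine Measurable.mul ?_ (hM.V n j)
    cases k with
    | inl k => exact (measurable_pi_apply k).comp measurable_fst
    | inr k => exact (measurable_pi_apply k).comp (hM.Phi n j)
  have h := integral_true_score_mul_eq_zero hM hB n j i hg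
    (integrable_psi_mul_v hτ hM hF n j i k)
  rw [← h]
  refine integral_congr_ae (Eventually.of_forall fun ω => ?_)
  simp only [f, score, dotProduct_zero, sub_zero, sub_sub, sub_nonpos, mul_assoc]
  rfl

theorem pop_truth (hτ : τ ∈ Set.Ioo (0 : ℝ) 1) (hM : M.Meas) (hB : M.Basic P τ)
    (hF : M.FiniteExpectations P τ) (n : ℕ) (j : Fin J) :
    M.pop P τ n j (M.betaN n) (M.gammaTrue n) 0 = 0 := by
  ext k
  simp [pop, integral_f_truth hτ hM hB hF]

theorem PiN_truth (hτ : τ ∈ Set.Ioo (0 : ℝ) 1) (hM : M.Meas) (hB : M.Basic P τ)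
    (hF : M.FiniteExpectations P τ) (n : ℕ) :
    M.PiN P τ n (M.betaN n) (M.gammaTrue n) 0 = 0 := by
  ext k
  simp [PiN, integral_f_truth hτ hM hB hF]

/-- Expectation of the estimated score near the truth, expressed by the Jacobians. -/
theorem popHat_eq (hM : M.Meas) (hB : M.Basic P τ) (n : ℕ) (j : Fin J) (ω : Ω)
    (h1 : ∀ i, Integrable (fun ω' => norm2 (M.psiHat n j i ω ω') * M.vHat n j i ω ω') P)
    (h2 : ∀ i, Integrable (fun ω' => norm2 (M.psiHat n j i ω ω') ^ 2 * M.vHat n j i ω ω') P)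
    (h3 : ∀ i, Integrable
      (fun ω' => norm2 (M.psiHat n j i ω ω') * |M.X n j i ω'| * M.vHat n j i ω ω') P)
    (vb : ℝ) (z : Idx dw dphi → ℝ) (k : Idx dw dphi) :
    IntervalIntegrable (fun s : ℝ => vb * M.jacXHat P n j ω (s * vb) (s • z ∘ Sum.inl)
        (s • z ∘ Sum.inr) k + (M.jacPsiHat P n j ω (s * vb) (s • z ∘ Sum.inl)
        (s • z ∘ Sum.inr) *ᵥ z) k) volume 0 1 ∧
    M.popHat P τ n j ω (M.betaN n + vb) (M.gammaTrue n + z ∘ Sum.inl) (z ∘ Sum.inr) k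
      = -∫ s in (0 : ℝ)..1, vb * M.jacXHat P n j ω (s * vb) (s • z ∘ Sum.inl)
        (s • z ∘ Sum.inr) k + (M.jacPsiHat P n j ω (s * vb) (s • z ∘ Sum.inl)
        (s • z ∘ Sum.inr) *ᵥ z) k := by
  obtain ⟨C, hC⟩ := hB.dens_bounded
  set a : ℝ × Vec dw × Vec dz → ℝ := fun u => u.1 * M.betaN n + u.2.1 ⬝ᵥ M.gammaTrue n with ha
  set ψ : ℝ × Vec dw × Vec dz → Idx dw dphi → ℝ :=
    fun u => Sum.elim u.2.1 (M.PhiHat n j ω u.2.1 u.2.2) with hψ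
  set w : ℝ × Vec dw × Vec dz → ℝ := fun u => M.VHat n j ω u.2.1 u.2.2 with hw
  set d : ℝ × Vec dw × Vec dz → ℝ := fun u => u.1 * vb + ψ u ⬝ᵥ z with hd
  have hPhim : Measurable fun u : ℝ × Vec dw × Vec dz => M.PhiHat n j ω u.2.1 u.2.2 :=
    (hM.PhiHat n j).comp (measurable_const.prodMk measurable_snd)
  have hwm : Measurable w := (hM.VHat n j).comp (measurable_const.prodMk measurable_snd)
  have hψm : ∀ l, Measurable fun u => ψ u l := by
    intro l
    cases l with
    | inl l => exact (measurable_pi_apply l).comp (measurable_fst.comp measurable_snd)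
    | inr l => exact (measurable_pi_apply l).comp hPhim
  have ham : Measurable a := (measurable_fst.mul_const _).add
    (measurable_dotProduct (measurable_fst.comp measurable_snd) measurable_const)
  have hdm : Measurable d := (measurable_fst.mul_const _).add
    (measurable_dotProduct (measurable_pi_iff.mpr hψm) measurable_const)
  have hUm : ∀ i, Measurable (M.XWZ n j i) := fun i =>
    (hM.X n j i).prodMk ((hM.W n j i).prodMk (hM.Z n j i))
  have hψU : ∀ i ω', ψ (M.XWZ n j i ω') = M.psiHat n j i ω ω' := fun _ _ => rfl
  have hwU : ∀ i ω', w (M.XWZ n j i ω') = M.vHat n j i ω ω' := fun _ _ => rfl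
  have hw0 : ∀ u, 0 ≤ w u := fun u => hM.VHat_nonneg n j ω u.2.1 u.2.2
  have hψ1 : ∀ i l, Integrable (fun ω' => M.psiHat n j i ω ω' l * M.vHat n j i ω ω') P := by
    intro i l
    refine (h1 i).mono (((hψm l).mul hwm).comp (hUm i)).aestronglyMeasurable
      (Eventually.of_forall fun ω' => ?_)
    rw [norm_mul, norm_mul, Real.norm_eq_abs (norm2 _), abs_of_nonneg (norm2_nonneg _)]
    exact mul_le_mul_of_nonneg_right (abs_apply_le_norm2 _ l) (norm_nonneg _)
  have hψ2 : ∀ i l, Integrable (fun ω' => M.psiHat n j i ω ω' k * M.psiHat n j i ω ω' l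
      * M.vHat n j i ω ω') P := by
    intro i l
    refine (h2 i).mono ((((hψm k).mul (hψm l)).mul hwm).comp (hUm i)).aestronglyMeasurable
      (Eventually.of_forall fun ω' => ?_)
    rw [norm_mul, norm_mul, norm_mul, Real.norm_eq_abs (norm2 _ ^ 2), abs_of_nonneg (sq_nonneg _),
      pow_two]
    exact mul_le_mul_of_nonneg_right (mul_le_mul (abs_apply_le_norm2 _ k) (abs_apply_le_norm2 _ l)
      (abs_nonneg _) (norm2_nonneg _)) (norm_nonneg _)
  have hψX : ∀ i, Integrable (fun ω' => M.psiHat n j i ω ω' k * M.X n j i ω'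
      * M.vHat n j i ω ω') P := by
    intro i
    refine (h3 i).mono ((((hψm k).mul measurable_fst).mul hwm).comp (hUm i)).aestronglyMeasurable
      (Eventually.of_forall fun ω' => ?_)
    rw [norm_mul, norm_mul, norm_mul, norm_mul, Real.norm_eq_abs (norm2 _),
      abs_of_nonneg (norm2_nonneg _), Real.norm_eq_abs |_|, abs_abs]
    exact mul_le_mul_of_nonneg_right (mul_le_mul_of_nonneg_right (abs_apply_le_norm2 _ k)
      (abs_nonneg _)) (norm_nonneg _)
  have hdens : ∀ (i : Fin (M.size n j)) (s : ℝ),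
      Measurable (fun ω' => M.dens n j i (a (M.XWZ n j i ω') + s * d (M.XWZ n j i ω'))
      (M.XWZ n j i ω')) := by
    intro i s
    exact (hB.dens_measurable n j i).comp ((measurable_id.prodMk
      (ham.add (measurable_const.mul hdm))).comp (hUm i))
  have hbdd : ∀ (i : Fin (M.size n j)) (s : ℝ) {φ : Ω → ℝ}, Integrable φ P →
      Integrable (fun ω' => M.dens n j i (a (M.XWZ n j i ω') + s * d (M.XWZ n j i ω'))
      (M.XWZ n j i ω') * φ ω') P := by
    intro i s φ hφ
    refine hφ.bdd_mul (c := C) (hdens i s).aestronglyMeasurable (Eventually.of_forall fun ω' => ?_)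
    rw [Real.norm_eq_abs, abs_of_nonneg (hB.dens_nonneg n j i _ _)]
    exact hC n j i _ _
  -- The density of `ε` at `s` times the shift equals the density of `y` on the segment from the
  -- true conditional quantile index `a` to `a + d`.
  have heps : ∀ i (s : ℝ) ω', M.epsDens n j i ω' (M.shift n j i ω ω' (s * vb) (s • z ∘ Sum.inl)
      (s • z ∘ Sum.inr)) = M.dens n j i (a (M.XWZ n j i ω') + s * d (M.XWZ n j i ω'))
      (M.XWZ n j i ω') := by
    intro i s ω'
    have hz : ψ (M.XWZ n j i ω') ⬝ᵥ z = M.W n j i ω' ⬝ᵥ (z ∘ Sum.inl)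
        + M.phiHat n j i ω ω' ⬝ᵥ (z ∘ Sum.inr) := by
      conv_lhs => rw [← Sum.elim_comp_inl_inr z]
      exact sumElim_dotProduct_sumElim _ _ _ _
    rw [epsDens]
    congr 1
    simp only [shift, hd, ha, hz, dotProduct_smul, smul_eq_mul]
    simp only [XWZ]
    ring
  have hdg : ∀ i ω', d (M.XWZ n j i ω') * (M.psiHat n j i ω ω' k * M.vHat n j i ω ω')
      = vb * (M.psiHat n j i ω ω' k * M.X n j i ω' * M.vHat n j i ω ω')
      + ∑ l, (M.psiHat n j i ω ω' k * M.psiHat n j i ω ω' l * M.vHat n j i ω ω') * z l := by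
    intro i ω'
    simp only [hd, hψU, dotProduct]
    rw [add_mul, Finset.sum_mul]
    congr 1
    · simp only [XWZ]; ring
    · exact Finset.sum_congr rfl fun l _ => by ring
  have hdgi : ∀ i, Integrable
      (fun ω' => d (M.XWZ n j i ω') * (M.psiHat n j i ω ω' k * M.vHat n j i ω ω')) P := by
    intro i
    simp_rw [hdg]
    exact ((hψX i).const_mul _).add (integrable_finsetSum _ fun l _ => (hψ2 i l).mul_const _)
  -- The estimated instrument and weight come from the frozen `ω`, hence are fixed functions of `(W,
  -- Z)` inside the expectation.
  have key := fun i => integral_increment_eq (P := P) (hUm i) (hM.y n j i)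
    (hB.dens_measurable n j i) (hB.dens_nonneg n j i) (hC n j i) (hB.dens_law n j i) ham hdm
    ((hψm k).mul hwm) (hψ1 i k) (hdgi i)
  simp only [Pi.mul_apply, hψU, hwU] at key
  -- the inner integrals, summed over the cluster
  have hsum : ∀ s : ℝ, vb * M.jacXHat P n j ω (s * vb) (s • z ∘ Sum.inl) (s • z ∘ Sum.inr) k
      + (M.jacPsiHat P n j ω (s * vb) (s • z ∘ Sum.inl) (s • z ∘ Sum.inr) *ᵥ z) k
      = (M.size n j : ℝ)⁻¹ * ∑ i, ∫ ω', M.dens n j i (a (M.XWZ n j i ω')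
        + s * d (M.XWZ n j i ω')) (M.XWZ n j i ω')
        * (d (M.XWZ n j i ω') * (M.psiHat n j i ω ω' k * M.vHat n j i ω ω')) ∂P := by
    intro s
    have hi : ∀ i, ∫ ω', M.dens n j i (a (M.XWZ n j i ω')
        + s * d (M.XWZ n j i ω')) (M.XWZ n j i ω')
        * (d (M.XWZ n j i ω') * (M.psiHat n j i ω ω' k * M.vHat n j i ω ω')) ∂P
        = vb * (∫ ω', M.dens n j i (a (M.XWZ n j i ω') + s * d (M.XWZ n j i ω')) (M.XWZ n j i ω')
          * (M.psiHat n j i ω ω' k * M.X n j i ω' * M.vHat n j i ω ω') ∂P)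
        + ∑ l, (∫ ω', M.dens n j i (a (M.XWZ n j i ω') + s * d (M.XWZ n j i ω')) (M.XWZ n j i ω')
          * (M.psiHat n j i ω ω' k * M.psiHat n j i ω ω' l * M.vHat n j i ω ω') ∂P) * z l := by
      intro i
      simp_rw [← integral_mul_const]
      rw [← integral_const_mul, ← integral_finsetSum, ← integral_add]
      · refine integral_congr_ae (Eventually.of_forall fun ω' => ?_)
        simp only [hdg, mul_add, Finset.mul_sum]
        congr 1
        · ring
        · exact Finset.sum_congr rfl fun l _ => by ring
      · exact (hbdd i s (hψX i)).const_mul _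
      · exact integrable_finsetSum _ fun l _ => (hbdd i s (hψ2 i l)).mul_const _
      · exact fun l _ => (hbdd i s (hψ2 i l)).mul_const _
    simp_rw [hi]
    rw [Finset.sum_add_distrib, mul_add, ← Finset.mul_sum, Finset.sum_comm]
    simp only [jacXHat, jacPsiHat, mulVec, dotProduct, of_apply, heps]
    congr 1
    · simp only [mul_assoc]; ring
    · rw [Finset.mul_sum]
      refine Finset.sum_congr rfl fun l _ => ?_
      rw [← Finset.sum_mul]
      simp only [mul_assoc]
  simp_rw [hsum]
  refine ⟨?_, ?_⟩
  · have := (IntervalIntegrable.sum Finset.univ fun i _ => (key i).1).const_mul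
      ((M.size n j : ℝ)⁻¹)
    simpa only [Finset.sum_apply] using this
  rw [intervalIntegral.integral_const_mul,
    intervalIntegral.integral_finsetSum fun i _ => (key i).1, popHat]
  simp_rw [← (key _).2]
  rw [← mul_neg, ← Finset.sum_neg_distrib]
  congr 1
  refine Finset.sum_congr rfl fun i _ => ?_
  -- At the true index the weighted quantile residual integrates to zero, for any weight that
  -- depends on `(W, Z)` only. Subtracting it turns the moment into minus an increment of the
  -- conditional distribution function.
  have h0 := integral_true_score_mul_eq_zero hM hB n j i
    (g := fun q => ψ (0, q) k * w (0, q))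
    (((hψm k).mul hwm).comp (measurable_const.prodMk measurable_id)) (hψ1 i k)
  refine (Eq.trans ?_ (congrArg (fun x => x - _) h0)).trans (zero_sub _)
  rw [← integral_sub]
  · refine integral_congr_ae (Eventually.of_forall fun ω' => ?_)
    have hz : M.psiHat n j i ω ω' ⬝ᵥ z = M.W n j i ω' ⬝ᵥ (z ∘ Sum.inl)
        + M.phiHat n j i ω ω' ⬝ᵥ (z ∘ Sum.inr) := by
      conv_lhs => rw [← Sum.elim_comp_inl_inr z]
      exact sumElim_dotProduct_sumElim _ _ _ _
    have hiff : (M.y n j i ω' - M.X n j i ω' * (M.betaN n + vb)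
        - M.W n j i ω' ⬝ᵥ (M.gammaTrue n + z ∘ Sum.inl) - M.phiHat n j i ω ω' ⬝ᵥ (z ∘ Sum.inr) ≤ 0)
        ↔ M.y n j i ω' ≤ a (M.XWZ n j i ω') + d (M.XWZ n j i ω') := by
      simp only [ha, hd, hψU, hz, dotProduct_add]
      simp only [XWZ]
      constructor <;> intro h <;> linarith
    simp only [fHat, score, hiff]
    have e1 : a (M.XWZ n j i ω') = M.X n j i ω' * M.betaN n + M.W n j i ω' ⬝ᵥ M.gammaTrue n := rfl
    have e2 : ψ (0, M.W n j i ω', M.Z n j i ω') = M.psiHat n j i ω ω' := rfl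
    have e3 : w (0, M.W n j i ω', M.Z n j i ω') = M.vHat n j i ω ω' := rfl
    rw [← e1, e2, e3, psiHat]
    ring
  · refine (hψ1 i k).bdd_mul (c := |τ| + 1) ?_ (Eventually.of_forall fun ω' => ?_)
    · refine (measurable_const.sub (Measurable.ite ?_ measurable_const
        measurable_const)).aestronglyMeasurable
      exact measurableSet_le (hM.y n j i) (ham.comp (hUm i))
    · rw [Real.norm_eq_abs]
      refine (abs_sub _ _).trans ?_
      split_ifs <;> simp
  · refine (hψ1 i k).bdd_mul (c := 1) ?_ (Eventually.of_forall fun ω' => ?_)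
    · refine ((Measurable.ite ?_ measurable_const measurable_const).sub
        (Measurable.ite ?_ measurable_const measurable_const)).aestronglyMeasurable
      · exact measurableSet_le (hM.y n j i) ((ham.add hdm).comp (hUm i))
      · exact measurableSet_le (hM.y n j i) (ham.comp (hUm i))
    · split_ifs <;> simp

end Population

end Model
-- Global identification
namespace Model

section Identification

variable {J dw dphi dz : ℕ} {Ω : Type*} {M : Model J dw dphi dz Ω} [MeasurableSpace Ω]
  {P : Measure Ω} {τ : ℝ} {L : Limits J dw dphi}

/-- The minimizer of the limit objective at `b`. -/
def argInf (M : Model J dw dphi dz Ω) (b : ℝ) : Idx dw dphi → ℝ :=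
  Sum.elim (M.gammaInf b) (M.thetaInf b)

/-- The minimizer of the population objective at `b`. -/
def argN (M : Model J dw dphi dz Ω) (n : ℕ) (b : ℝ) : Idx dw dphi → ℝ :=
  Sum.elim (M.gammaN n b) (M.thetaN n b)

theorem continuousOn_argInf (hA : M.Asymptotics P τ L) : ContinuousOn M.argInf M.B := by
  refine continuousOn_pi.mpr fun k => ?_
  cases k with
  | inl k => exact (continuous_apply k).comp_continuousOn (continuous_fst.comp_continuousOn hA.cont_inf)
  | inr k => exact (continuous_apply k).comp_continuousOn (continuous_snd.comp_continuousOn hA.cont_inf)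

theorem pair_ne_of_ne {r' : Vec dw} {t' : Vec dphi} {z : Idx dw dphi → ℝ}
    (h : z ≠ Sum.elim r' t') : (z ∘ Sum.inl, z ∘ Sum.inr) ≠ (r', t') := by
  intro h'
  refine h ?_
  rw [← (Prod.mk.inj h').1, ← (Prod.mk.inj h').2, Sum.elim_comp_inl_inr]

theorem Qinf_argInf_lt (hA : M.Asymptotics P τ L) {b : ℝ} (hb : b ∈ M.B) {z : Idx dw dphi → ℝ}
    (hz : z ≠ M.argInf b) :
    M.Qinf b (M.argInf b ∘ Sum.inl) (M.argInf b ∘ Sum.inr)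
      < M.Qinf b (z ∘ Sum.inl) (z ∘ Sum.inr) :=
  hA.min_inf b hb _ _ (pair_ne_of_ne hz)

theorem tendsto_QN (hA : M.Asymptotics P τ L) {b : ℝ} (hb : b ∈ M.B) (z : Idx dw dphi → ℝ) :
    Tendsto (fun n => M.QN P τ n b (z ∘ Sum.inl) (z ∘ Sum.inr)) atTop
      (𝓝 (M.Qinf b (z ∘ Sum.inl) (z ∘ Sum.inr))) :=
  (hA.obj_pop _ _).tendsto_at hb

/-- Convexity passes to pointwise limits. -/
theorem Qinf_convex (hτ : τ ∈ Set.Ioo (0 : ℝ) 1) (hM : M.Meas)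
    (hF : M.FiniteExpectations P τ) (hA : M.Asymptotics P τ L) {b : ℝ} (hb : b ∈ M.B) :
    ConvexOn ℝ Set.univ fun z : Idx dw dphi → ℝ => M.Qinf b (z ∘ Sum.inl) (z ∘ Sum.inr) := by
  refine ⟨convex_univ, fun p hp q hq a c ha hc hac => ?_⟩
  exact le_of_tendsto_of_tendsto (tendsto_QN hA hb (a • p + c • q))
    (((tendsto_QN hA hb p).const_smul a).add ((tendsto_QN hA hb q).const_smul c))
    (Eventually.of_forall fun n => (QN_convex_right hτ hM hF n b).2 hp hq ha hc hac)

theorem continuousOn_Qinf (hτ : τ ∈ Set.Ioo (0 : ℝ) 1) (hM : M.Meas)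
    (hF : M.FiniteExpectations P τ) (hA : M.Asymptotics P τ L) (z : Idx dw dphi → ℝ) :
    ContinuousOn (fun b => M.Qinf b (z ∘ Sum.inl) (z ∘ Sum.inr)) M.B :=
  (hA.obj_pop _ _).continuousOn
    (Eventually.of_forall fun n => (QN_continuous hτ hM hF n z).continuousOn).frequently

/-- Convex functions close to the limit objective have minimizers close to `argInf`. -/
theorem exists_finset_argInf_close (hτ : τ ∈ Set.Ioo (0 : ℝ) 1) (hM : M.Meas)
    (hF : M.FiniteExpectations P τ) (hA : M.Asymptotics P τ L) (hB : M.Basic P τ) {ε : ℝ}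
    (hε : 0 < ε) :
    ∃ (F : Finset (Idx dw dphi → ℝ)) (η : ℝ), 0 < η ∧ ∀ b ∈ M.B, ∀ f : (Idx dw dphi → ℝ) → ℝ,
      ConvexOn ℝ Set.univ f → (∀ z ∈ F, |f z - M.Qinf b (z ∘ Sum.inl) (z ∘ Sum.inr)| ≤ η) →
      ∀ x, (∀ y, f x ≤ f y) → ‖x - M.argInf b‖ < ε :=
  exists_finset_argmin_close hB.B_compact
    (q := fun b z => M.Qinf b (z ∘ Sum.inl) (z ∘ Sum.inr))
    (fun _ hb => Qinf_convex hτ hM hF hA hb) (continuousOn_Qinf hτ hM hF hA)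
    (continuousOn_argInf hA) (fun _ hb _ hz => Qinf_argInf_lt hA hb hz) hε

theorem argN_le (hA : M.Asymptotics P τ L) : ∀ᶠ n in atTop, ∀ b ∈ M.B, ∀ z : Idx dw dphi → ℝ,
    M.QN P τ n b (M.argN n b ∘ Sum.inl) (M.argN n b ∘ Sum.inr)
      ≤ M.QN P τ n b (z ∘ Sum.inl) (z ∘ Sum.inr) := by
  filter_upwards [hA.min_n] with n hn b hb z
  by_cases h : z = M.argN n b
  · rw [h]
  · exact (hn b hb _ _ (pair_ne_of_ne h)).le

theorem eventually_norm_argN_sub_lt (hτ : τ ∈ Set.Ioo (0 : ℝ) 1) (hM : M.Meas)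
    (hF : M.FiniteExpectations P τ) (hA : M.Asymptotics P τ L) (hB : M.Basic P τ) {ε : ℝ}
    (hε : 0 < ε) : ∀ᶠ n in atTop, ∀ b ∈ M.B, ‖M.argN n b - M.argInf b‖ < ε := by
  obtain ⟨F, η, hη, h⟩ := exists_finset_argInf_close hτ hM hF hA hB hε
  have h1 : ∀ᶠ n in atTop, ∀ z ∈ F, ∀ b ∈ M.B,
      |M.QN P τ n b (z ∘ Sum.inl) (z ∘ Sum.inr) - M.Qinf b (z ∘ Sum.inl) (z ∘ Sum.inr)| ≤ η := by
    rw [eventually_all_finset]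
    intro z _
    filter_upwards [Metric.tendstoUniformlyOn_iff.mp (hA.obj_pop (z ∘ Sum.inl) (z ∘ Sum.inr)) η hη]
      with n hn b hb
    rw [abs_sub_comm]
    exact (hn b hb).le
  filter_upwards [h1, argN_le hA] with n h2 h3 b hb
  exact h b hb _ (QN_convex_right hτ hM hF n b) (fun z hz => h2 z hz b hb) _ (h3 b hb)

theorem tendsto_betaN (hA : M.Asymptotics P τ L) : Tendsto M.betaN atTop (𝓝 M.beta0) := by
  have := (tendsto_const_nhds (x := M.muBeta)).div_atTop hA.rate_tendsto
  have h := (tendsto_const_nhds (x := M.beta0)).add this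
  rw [add_zero] at h
  exact h

theorem tendsto_truth (hA : M.Asymptotics P τ L) :
    Tendsto M.truth atTop (𝓝 (Sum.elim M.gamma0 0)) := by
  refine tendsto_pi_nhds.mpr fun k => ?_
  cases k with
  | inl k =>
    have := (tendsto_inv_atTop_zero.comp hA.rate_tendsto).mul_const (M.muGamma k)
    simpa [truth, gammaTrue] using (tendsto_const_nhds (x := M.gamma0 k)).add this
  | inr k => simp [truth]

theorem eventually_betaN_mem (hB : M.Basic P τ) : ∀ᶠ n in atTop, M.betaN n ∈ M.B :=
  hB.beta_mem.mono fun _ h => interior_subset h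

theorem beta0_mem (hA : M.Asymptotics P τ L) (hB : M.Basic P τ) : M.beta0 ∈ M.B :=
  hB.B_compact.isClosed.mem_of_tendsto (tendsto_betaN hA) (eventually_betaN_mem hB)

variable [IsProbabilityMeasure P]

/-- The population score vanishes at the truth by the quantile restriction. Zero is thus a
subgradient there, and the minimizer is unique. -/
theorem eventually_argN_betaN (hτ : τ ∈ Set.Ioo (0 : ℝ) 1) (hM : M.Meas)
    (hF : M.FiniteExpectations P τ) (hA : M.Asymptotics P τ L) (hB : M.Basic P τ) :
    ∀ᶠ n in atTop, M.argN n (M.betaN n) = M.truth n := by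
  filter_upwards [hA.min_n, eventually_betaN_mem hB] with n hn hb
  by_contra hne
  have h1 := hn _ hb _ _ (pair_ne_of_ne (Ne.symm hne))
  have h2 := QN_ge (P := P) hτ hM hF n (M.betaN n) (M.truth n) (M.argN n (M.betaN n))
  have h3 : M.PiN P τ n (M.betaN n) (M.truth n ∘ Sum.inl) (M.truth n ∘ Sum.inr) = 0 :=
    PiN_truth hτ hM hB hF n
  rw [h3, zero_dotProduct, sub_zero] at h2
  exact absurd h2 (not_le.mpr h1)

/-- The minimizers along `β_n → β_0` are compared in two ways: they equal the truth, which converges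
to `(γ_0, 0)`, and they are uniformly close to the continuous limit minimizer. -/
theorem argInf_beta0 (hτ : τ ∈ Set.Ioo (0 : ℝ) 1) (hM : M.Meas)
    (hF : M.FiniteExpectations P τ) (hA : M.Asymptotics P τ L) (hB : M.Basic P τ) :
    M.argInf M.beta0 = Sum.elim M.gamma0 0 := by
  have h1 : Tendsto (fun n => M.argInf (M.betaN n)) atTop (𝓝 (M.argInf M.beta0)) :=
    ((continuousOn_argInf hA) _ (beta0_mem hA hB)).tendsto.comp
      (tendsto_nhdsWithin_iff.mpr ⟨tendsto_betaN hA, eventually_betaN_mem hB⟩)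
  have h2 : Tendsto (fun n => M.truth n - M.argInf (M.betaN n)) atTop (𝓝 0) := by
    rw [tendsto_zero_iff_norm_tendsto_zero, Metric.tendsto_nhds]
    intro ε hε
    filter_upwards [eventually_argN_betaN hτ hM hF hA hB,
      eventually_norm_argN_sub_lt hτ hM hF hA hB hε, eventually_betaN_mem hB] with n h3 h4 h5
    rw [← h3]
    simpa using h4 _ h5
  have h3 := (tendsto_truth hA).sub h2
  simp only [sub_sub_cancel, sub_zero] at h3
  exact tendsto_nhds_unique h1 h3

omit [IsProbabilityMeasure P] in
-- A subgradient of a convex function is controlled by the values of the function at unit steps in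
-- the coordinate directions, and the objectives converge pointwise.
theorem eventually_norm_PiN_le (hτ : τ ∈ Set.Ioo (0 : ℝ) 1) (hM : M.Meas)
    (hF : M.FiniteExpectations P τ) (hA : M.Asymptotics P τ L) {b : ℝ} (hb : b ∈ M.B)
    (z : Idx dw dphi → ℝ) :
    ∃ C : ℝ, ∀ᶠ n in atTop, ‖M.PiN P τ n b (z ∘ Sum.inl) (z ∘ Sum.inr)‖ ≤ C := by
  have hbd : ∀ y : Idx dw dphi → ℝ, ∃ C : ℝ, ∀ᶠ n in atTop,
      |M.QN P τ n b (y ∘ Sum.inl) (y ∘ Sum.inr)| ≤ C := fun y =>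
    ⟨_, ((tendsto_QN hA hb y).abs.eventually_lt_const (lt_add_one _)).mono fun _ h => h.le⟩
  choose C hC using hbd
  obtain ⟨D, hD⟩ := ((Finset.univ.image fun k => C (z + Pi.single k 1)) ∪
    (Finset.univ.image fun k => C (z - Pi.single k 1)) ∪ {0}).exists_le
  refine ⟨D + C z, ?_⟩
  have h1 : ∀ᶠ n in atTop, ∀ k, |M.QN P τ n b ((z + Pi.single k 1) ∘ Sum.inl)
      ((z + Pi.single k 1) ∘ Sum.inr)| ≤ D :=
    eventually_all.mpr fun k => (hC _).mono fun n hn => hn.trans (hD _ (by simp))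
  have h2 : ∀ᶠ n in atTop, ∀ k, |M.QN P τ n b ((z - Pi.single k 1) ∘ Sum.inl)
      ((z - Pi.single k 1) ∘ Sum.inr)| ≤ D :=
    eventually_all.mpr fun k => (hC _).mono fun n hn => hn.trans (hD _ (by simp))
  filter_upwards [h1, h2, hC z] with n h3 h4 h5
  have hD0 : 0 ≤ D := hD 0 (by simp)
  refine (pi_norm_le_iff_of_nonneg (add_nonneg hD0 ((abs_nonneg _).trans h5))).mpr fun k => ?_
  have h6 := QN_ge (P := P) hτ hM hF n b z (z + Pi.single k 1)
  have h7 := QN_ge (P := P) hτ hM hF n b z (z - Pi.single k 1)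
  have e6 : z + Pi.single k 1 - z = Pi.single k (1 : ℝ) := by simp
  have e7 : z - Pi.single k 1 - z = -Pi.single k (1 : ℝ) := by simp
  rw [e6, dotProduct_single_one] at h6
  rw [e7, dotProduct_neg, dotProduct_single_one] at h7
  rw [Real.norm_eq_abs, abs_le]
  have h8 := abs_le.mp (h3 k)
  have h9 := abs_le.mp (h4 k)
  have h10 := abs_le.mp h5
  constructor <;> linarith [h8.1, h8.2, h9.1, h9.2, h10.1, h10.2]

omit [IsProbabilityMeasure P] in
/-- The population first order condition. -/
theorem eventually_PiN_argN (hτ : τ ∈ Set.Ioo (0 : ℝ) 1) (hM : M.Meas)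
    (hF : M.FiniteExpectations P τ) (hA : M.Asymptotics P τ L) (hB : M.Basic P τ) :
    ∀ᶠ n in atTop, ∀ b ∈ M.B, M.PiN P τ n b (M.gammaN n b) (M.thetaN n b) = 0 := by
  filter_upwards [argN_le hA, hB.jacobian.1, hA.min_mem] with n h1 h2 h3 b hb
  have hc : ContinuousAt (fun p : Vec dw × Vec dphi => M.PiN P τ n b p.1 p.2)
      (M.gammaN n b, M.thetaN n b) :=
    (h2 (b, (M.gammaN n b, M.thetaN n b)) ⟨hb, interior_subset (h3 b hb)⟩).continuousAt
  have hlim : ∀ u : Idx dw dphi → ℝ, Tendsto (fun s : ℝ => M.PiN P τ n b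
      ((M.argN n b + s • u) ∘ Sum.inl) ((M.argN n b + s • u) ∘ Sum.inr)) (𝓝[>] 0)
      (𝓝 (M.PiN P τ n b (M.gammaN n b) (M.thetaN n b))) := by
    intro u
    have hc' : Continuous fun s : ℝ => (((M.argN n b + s • u) ∘ Sum.inl,
        (M.argN n b + s • u) ∘ Sum.inr) : Vec dw × Vec dphi) := by
      refine Continuous.prodMk ?_ ?_ <;> refine continuous_pi fun k => ?_ <;>
        simp only [Function.comp, Pi.add_apply, Pi.smul_apply] <;> fun_prop
    have h0 := hc'.tendsto 0
    simp only [zero_smul, add_zero] at h0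
    exact (hc.tendsto.comp h0).mono_left nhdsWithin_le_nhds
  -- The subgradient inequality at `argN + s u`, tested at the minimizer, shows that moving in
  -- direction `u` cannot decrease the objective.
  have hsign : ∀ u : Idx dw dphi → ℝ, ∀ s : ℝ, 0 < s → M.PiN P τ n b
      ((M.argN n b + s • u) ∘ Sum.inl) ((M.argN n b + s • u) ∘ Sum.inr) ⬝ᵥ u ≤ 0 := by
    intro u s hs
    have h4 := QN_ge (P := P) hτ hM hF n b (M.argN n b + s • u) (M.argN n b)
    have h5 := h1 b hb (M.argN n b + s • u)
    have e : M.argN n b - (M.argN n b + s • u) = -(s • u) := by simp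
    rw [e, dotProduct_neg, dotProduct_smul, smul_eq_mul] at h4
    by_contra! h6
    nlinarith
  have hle : ∀ u : Idx dw dphi → ℝ,
      M.PiN P τ n b (M.gammaN n b) (M.thetaN n b) ⬝ᵥ u ≤ 0 := by
    intro u
    have hcd : Continuous fun w : Idx dw dphi → ℝ => w ⬝ᵥ u := by
      unfold dotProduct; fun_prop
    refine le_of_tendsto ((hcd.tendsto _).comp (hlim u)) ?_
    filter_upwards [self_mem_nhdsWithin] with s hs
    exact hsign u s hs
  -- Testing with the score itself shows that its squared length is nonpositive.
  have h6 := hle (M.PiN P τ n b (M.gammaN n b) (M.thetaN n b))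
  exact dotProduct_self_eq_zero.mp (le_antisymm h6 (Finset.sum_nonneg fun i _ => mul_self_nonneg _))

omit [IsProbabilityMeasure P] in
theorem interior_R_prod_Theta_nonempty (hA : M.Asymptotics P τ L) (hB : M.Basic P τ) :
    (interior (M.R ×ˢ M.Theta)).Nonempty := by
  obtain ⟨n, h1, h2⟩ := (hA.min_mem.and (eventually_betaN_mem hB)).exists
  exact ⟨_, h1 _ h2⟩

omit [IsProbabilityMeasure P] in
-- The population score vanishes at the finite-stage minimizers, which converge to `(γ_∞(b), 0)`.
-- Since the `Π_n` are equi-Lipschitz, they tend to zero at that limit point too.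
theorem PiInf_eq_zero (hτ : τ ∈ Set.Ioo (0 : ℝ) 1) (hM : M.Meas)
    (hF : M.FiniteExpectations P τ) (hA : M.Asymptotics P τ L) (hB : M.Basic P τ)
    (hI : M.StrongIdentification P τ L) {b : ℝ} (hb : b ∈ M.B) (h0 : M.thetaInf b = 0) :
    (b, M.gammaInf b) ∈ M.B ×ˢ M.R ∧ M.PiInf (b, M.gammaInf b) = 0 := by
  have hS : IsCompact (M.R ×ˢ M.Theta) := hB.R_compact.prod hB.Theta_compact
  have hlim : Tendsto (fun n => (M.gammaN n b, M.thetaN n b)) atTop (𝓝 (M.gammaInf b, 0)) := by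
    have h1 : Tendsto (fun n => M.argN n b) atTop (𝓝 (M.argInf b)) := by
      rw [tendsto_iff_norm_sub_tendsto_zero, Metric.tendsto_nhds]
      intro ε hε
      filter_upwards [eventually_norm_argN_sub_lt hτ hM hF hA hB hε] with n h4
      simpa using h4 b hb
    rw [← h0]
    refine Tendsto.prodMk_nhds (tendsto_pi_nhds.mpr fun k => ?_) (tendsto_pi_nhds.mpr fun k => ?_)
    · exact tendsto_pi_nhds.mp h1 (Sum.inl k)
    · exact tendsto_pi_nhds.mp h1 (Sum.inr k)
  have hmem : (M.gammaInf b, (0 : Vec dphi)) ∈ M.R ×ˢ M.Theta :=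
    hS.isClosed.mem_of_tendsto hlim (hA.min_mem.mono fun n hn => interior_subset (hn b hb))
  refine ⟨⟨hb, hmem.1⟩, ?_⟩
  obtain ⟨C, _, hC⟩ := exists_eventually_lipschitz
    (H := fun n (p : Vec dw × Vec dphi) => M.PiN P τ n b p.1 p.2)
    (hB.R_convex.prod hB.Theta_convex) hS.isBounded (interior_R_prod_Theta_nonempty hA hB)
    (hB.jacobian.1.mono fun n hn p hp => hn (b, p) ⟨hb, hp⟩)
    (fun ε hε => by
      obtain ⟨η, hη, h⟩ := hB.jacobian.2.1 ε hε
      refine ⟨η, hη, h.mono fun n hn p hp q hq hpq => ?_⟩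
      exact hn (b, p) ⟨hb, hp⟩ (b, q) ⟨hb, hq⟩ (by simpa [Prod.dist_eq] using hpq))
    (fun p _ => by
      simpa using eventually_norm_PiN_le hτ hM hF hA hb (Sum.elim p.1 p.2))
  have h1 : Tendsto (fun n => M.PiN P τ n b (M.gammaInf b) 0) atTop (𝓝 0) := by
    refine squeeze_zero_norm' (a := fun n => C * ‖(M.gammaInf b, (0 : Vec dphi))
      - (M.gammaN n b, M.thetaN n b)‖) ?_ ?_
    · filter_upwards [hC, eventually_PiN_argN hτ hM hF hA hB, hA.min_mem] with n h2 h3 h4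
      have h5 := h2 _ (interior_subset (h4 b hb)) _ hmem
      simpa only [h3 b hb, sub_zero] using h5
    · have := ((tendsto_const_nhds (x := (M.gammaInf b, (0 : Vec dphi)))).sub hlim).norm.const_mul C
      simpa using this
  exact tendsto_nhds_unique (hI.PiInf_lim (b, M.gammaInf b) ⟨hb, hmem.1⟩) h1

omit [IsProbabilityMeasure P] in
/-- Global identification: the limit moment function is injective. -/
theorem injOn_PiInf (hA : M.Asymptotics P τ L) (hB : M.Basic P τ)
    (hI : M.StrongIdentification P τ L) : Set.InjOn M.PiInf (M.B ×ˢ M.R) := by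
  have hS : IsCompact (M.B ×ˢ M.R) := hB.B_compact.prod hB.R_compact
  have hconv : Convex ℝ (M.B ×ˢ M.R) := hB.B_convex.prod hB.R_convex
  have hd : ∀ᶠ n in atTop, ∀ p ∈ M.B ×ˢ M.R,
      DifferentiableAt ℝ (fun p : ℝ × Vec dw => M.PiN P τ n p.1 p.2 0) p :=
    hI.jacobian.1.mono fun n hn p hp => hn ((), p) ⟨trivial, hp⟩
  have hc : ∀ ε : ℝ, 0 < ε → ∃ η : ℝ, 0 < η ∧ ∀ᶠ n in atTop, ∀ p ∈ M.B ×ˢ M.R,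
      ∀ q ∈ M.B ×ˢ M.R, dist p q < η →
      ‖fderiv ℝ (fun p : ℝ × Vec dw => M.PiN P τ n p.1 p.2 0) p
        - fderiv ℝ (fun p : ℝ × Vec dw => M.PiN P τ n p.1 p.2 0) q‖ < ε := by
    intro ε hε
    obtain ⟨η, hη, h⟩ := hI.jacobian.2.1 ε hε
    refine ⟨η, hη, h.mono fun n hn p hp q hq hpq => ?_⟩
    exact hn ((), p) ⟨trivial, hp⟩ ((), q) ⟨trivial, hq⟩ (by simpa [Prod.dist_eq] using hpq)
  have hne : (interior (M.B ×ˢ M.R)).Nonempty := by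
    obtain ⟨n, hn⟩ := hB.beta_mem.exists
    obtain ⟨p, hp⟩ := interior_R_prod_Theta_nonempty hA hB
    rw [interior_prod_eq] at hp ⊢
    exact ⟨(M.betaN n, p.1), hn, hp.1⟩
  obtain ⟨C, _, hC⟩ := exists_eventually_lipschitz
    (H := fun n (p : ℝ × Vec dw) => M.PiN P τ n p.1 p.2 0) hconv hS.isBounded hne hd hc
    (fun p hp => ⟨_, ((hI.PiInf_lim p hp).norm.eventually_lt_const (lt_add_one _)).mono
      fun _ h => h.le⟩)
  refine injOn_of_openOntoImage hS hconv ?_ ?_ hI.openOntoImage hI.image_simplyConnected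
  · refine LipschitzOnWith.continuousOn (K := C.toNNReal)
      (LipschitzOnWith.of_dist_le_mul fun p hp q hq => ?_)
    refine le_of_tendsto ((hI.PiInf_lim p hp).dist (hI.PiInf_lim q hq)) ?_
    filter_upwards [hC] with n hn
    rw [dist_eq_norm, dist_eq_norm]
    exact (hn q hq p hp).trans (mul_le_mul_of_nonneg_right (Real.le_coe_toNNReal C)
      (norm_nonneg _))
  · obtain ⟨c, hc0, hlow⟩ := hI.jacobian.2.2
    obtain ⟨η, hη, hη'⟩ := hc (c / 2) (by positivity)
    refine ⟨η, hη, fun p hp q hq hpq hfpq => ?_⟩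
    -- The Jacobian expands by at least `c`, and within distance `η` the linearization error is at
    -- most `c / 2` times the distance. What remains survives in the limit and gives local
    -- injectivity.
    have hlow' : c / 2 * ‖q - p‖ ≤ ‖M.PiInf q - M.PiInf p‖ := by
      refine ge_of_tendsto ((hI.PiInf_lim q hq).sub (hI.PiInf_lim p hp)).norm ?_
      filter_upwards [hd, hη', hlow] with n h1 h2 h3
      have h4 := norm_sub_sub_fderiv_le hconv h1 h2 hp hq hpq
      have h5 := h3 ((), p) ⟨trivial, hp⟩ (q - p)
      have h6 := norm_sub_norm_le (fderiv ℝ (fun p : ℝ × Vec dw => M.PiN P τ n p.1 p.2 0) p (q - p))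
        (M.PiN P τ n q.1 q.2 0 - M.PiN P τ n p.1 p.2 0)
      rw [norm_sub_rev (fderiv ℝ _ _ _)] at h6
      linarith
    rw [hfpq, sub_self, norm_zero] at hlow'
    have : ‖q - p‖ = 0 := le_antisymm (by nlinarith) (norm_nonneg _)
    exact (sub_eq_zero.mp (norm_eq_zero.mp this)).symm

/-- Both `b` and `β_0` produce zeros of the injective limit moment function. -/
theorem eq_beta0_of_thetaInf_eq_zero (hτ : τ ∈ Set.Ioo (0 : ℝ) 1) (hM : M.Meas)
    (hF : M.FiniteExpectations P τ) (hA : M.Asymptotics P τ L) (hB : M.Basic P τ)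
    (hI : M.StrongIdentification P τ L) {b : ℝ} (hb : b ∈ M.B) (h0 : M.thetaInf b = 0) :
    b = M.beta0 := by
  have hβ : M.thetaInf M.beta0 = 0 :=
    congrArg (fun z => z ∘ Sum.inr) (argInf_beta0 hτ hM hF hA hB)
  obtain ⟨h1, h2⟩ := PiInf_eq_zero hτ hM hF hA hB hI hb h0
  obtain ⟨h3, h4⟩ := PiInf_eq_zero hτ hM hF hA hB hI (beta0_mem hA hB) hβ
  exact congrArg Prod.fst (injOn_PiInf hA hB hI h1 h3 (h2.trans h4.symm))

end Identification

end Model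
-- Local expansion of the scores
namespace Model

section Expansion

open _root_.Asymptotics

variable {J dw dphi dz : ℕ} {Ω : Type*} {M : Model J dw dphi dz Ω}
variable [MeasurableSpace Ω] {P : Measure Ω} [IsProbabilityMeasure P] {τ : ℝ}
  {L : Limits J dw dphi} {A : ℕ → Set Ω}

omit [MeasurableSpace Ω] in
theorem eventually_inBall {ℓ : Filter (ℕ × Ω)} {vb : ℕ × Ω → ℝ}
    {z : ℕ × Ω → Idx dw dphi → ℝ} (hvb : Tendsto vb ℓ (𝓝 0)) (hz : Tendsto z ℓ (𝓝 0)) {δ : ℝ}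
    (hδ : 0 < δ) : ∀ᶠ p in ℓ, ∀ s ∈ Set.Icc (0 : ℝ) 1,
      InBall δ (s * vb p) (s • z p ∘ Sum.inl) (s • z p ∘ Sum.inr) := by
  have hc : Continuous fun q : ℝ × (Idx dw dphi → ℝ) => q.1 ^ 2 +
      (q.2 ∘ Sum.inl) ⬝ᵥ (q.2 ∘ Sum.inl) + (q.2 ∘ Sum.inr) ⬝ᵥ (q.2 ∘ Sum.inr) := by
    simp only [dotProduct, Function.comp_apply]; fun_prop
  have h1 := (hc.tendsto (0, 0)).comp (hvb.prodMk_nhds hz)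
  have h2 : 0 < δ ^ 2 := by positivity
  filter_upwards [h1.eventually_lt_const (u := δ ^ 2) (by simpa [dotProduct] using h2)]
    with p hp s hs
  simp only [Function.comp_apply] at hp
  have h3 : s ^ 2 ≤ 1 := by nlinarith [hs.1, hs.2]
  have h4 : 0 ≤ (z p ∘ Sum.inl) ⬝ᵥ (z p ∘ Sum.inl) :=
    Finset.sum_nonneg fun i _ => mul_self_nonneg _
  have h5 : 0 ≤ (z p ∘ Sum.inr) ⬝ᵥ (z p ∘ Sum.inr) :=
    Finset.sum_nonneg fun i _ => mul_self_nonneg _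
  unfold InBall
  rw [smul_dotProduct, dotProduct_smul, smul_dotProduct, dotProduct_smul]
  simp only [smul_eq_mul]
  nlinarith [mul_le_mul_of_nonneg_right h3 (by positivity : 0 ≤ vb p ^ 2 +
    (z p ∘ Sum.inl) ⬝ᵥ (z p ∘ Sum.inl) + (z p ∘ Sum.inr) ⬝ᵥ (z p ∘ Sum.inr))]

omit [IsProbabilityMeasure P] in
-- Suprema over small balls apply to random arguments that tend to zero. The whole segment `s ∈ [0,
-- 1]` is needed because the Jacobians enter through an integral along it.
theorem eventually_not_of_local {B : ℝ → Vec dw → Vec dphi → ℕ → Fin J → Ω → Prop}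
    (hT : Tendsto (fun δ : ℝ => limsup (fun n => P {ω | ∃ j vb vr vt,
      InBall (dw := dw) (dphi := dphi) δ vb vr vt ∧ B vb vr vt n j ω}) atTop) (𝓝[>] 0) (𝓝 0))
    {vb : ℕ × Ω → ℝ} {z : ℕ × Ω → Idx dw dphi → ℝ} (hvb : Tendsto vb (probFilter P A) (𝓝 0))
    (hz : Tendsto z (probFilter P A) (𝓝 0)) (j : Fin J) :
    ∀ᶠ p in probFilter P A, ∀ s ∈ Set.Icc (0 : ℝ) 1,
      ¬ B (s * vb p) (s • z p ∘ Sum.inl) (s • z p ∘ Sum.inr) p.1 j p.2 := by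
  refine eventually_probFilter_of_local hT fun δ hδ => ?_
  filter_upwards [eventually_inBall hvb hz hδ] with p hp
  by_cases h : p.2 ∈ {ω | ∃ j vb vr vt,
      InBall (dw := dw) (dphi := dphi) δ vb vr vt ∧ B vb vr vt p.1 j ω}
  · exact Or.inr h
  · exact Or.inl fun s hs hb => h ⟨j, _, _, _, hp s hs, hb⟩

/-- Stochastic equicontinuity evaluated at random deviations; the centering at the truth drops out
since that expectation is zero. -/
theorem isLittleO_empHat_sub_popHat (hτ : τ ∈ Set.Ioo (0 : ℝ) 1) (hM : M.Meas)
    (hB : M.Basic P τ) (hF : M.FiniteExpectations P τ) (hA : M.Asymptotics P τ L)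
    {vb : ℕ × Ω → ℝ} {z : ℕ × Ω → Idx dw dphi → ℝ} (hvb : Tendsto vb (probFilter P A) (𝓝 0))
    (hz : Tendsto z (probFilter P A) (𝓝 0)) (j : Fin J) (k : Idx dw dphi) :
    Tendsto (fun p => M.rate p.1 *
      (M.empHat τ p.1 j p.2 (M.betaN p.1 + vb p) (M.gammaTrue p.1 + z p ∘ Sum.inl)
          (z p ∘ Sum.inr) k
        - M.emp τ p.1 j p.2 (M.betaN p.1) (M.gammaTrue p.1) 0 k
        - M.popHat P τ p.1 j p.2 (M.betaN p.1 + vb p) (M.gammaTrue p.1 + z p ∘ Sum.inl)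
          (z p ∘ Sum.inr) k)) (probFilter P A) (𝓝 0) := by
  rw [Metric.tendsto_nhds]
  intro ε hε
  filter_upwards [eventually_not_of_local (A := A) (hA.equicont ε hε) hvb hz j] with p hp
  have h1 := not_le.mp (hp 1 (by simp))
  rw [pop_truth hτ hM hB hF] at h1
  simp only [one_mul, one_smul, sub_zero] at h1
  have h2 := (abs_apply_le_norm2 _ k).trans_lt h1
  rw [dist_zero_right, Real.norm_eq_abs]
  exact h2

/-- By `popHat_eq` the remainder is an integral along the segment of the difference between the
Jacobians and their limits, which is uniformly small there. -/
theorem isLittleO_popHat (hM : M.Meas)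
    (hB : M.Basic P τ) (hF : M.FiniteExpectations P τ) (hA : M.Asymptotics P τ L)
    {vb : ℕ × Ω → ℝ} {z : ℕ × Ω → Idx dw dphi → ℝ} (hvb : Tendsto vb (probFilter P A) (𝓝 0))
    (hz : Tendsto z (probFilter P A) (𝓝 0)) (j : Fin J) (k : Idx dw dphi) :
    (fun p => M.popHat P τ p.1 j p.2 (M.betaN p.1 + vb p) (M.gammaTrue p.1 + z p ∘ Sum.inl)
          (z p ∘ Sum.inr) k + vb p * L.QPsiX j k + (L.QPsiPsi j *ᵥ z p) k)
      =o[probFilter P A] fun p => |vb p| + ‖z p‖ := by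
  rw [isLittleO_iff]
  intro c hc
  set d : ℝ := ((Fintype.card (Idx dw dphi) : ℕ) : ℝ) with hd_def
  have hd : 0 ≤ d := Nat.cast_nonneg _
  -- Each row of the matrix error contributes at most `d ε ‖z‖`, and the error of the `X`-Jacobian
  -- at most `ε |v_b|`; this makes the total at most `c (|v_b| + ‖z‖)`.
  set ε := c / (1 + d)
  have hε : 0 < ε := by positivity
  have hεc : ε * (1 + d) = c := div_mul_cancel₀ _ (by positivity)
  have i1 : ∀ᶠ p in probFilter P A, ∀ i, Integrable
      (fun ω' => norm2 (M.psiHat p.1 j i p.2 ω') * M.vHat p.1 j i p.2 ω') P :=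
    eventually_probFilter_of_ae fun n => ae_all_iff.mpr fun i => hF.psiHat n j i
  have i2 : ∀ᶠ p in probFilter P A, ∀ i, Integrable
      (fun ω' => norm2 (M.psiHat p.1 j i p.2 ω') ^ 2 * M.vHat p.1 j i p.2 ω') P :=
    eventually_probFilter_of_ae fun n => ae_all_iff.mpr fun i => hF.psiHat_sq n j i
  have i3 : ∀ᶠ p in probFilter P A, ∀ i, Integrable
      (fun ω' => norm2 (M.psiHat p.1 j i p.2 ω') * |M.X p.1 j i ω'| * M.vHat p.1 j i p.2 ω') P :=
    eventually_probFilter_of_ae fun n => ae_all_iff.mpr fun i => hF.psiHat_X n j i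
  filter_upwards [i1, i2, i3, eventually_not_of_local (A := A) (hA.jacPsiHat ε hε) hvb hz j,
    eventually_not_of_local (A := A) (hA.jacXHat ε hε) hvb hz j] with p i1 i2 i3 h1 h2
  obtain ⟨hint, heq⟩ := popHat_eq hM hB p.1 j p.2 i1 i2 i3 (vb p) (z p) k
  rw [heq]
  have e : -(∫ s in (0 : ℝ)..1, vb p * M.jacXHat P p.1 j p.2 (s * vb p) (s • z p ∘ Sum.inl)
        (s • z p ∘ Sum.inr) k + (M.jacPsiHat P p.1 j p.2 (s * vb p) (s • z p ∘ Sum.inl)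
        (s • z p ∘ Sum.inr) *ᵥ z p) k) + vb p * L.QPsiX j k + (L.QPsiPsi j *ᵥ z p) k
      = -∫ s in (0 : ℝ)..1, ((vb p * M.jacXHat P p.1 j p.2 (s * vb p) (s • z p ∘ Sum.inl)
        (s • z p ∘ Sum.inr) k + (M.jacPsiHat P p.1 j p.2 (s * vb p) (s • z p ∘ Sum.inl)
        (s • z p ∘ Sum.inr) *ᵥ z p) k) - (vb p * L.QPsiX j k + (L.QPsiPsi j *ᵥ z p) k)) := by
    rw [intervalIntegral.integral_sub hint intervalIntegrable_const]
    simp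
    ring
  rw [e, norm_neg, Real.norm_of_nonneg (by positivity : (0 : ℝ) ≤ |vb p| + ‖z p‖)]
  have hbound : ∀ s ∈ Set.uIoc (0 : ℝ) 1, ‖(vb p * M.jacXHat P p.1 j p.2 (s * vb p)
        (s • z p ∘ Sum.inl) (s • z p ∘ Sum.inr) k + (M.jacPsiHat P p.1 j p.2 (s * vb p)
        (s • z p ∘ Sum.inl) (s • z p ∘ Sum.inr) *ᵥ z p) k)
        - (vb p * L.QPsiX j k + (L.QPsiPsi j *ᵥ z p) k)‖ ≤ c * (|vb p| + ‖z p‖) := by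
    intro s hs
    rw [Set.uIoc_of_le zero_le_one] at hs
    have hs' : s ∈ Set.Icc (0 : ℝ) 1 := ⟨hs.1.le, hs.2⟩
    have k1 := not_le.mp (h1 s hs')
    have k2 := (abs_apply_le_norm2 _ k).trans (not_le.mp (h2 s hs')).le
    rw [Pi.sub_apply] at k2
    set D := M.jacPsiHat P p.1 j p.2 (s * vb p) (s • z p ∘ Sum.inl) (s • z p ∘ Sum.inr)
    set E := M.jacXHat P p.1 j p.2 (s * vb p) (s • z p ∘ Sum.inl) (s • z p ∘ Sum.inr)
    have e2 : (vb p * E k + (D *ᵥ z p) k) - (vb p * L.QPsiX j k + (L.QPsiPsi j *ᵥ z p) k)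
        = vb p * (E k - L.QPsiX j k) + ∑ l, (D - L.QPsiPsi j) k l * z p l := by
      simp only [mulVec, dotProduct, Matrix.sub_apply, sub_mul, Finset.sum_sub_distrib]
      ring
    have k3 : |∑ l, (D - L.QPsiPsi j) k l * z p l| ≤ d * (ε * ‖z p‖) := by
      refine (Finset.abs_sum_le_sum_abs _ _).trans ?_
      refine (Finset.sum_le_card_nsmul _ _ (ε * ‖z p‖) fun l _ => ?_).trans_eq (by rw [nsmul_eq_mul, Finset.card_univ])
      rw [abs_mul]
      exact mul_le_mul ((abs_apply_le_opNorm _ _ _).trans k1.le) (norm_le_pi_norm (z p) l)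
        (abs_nonneg _) hε.le
    rw [e2, Real.norm_eq_abs]
    refine (abs_add_le _ _).trans ?_
    rw [abs_mul]
    have k4 := mul_le_mul_of_nonneg_left k2 (abs_nonneg (vb p))
    have k5 : 0 ≤ ‖z p‖ := norm_nonneg _
    have k6 := abs_nonneg (vb p)
    rw [← hεc]
    nlinarith [mul_nonneg hε.le k5, mul_nonneg (mul_nonneg hε.le k6) hd]
  have := intervalIntegral.norm_integral_le_of_norm_le_const hbound
  simpa using this

/-- Local expansion of the cluster averages of the estimated score around the truth. -/
theorem isLittleO_empHat (hτ : τ ∈ Set.Ioo (0 : ℝ) 1) (hM : M.Meas)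
    (hB : M.Basic P τ) (hF : M.FiniteExpectations P τ) (hA : M.Asymptotics P τ L)
    {vb : ℕ × Ω → ℝ} {z : ℕ × Ω → Idx dw dphi → ℝ} (hvb : Tendsto vb (probFilter P A) (𝓝 0))
    (hz : Tendsto z (probFilter P A) (𝓝 0)) (j : Fin J) (k : Idx dw dphi) :
    (fun p => M.rate p.1 * M.empHat τ p.1 j p.2 (M.betaN p.1 + vb p)
          (M.gammaTrue p.1 + z p ∘ Sum.inl) (z p ∘ Sum.inr) k
        - M.rate p.1 * M.emp τ p.1 j p.2 (M.betaN p.1) (M.gammaTrue p.1) 0 k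
        + M.rate p.1 * (vb p * L.QPsiX j k + (L.QPsiPsi j *ᵥ z p) k))
      =o[probFilter P A] fun p => 1 + M.rate p.1 * (|vb p| + ‖z p‖) := by
  have h1 := (isLittleO_one_iff ℝ).mpr (isLittleO_empHat_sub_popHat hτ hM hB hF hA hvb hz j k)
  have h2 := (isBigO_refl (fun p : ℕ × Ω => M.rate p.1) (probFilter P A)).mul_isLittleO
    (isLittleO_popHat hM hB hF hA hvb hz j k)
  have hr : ∀ᶠ p in probFilter P A, 0 ≤ M.rate p.1 :=
    tendsto_fst_probFilter.eventually (hA.rate_tendsto.eventually_ge_atTop 0)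
  have g1 : (fun _ : ℕ × Ω => (1 : ℝ)) =O[probFilter P A]
      fun p => 1 + M.rate p.1 * (|vb p| + ‖z p‖) := by
    refine IsBigO.of_bound 1 (hr.mono fun p hp => ?_)
    have : 0 ≤ M.rate p.1 * (|vb p| + ‖z p‖) := by positivity
    rw [norm_one, one_mul, Real.norm_of_nonneg (by linarith)]
    linarith
  have g2 : (fun p : ℕ × Ω => M.rate p.1 * (|vb p| + ‖z p‖)) =O[probFilter P A]
      fun p => 1 + M.rate p.1 * (|vb p| + ‖z p‖) := by
    refine IsBigO.of_bound 1 (hr.mono fun p hp => ?_)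
    have : 0 ≤ M.rate p.1 * (|vb p| + ‖z p‖) := by positivity
    rw [one_mul, Real.norm_of_nonneg (by linarith), Real.norm_of_nonneg (by linarith)]
    linarith
  refine ((h1.trans_isBigO g1).add (h2.trans_isBigO g2)).congr_left fun p => ?_
  ring

end Expansion

end Model

/-! ### Positive definite matrices and subgradients -/

section Matrices

variable {ι : Type*} [Fintype ι]

open scoped Matrix.Norms.L2Operator in
theorem opNorm_nonneg [DecidableEq ι] (A : Matrix ι ι ℝ) : 0 ≤ opNorm A := norm_nonneg _

theorem exists_le_dotProduct_mulVec {A : Matrix ι ι ℝ} (hA : A.PosDef) :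
    ∃ c : ℝ, 0 < c ∧ ∀ x : ι → ℝ, c * ‖x‖ ^ 2 ≤ x ⬝ᵥ A *ᵥ x := by
  have hpos : ∀ x : ι → ℝ, x ≠ 0 → 0 < x ⬝ᵥ A *ᵥ x := fun x hx => by
    simpa using hA.dotProduct_mulVec_pos hx
  have hcont : Continuous fun x : ι → ℝ => x ⬝ᵥ A *ᵥ x := by
    unfold dotProduct mulVec dotProduct; fun_prop
  rcases (Metric.sphere (0 : ι → ℝ) 1).eq_empty_or_nonempty with he | hne
  · refine ⟨1, one_pos, fun x => ?_⟩
    have hx : x = 0 := by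
      by_contra hx
      have : ‖x‖⁻¹ • x ∈ Metric.sphere (0 : ι → ℝ) 1 := by
        simp [norm_smul, inv_mul_cancel₀ (norm_ne_zero_iff.mpr hx)]
      simp [he] at this
    simp [hx]
  · obtain ⟨u, hu, hmin⟩ := (isCompact_sphere (0 : ι → ℝ) 1).exists_isMinOn hne hcont.continuousOn
    have hu1 : ‖u‖ = 1 := by simpa using hu
    have hu0 : u ≠ 0 := norm_ne_zero_iff.mp (by rw [hu1]; exact one_ne_zero)
    refine ⟨_, hpos u hu0, fun x => ?_⟩
    rcases eq_or_ne x 0 with rfl | hx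
    · simp
    have hx' : 0 < ‖x‖ := norm_pos_iff.mpr hx
    have h1 : ‖x‖⁻¹ • x ∈ Metric.sphere (0 : ι → ℝ) 1 := by
      simp [norm_smul, inv_mul_cancel₀ hx'.ne']
    have h2 : u ⬝ᵥ A *ᵥ u ≤ (‖x‖⁻¹ • x) ⬝ᵥ A *ᵥ (‖x‖⁻¹ • x) := hmin h1
    rw [mulVec_smul, smul_dotProduct, dotProduct_smul, smul_eq_mul, smul_eq_mul] at h2
    calc (u ⬝ᵥ A *ᵥ u) * ‖x‖ ^ 2 ≤ ‖x‖⁻¹ * (‖x‖⁻¹ * (x ⬝ᵥ A *ᵥ x)) * ‖x‖ ^ 2 := by gcongr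
      _ = x ⬝ᵥ A *ᵥ x := by field_simp

theorem abs_dotProduct_le (x y : ι → ℝ) : |x ⬝ᵥ y| ≤ Fintype.card ι * (‖x‖ * ‖y‖) := by
  refine (Finset.abs_sum_le_sum_abs _ _).trans ?_
  refine (Finset.sum_le_card_nsmul _ _ (‖x‖ * ‖y‖) fun l _ => ?_).trans_eq
    (by rw [nsmul_eq_mul, Finset.card_univ])
  rw [abs_mul]
  exact mul_le_mul (norm_le_pi_norm x l) (norm_le_pi_norm y l) (abs_nonneg _) (norm_nonneg _)

theorem norm_mulVec_le [DecidableEq ι] (A : Matrix ι ι ℝ) (x : ι → ℝ) :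
    ‖A *ᵥ x‖ ≤ Fintype.card ι * (opNorm A * ‖x‖) := by
  have h0 : 0 ≤ opNorm A := opNorm_nonneg _
  refine (pi_norm_le_iff_of_nonneg (by positivity)).mpr fun k => ?_
  refine (abs_dotProduct_le (A k) x).trans ?_
  gcongr
  exact (pi_norm_le_iff_of_nonneg h0).mpr fun l => abs_apply_le_opNorm A k l

theorem exists_le_norm_mulVec {A : Matrix ι ι ℝ} (hA : A.PosDef) :
    ∃ c : ℝ, 0 < c ∧ ∀ x : ι → ℝ, c * ‖x‖ ≤ ‖A *ᵥ x‖ := by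
  obtain ⟨c, hc, h⟩ := exists_le_dotProduct_mulVec hA
  refine ⟨c / (Fintype.card ι + 1), by positivity, fun x => ?_⟩
  rcases eq_or_ne x 0 with rfl | hx
  · simp
  have hx' : 0 < ‖x‖ := norm_pos_iff.mpr hx
  have h1 := (h x).trans ((le_abs_self _).trans (abs_dotProduct_le x (A *ᵥ x)))
  rw [div_mul_eq_mul_div, div_le_iff₀ (by positivity)]
  have h2 : c * ‖x‖ ≤ Fintype.card ι * ‖A *ᵥ x‖ := by
    by_contra! h3
    nlinarith
  linarith [norm_nonneg (A *ᵥ x)]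

/-- Comparison of weighted norms implies comparison of norms, uniformly in the weights close to a
positive definite one. -/
theorem exists_norm_le_of_wnorm_le [DecidableEq ι] {A : Matrix ι ι ℝ} (hA : A.PosDef) :
    ∃ κ : ℝ, 0 < κ ∧ ∃ η : ℝ, 0 < η ∧ ∀ A' : Matrix ι ι ℝ, opNorm (A' - A) < η →
      ∀ x y : ι → ℝ, wnorm A' x ≤ wnorm A' y → ‖x‖ ≤ κ * ‖y‖ := by
  obtain ⟨c, hc, h⟩ := exists_le_dotProduct_mulVec hA
  set d : ℝ := ((Fintype.card ι : ℕ) : ℝ) with hd_def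
  have hd : 0 ≤ d := Nat.cast_nonneg _
  have hq : ∀ (D : Matrix ι ι ℝ) (x : ι → ℝ), |x ⬝ᵥ D *ᵥ x| ≤ d ^ 2 * opNorm D * ‖x‖ ^ 2 := by
    intro D x
    calc |x ⬝ᵥ D *ᵥ x| ≤ d * (‖x‖ * ‖D *ᵥ x‖) := abs_dotProduct_le _ _
      _ ≤ d * (‖x‖ * (d * (opNorm D * ‖x‖))) := by gcongr; exact norm_mulVec_le D x
      _ = _ := by ring
  set C : ℝ := d ^ 2 * opNorm A + c with hC
  have hC0 : 0 < C := by
    have : 0 ≤ opNorm A := opNorm_nonneg _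
    positivity
  refine ⟨2 * C / c + 1, by positivity, c / (2 * (d ^ 2 + 1)), by positivity,
    fun A' hA' x y hxy => ?_⟩
  -- The radius `η` is chosen so that replacing `A` by `A'` costs at most half of the lower bound
  -- `c` of the quadratic form.
  have hD : d ^ 2 * opNorm (A' - A) ≤ c / 2 := by
    have h0 : 0 ≤ opNorm (A' - A) := opNorm_nonneg _
    rw [lt_div_iff₀ (by positivity)] at hA'
    nlinarith
  have hsplit : ∀ x : ι → ℝ, x ⬝ᵥ A' *ᵥ x = x ⬝ᵥ A *ᵥ x + x ⬝ᵥ (A' - A) *ᵥ x := fun x => by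
    rw [← dotProduct_add, ← add_mulVec, add_sub_cancel]
  have hlow : ∀ x : ι → ℝ, c / 2 * ‖x‖ ^ 2 ≤ x ⬝ᵥ A' *ᵥ x := fun x => by
    have h1 := (abs_le.mp (hq (A' - A) x)).1
    have h2 := mul_le_mul_of_nonneg_right hD (sq_nonneg ‖x‖)
    rw [hsplit]
    linarith [h x]
  have hup : y ⬝ᵥ A' *ᵥ y ≤ C * ‖y‖ ^ 2 := by
    have h1 := (abs_le.mp (hq (A' - A) y)).2
    have h2 := mul_le_mul_of_nonneg_right hD (sq_nonneg ‖y‖)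
    have h3 := (abs_le.mp (hq A y)).2
    rw [hsplit, hC]
    nlinarith [mul_nonneg hc.le (sq_nonneg ‖y‖)]
  have h0 : 0 ≤ y ⬝ᵥ A' *ᵥ y := le_trans (by positivity) (hlow y)
  have h1 := (Real.sqrt_le_sqrt_iff h0).mp hxy
  have h2 : c / 2 * ‖x‖ ^ 2 ≤ C * ‖y‖ ^ 2 := (hlow x).trans (h1.trans hup)
  set κ := 2 * C / c + 1 with hκ
  have hκ1 : C ≤ c / 2 * κ := by rw [hκ]; field_simp; linarith
  have hκ2 : 1 ≤ κ := by rw [hκ]; linarith [show 0 ≤ 2 * C / c by positivity]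
  refine abs_le_of_sq_le_sq' ?_ (by positivity) |>.2
  have h3 : c / 2 * ‖x‖ ^ 2 ≤ c / 2 * (κ * ‖y‖) ^ 2 := by
    calc c / 2 * ‖x‖ ^ 2 ≤ C * ‖y‖ ^ 2 := h2
      _ ≤ (c / 2 * κ) * ‖y‖ ^ 2 := by gcongr
      _ ≤ (c / 2 * κ) * ‖y‖ ^ 2 * κ := le_mul_of_one_le_right (by positivity) hκ2
      _ = _ := by ring
  exact le_of_mul_le_mul_left h3 (by positivity)

/-- At a convex combination the subgradient inequalities toward both endpoints average to the
convexity inequality, as the weighted displacements cancel. -/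
theorem convexOn_of_subgradient {f : (ι → ℝ) → ℝ} {g : (ι → ℝ) → ι → ℝ}
    (h : ∀ x y, f x - g x ⬝ᵥ (y - x) ≤ f y) : ConvexOn ℝ Set.univ f := by
  refine ⟨convex_univ, fun x _ y _ a c ha hc hac => ?_⟩
  have h1 := h (a • x + c • y) x
  have h2 := h (a • x + c • y) y
  have h3 : a * (g (a • x + c • y) ⬝ᵥ (x - (a • x + c • y)))
      + c * (g (a • x + c • y) ⬝ᵥ (y - (a • x + c • y))) = 0 := by
    rw [← smul_eq_mul, ← smul_eq_mul, ← dotProduct_smul, ← dotProduct_smul, ← dotProduct_add]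
    have : a • (x - (a • x + c • y)) + c • (y - (a • x + c • y)) = 0 := by
      obtain rfl : c = 1 - a := by linarith
      module
    rw [this, dotProduct_zero]
  simp only [smul_eq_mul]
  have h4 := mul_le_mul_of_nonneg_left h1 ha
  have h5 := mul_le_mul_of_nonneg_left h2 hc
  have h6 : f (a • x + c • y) = a * f (a • x + c • y) + c * f (a • x + c • y) := by
    rw [← add_mul, hac, one_mul]
  linarith

end Matrices

/-! ### Subgradients of the sample objective -/

namespace Model

variable {J dw dphi dz : ℕ} {Ω : Type*} {M : Model J dw dphi dz Ω}

/-- The average over the whole sample of the estimated score, as a function of `z = (r, t)`. -/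
noncomputable def scoreHat (M : Model J dw dphi dz Ω) (τ : ℝ) (n : ℕ) (ω : Ω) (b : ℝ)
    (z : Idx dw dphi → ℝ) : Idx dw dphi → ℝ :=
  fun k => (M.total n : ℝ)⁻¹ * ∑ j, ∑ i, M.fHat τ n j i ω ω b (z ∘ Sum.inl) (z ∘ Sum.inr) k

theorem scoreHat_eq (τ : ℝ) (n : ℕ) (ω : Ω) (b : ℝ) (z : Idx dw dphi → ℝ) (k : Idx dw dphi) :
    M.scoreHat τ n ω b z k = ∑ j, (M.size n j : ℝ) / (M.total n : ℝ)
      * M.empHat τ n j ω b (z ∘ Sum.inl) (z ∘ Sum.inr) k := by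
  rw [scoreHat, Finset.mul_sum]
  refine Finset.sum_congr rfl fun j _ => ?_
  rw [empHat]
  rcases Nat.eq_zero_or_pos (M.size n j) with h | h
  · have : IsEmpty (Fin (M.size n j)) := by rw [h]; infer_instance
    simp
  · have : (M.size n j : ℝ) ≠ 0 := by positivity
    field_simp

variable [MeasurableSpace Ω]

/-- The scores are subgradients of the sample objective. -/
theorem QHat_ge {τ : ℝ} (hτ : τ ∈ Set.Ioo (0 : ℝ) 1) (hM : M.Meas) (n : ℕ) (ω : Ω) (b : ℝ)
    (z z' : Idx dw dphi → ℝ) :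
    M.QHat τ n ω b (z ∘ Sum.inl) (z ∘ Sum.inr) - M.scoreHat τ n ω b z ⬝ᵥ (z' - z)
      ≤ M.QHat τ n ω b (z' ∘ Sum.inl) (z' ∘ Sum.inr) := by
  have hres : ∀ j i (z : Idx dw dphi → ℝ), M.y n j i ω - M.X n j i ω * b
      - M.W n j i ω ⬝ᵥ (z ∘ Sum.inl) - M.phiHat n j i ω ω ⬝ᵥ (z ∘ Sum.inr)
      = M.y n j i ω - M.X n j i ω * b - M.psiHat n j i ω ω ⬝ᵥ z := by
    intro j i z
    conv_rhs => rw [← Sum.elim_comp_inl_inr z]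
    rw [psiHat, sumElim_dotProduct_sumElim, sub_sub (M.y n j i ω - M.X n j i ω * b)]
  have h4 : M.scoreHat τ n ω b z ⬝ᵥ (z' - z) = (M.total n : ℝ)⁻¹ *
      ∑ j, ∑ i, ∑ k, M.fHat τ n j i ω ω b (z ∘ Sum.inl) (z ∘ Sum.inr) k * (z' - z) k := by
    simp only [scoreHat, dotProduct, mul_assoc, ← Finset.mul_sum, Finset.sum_mul]
    congr 1
    rw [Finset.sum_comm]
    exact Finset.sum_congr rfl fun j _ => Finset.sum_comm
  rw [h4, QHat, QHat, ← mul_sub]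
  refine mul_le_mul_of_nonneg_left ?_ (by positivity)
  simp_rw [objective, ← Finset.sum_sub_distrib]
  refine Finset.sum_le_sum fun j _ => Finset.sum_le_sum fun i _ => ?_
  rw [hres, hres]
  simp only [fHat, score_eq]
  set u := M.y n j i ω - M.X n j i ω * b - M.psiHat n j i ω ω ⬝ᵥ z with hu
  have h2 : M.y n j i ω - M.X n j i ω * b - M.psiHat n j i ω ω ⬝ᵥ z'
      = u - M.psiHat n j i ω ω ⬝ᵥ (z' - z) := by
    rw [dotProduct_sub, hu]; ring
  have h3 : ∑ k, (τ - if M.y n j i ω - M.X n j i ω * b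
        - Sum.elim (M.W n j i ω) (M.phiHat n j i ω ω) ⬝ᵥ z ≤ 0 then 1 else 0)
        * (Sum.elim (M.W n j i ω) (M.phiHat n j i ω ω) k * M.vHat n j i ω ω) * (z' - z) k
      = (τ - if u ≤ 0 then 1 else 0) * (M.psiHat n j i ω ω ⬝ᵥ (z' - z)) * M.vHat n j i ω ω := by
    change ∑ k, (τ - if u ≤ 0 then 1 else 0) * (M.psiHat n j i ω ω k * M.vHat n j i ω ω)
      * (z' - z) k = (τ - if u ≤ 0 then 1 else 0) * (∑ k, M.psiHat n j i ω ω k * (z' - z) k)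
        * M.vHat n j i ω ω
    rw [Finset.mul_sum, Finset.sum_mul]
    exact Finset.sum_congr rfl fun k _ => by ring
  rw [h2, h3, ← sub_mul]
  exact mul_le_mul_of_nonneg_right (rho_sub_ge hτ _ _) (hM.VHat_nonneg _ _ _ _ _)

theorem perturbed_ge {τ : ℝ} (hτ : τ ∈ Set.Ioo (0 : ℝ) 1) (hM : M.Meas) (n : ℕ) (ω : Ω) (b : ℝ)
    (h z z' : Idx dw dphi → ℝ) :
    (M.QHat τ n ω b (z ∘ Sum.inl) (z ∘ Sum.inr) - h ⬝ᵥ z)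
        - (M.scoreHat τ n ω b z + h) ⬝ᵥ (z' - z)
      ≤ M.QHat τ n ω b (z' ∘ Sum.inl) (z' ∘ Sum.inr) - h ⬝ᵥ z' := by
  have := QHat_ge hτ hM n ω b z z'
  rw [add_dotProduct, dotProduct_sub h]
  linarith

theorem perturbed_convex {τ : ℝ} (hτ : τ ∈ Set.Ioo (0 : ℝ) 1) (hM : M.Meas) (n : ℕ) (ω : Ω)
    (b : ℝ) (h : Idx dw dphi → ℝ) : ConvexOn ℝ Set.univ fun z : Idx dw dphi → ℝ =>
      M.QHat τ n ω b (z ∘ Sum.inl) (z ∘ Sum.inr) - h ⬝ᵥ z :=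
  convexOn_of_subgradient (perturbed_ge hτ hM n ω b h)

/-! ### Consistency of the estimators -/

section Consistency

variable {J dw dphi dz : ℕ} {Ω : Type*} {M : Model J dw dphi dz Ω}

/-- Eventually along `ℓ`, `xs p b` minimizes for all `b ∈ ℬ` the sample objective, perturbed by the
linear function `h p`. -/
def IsMinimizer (M : Model J dw dphi dz Ω) (τ : ℝ) (ℓ : Filter (ℕ × Ω))
    (h : ℕ × Ω → Idx dw dphi → ℝ) (xs : ℕ × Ω → ℝ → Idx dw dphi → ℝ) : Prop :=
  ∀ᶠ p in ℓ, ∀ b ∈ M.B, ∀ z : Idx dw dphi → ℝ,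
    M.QHat τ p.1 p.2 b (xs p b ∘ Sum.inl) (xs p b ∘ Sum.inr) - h p ⬝ᵥ xs p b
      ≤ M.QHat τ p.1 p.2 b (z ∘ Sum.inl) (z ∘ Sum.inr) - h p ⬝ᵥ z

/-- Eventually along `ℓ`, `bs p` minimizes over `ℬ` the weighted norm of the second block of
`xs p b`. -/
def IsSelector (M : Model J dw dphi dz Ω) (ℓ : Filter (ℕ × Ω))
    (xs : ℕ × Ω → ℝ → Idx dw dphi → ℝ) (bs : ℕ × Ω → ℝ) : Prop :=
  ∀ᶠ p in ℓ, bs p ∈ M.B ∧ ∀ b ∈ M.B,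
    wnorm (M.A1Hat p.1 p.2) (xs p (bs p) ∘ Sum.inr) ≤ wnorm (M.A1Hat p.1 p.2) (xs p b ∘ Sum.inr)

theorem norm_comp_le {ι κ : Type*} [Fintype ι] [Fintype κ] (x : ι → ℝ) (e : κ → ι) :
    ‖x ∘ e‖ ≤ ‖x‖ :=
  (pi_norm_le_iff_of_nonneg (norm_nonneg _)).mpr fun k => norm_le_pi_norm x (e k)

variable [MeasurableSpace Ω] {P : Measure Ω} [IsProbabilityMeasure P] {τ : ℝ}
  {L : Limits J dw dphi} {A : ℕ → Set Ω} {h : ℕ × Ω → Idx dw dphi → ℝ}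
  {xs : ℕ × Ω → ℝ → Idx dw dphi → ℝ} {bs : ℕ × Ω → ℝ}

omit [IsProbabilityMeasure P] in
-- The perturbed sample objective is convex and close to the limit objective on a finite set,
-- uniformly in `b`. The three errors, namely sample against population, population against limit,
-- and the linear term, get `η / 3` each.
theorem IsMinimizer.eventually_norm_sub_lt (hmin : M.IsMinimizer τ (probFilter P A) h xs)
    (hτ : τ ∈ Set.Ioo (0 : ℝ) 1) (hX : M.Assumptions P τ L)
    (hh : Tendsto h (probFilter P A) (𝓝 0)) {ε : ℝ} (hε : 0 < ε) :
    ∀ᶠ p in probFilter P A, ∀ b ∈ M.B, ‖xs p b - M.argInf b‖ < ε := by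
  obtain ⟨F, η, hη, hF⟩ := exists_finset_argInf_close hτ hX.meas hX.finite hX.asymptotics
    hX.basic hε
  have h1 : ∀ᶠ p in probFilter P A, ∀ z ∈ F, ∀ b ∈ M.B,
      |M.QHat τ p.1 p.2 b (z ∘ Sum.inl) (z ∘ Sum.inr)
        - M.QN P τ p.1 b (z ∘ Sum.inl) (z ∘ Sum.inr)| < η / 3 := by
    rw [eventually_all_finset]
    intro z _
    refine eventually_probFilter_of_tendsto ?_
    simpa using hX.asymptotics.obj_sample (z ∘ Sum.inl) (z ∘ Sum.inr) (η / 3) (by positivity)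
  have h2 : ∀ᶠ p in probFilter P A, ∀ z ∈ F, ∀ b ∈ M.B,
      |M.QN P τ p.1 b (z ∘ Sum.inl) (z ∘ Sum.inr) - M.Qinf b (z ∘ Sum.inl) (z ∘ Sum.inr)|
        < η / 3 := by
    rw [eventually_all_finset]
    intro z _
    have h4 := (tendsto_fst_probFilter (P := P) (A := A)).eventually (Metric.tendstoUniformlyOn_iff.mp
      (hX.asymptotics.obj_pop (z ∘ Sum.inl) (z ∘ Sum.inr)) (η / 3) (by positivity))
    filter_upwards [h4] with p hp b hb
    rw [abs_sub_comm]
    exact hp b hb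
  have h3 : ∀ᶠ p in probFilter P A, ∀ z ∈ F, |h p ⬝ᵥ z| < η / 3 := by
    rw [eventually_all_finset]
    intro z _
    have hc : Continuous fun w : Idx dw dphi → ℝ => |w ⬝ᵥ z| := by
      unfold dotProduct; fun_prop
    have := (hc.tendsto 0).comp hh
    exact this.eventually_lt_const (by simpa using by positivity)
  filter_upwards [h1, h2, h3, hmin] with p h1 h2 h3 h4 b hb
  refine hF b hb _ (perturbed_convex hτ hX.meas p.1 p.2 b (h p)) (fun z hz => ?_) _ (h4 b hb)
  have k1 := abs_lt.mp (h1 z hz b hb)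
  have k2 := abs_lt.mp (h2 z hz b hb)
  have k3 := abs_lt.mp (h3 z hz)
  rw [abs_le]
  constructor <;> linarith [k1.1, k1.2, k2.1, k2.2, k3.1, k3.2]

theorem tendsto_argInf (hτ : τ ∈ Set.Ioo (0 : ℝ) 1) (hX : M.Assumptions P τ L)
    (hbs : Tendsto bs (probFilter P A) (𝓝 M.beta0)) (hB : ∀ᶠ p in probFilter P A, bs p ∈ M.B) :
    Tendsto (fun p => M.argInf (bs p)) (probFilter P A) (𝓝 (Sum.elim M.gamma0 0)) := by
  rw [← argInf_beta0 hτ hX.meas hX.finite hX.asymptotics hX.basic]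
  exact ((continuousOn_argInf hX.asymptotics) _ (beta0_mem hX.asymptotics hX.basic)).tendsto.comp
    (tendsto_nhdsWithin_iff.mpr ⟨hbs, hB⟩)

theorem IsMinimizer.tendsto_sub_truth (hmin : M.IsMinimizer τ (probFilter P A) h xs)
    (hτ : τ ∈ Set.Ioo (0 : ℝ) 1) (hX : M.Assumptions P τ L)
    (hh : Tendsto h (probFilter P A) (𝓝 0)) (hbs : Tendsto bs (probFilter P A) (𝓝 M.beta0))
    (hB : ∀ᶠ p in probFilter P A, bs p ∈ M.B) :
    Tendsto (fun p => xs p (bs p) - M.truth p.1) (probFilter P A) (𝓝 0) := by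
  have h1 : Tendsto (fun p => xs p (bs p) - M.argInf (bs p)) (probFilter P A) (𝓝 0) := by
    rw [Metric.tendsto_nhds]
    intro ε hε
    filter_upwards [hmin.eventually_norm_sub_lt hτ hX hh hε, hB] with p h1 h2
    simpa using h1 _ h2
  have h2 := (tendsto_argInf hτ hX hbs hB).sub
    ((tendsto_truth hX.asymptotics).comp (tendsto_fst_probFilter (P := P) (A := A)))
  rw [sub_self] at h2
  have h3 := h1.add h2
  rw [add_zero] at h3
  exact h3.congr fun p => by simp

omit [IsProbabilityMeasure P] in
theorem eventually_betaN_mem' (hX : M.Assumptions P τ L) :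
    ∀ᶠ p in probFilter P A, M.betaN p.1 ∈ M.B :=
  tendsto_fst_probFilter.eventually (p := fun n => M.betaN n ∈ M.B)
    (eventually_betaN_mem hX.basic)

omit [IsProbabilityMeasure P] in
theorem tendsto_betaN' (hX : M.Assumptions P τ L) :
    Tendsto (fun p : ℕ × Ω => M.betaN p.1) (probFilter P A) (𝓝 M.beta0) :=
  (tendsto_betaN hX.asymptotics).comp tendsto_fst_probFilter

omit [IsProbabilityMeasure P] in
-- The competitor `b = β_n` has a small second block. The weights converge to a positive definite
-- matrix, so the comparison in weighted norm becomes one in norm, with `κ` depending on the limits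
-- only.
theorem IsSelector.exists_norm_le (hL : L.Regular) :
    ∃ κ : ℝ, 0 < κ ∧ ∀ (dz : ℕ) (Ω : Type*) [MeasurableSpace Ω] (P : Measure Ω)
      (A : ℕ → Set Ω) (M : Model J dw dphi dz Ω) (τ : ℝ)
      (xs : ℕ × Ω → ℝ → Idx dw dphi → ℝ) (bs : ℕ × Ω → ℝ), M.Assumptions P τ L →
      M.IsSelector (probFilter P A) xs bs → ∀ᶠ p in probFilter P A,
        ‖xs p (bs p) ∘ Sum.inr‖ ≤ κ * ‖xs p (M.betaN p.1) ∘ Sum.inr‖ := by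
  obtain ⟨κ, hκ, η, hη, h⟩ := exists_norm_le_of_wnorm_le hL.A1_posDef
  refine ⟨κ, hκ, fun dz Ω _ P A M τ xs bs hX hsel => ?_⟩
  have hA1 := (hX.identification.weight.tendsto (A := A)).eventually_lt_const hη
  filter_upwards [hA1, hsel, eventually_betaN_mem' hX] with p h1 h2 h3
  exact h _ h1 _ _ (h2.2 _ h3)

/-- Away from `β_0` the limit `θ_∞` is nonzero by identification, hence bounded below by
compactness. The selected second block is small by comparison with `β_n`, and it is uniformly close
to `θ_∞`. -/
theorem IsSelector.tendsto (hsel : M.IsSelector (probFilter P A) xs bs)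
    (hmin : M.IsMinimizer τ (probFilter P A) h xs) (hτ : τ ∈ Set.Ioo (0 : ℝ) 1)
    (hL : L.Regular) (hX : M.Assumptions P τ L) (hh : Tendsto h (probFilter P A) (𝓝 0)) :
    Tendsto bs (probFilter P A) (𝓝 M.beta0) := by
  obtain ⟨κ, hκ, hnorm⟩ := IsSelector.exists_norm_le hL
  have h0 := hmin.tendsto_sub_truth hτ hX hh (tendsto_betaN' hX) (eventually_betaN_mem' hX)
  have htruth : ∀ n, M.truth n ∘ Sum.inr = 0 := fun n => by simp [truth]
  rw [Metric.tendsto_nhds]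
  intro ε hε
  set K : Set ℝ := M.B ∩ {b | ε ≤ dist b M.beta0}
  have hK : IsCompact K := hX.basic.B_compact.inter_right
    (isClosed_le continuous_const (continuous_id.dist continuous_const))
  have hcont : ContinuousOn (fun b => ‖M.argInf b ∘ Sum.inr‖) K := by
    have h1 : Continuous fun z : Idx dw dphi → ℝ => ‖z ∘ (Sum.inr : Fin dphi → Idx dw dphi)‖ :=
      continuous_norm.comp (continuous_pi fun k => continuous_apply (Sum.inr k))
    exact h1.comp_continuousOn ((continuousOn_argInf hX.asymptotics).mono Set.inter_subset_left)
  obtain ⟨η, hη, hlow⟩ : ∃ η : ℝ, 0 < η ∧ ∀ b ∈ K, η ≤ ‖M.argInf b ∘ Sum.inr‖ := by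
    rcases K.eq_empty_or_nonempty with he | hne
    · exact ⟨1, one_pos, fun b hb => by simp [he] at hb⟩
    · obtain ⟨b, hb, hbmin⟩ := hK.exists_isMinOn hne hcont
      refine ⟨_, norm_pos_iff.mpr fun h1 => ?_, fun b' hb' => hbmin hb'⟩
      have h2 := eq_beta0_of_thetaInf_eq_zero hτ hX.meas hX.finite hX.asymptotics hX.basic
        hX.identification hb.1 h1
      have h3 : ε ≤ dist b M.beta0 := hb.2
      rw [h2, dist_self] at h3
      linarith
  have hnt := h0.norm.eventually_lt_const (u := η / (2 * κ)) (by simpa using by positivity)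
  filter_upwards [hnorm dz Ω P A M τ xs bs hX hsel, hsel, hnt,
    hmin.eventually_norm_sub_lt hτ hX hh (half_pos hη)] with p h1 h2 h3 h4
  by_contra! h5
  have h6 := hlow _ ⟨h2.1, h5⟩
  have h7 := (norm_comp_le (xs p (bs p) - M.argInf (bs p)) Sum.inr).trans_lt (h4 _ h2.1)
  have h8 := (norm_comp_le (xs p (M.betaN p.1) - M.truth p.1) Sum.inr).trans_lt h3
  have e8 : (xs p (M.betaN p.1) - M.truth p.1) ∘ Sum.inr = xs p (M.betaN p.1) ∘ Sum.inr := by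
    rw [Pi.sub_comp, htruth, sub_zero]
  rw [e8, lt_div_iff₀ (by positivity)] at h8
  have h9 := norm_sub_norm_le (M.argInf (bs p) ∘ Sum.inr) (xs p (bs p) ∘ Sum.inr)
  have e9 : ‖M.argInf (bs p) ∘ (Sum.inr : Fin dphi → Idx dw dphi) - xs p (bs p) ∘ Sum.inr‖
      = ‖(xs p (bs p) - M.argInf (bs p)) ∘ Sum.inr‖ := by
    rw [norm_sub_rev, Pi.sub_comp]
  rw [e9] at h9
  linarith

end Consistency

end Model

/-! ### Block structure of the limit matrices -/

namespace Limits

variable {J dw dphi : ℕ} (L : Limits J dw dphi)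

/-- `Q_{Ψ,X} = ∑ ξ_j Q_{Ψ,X,j}`. -/
def QPX : Idx dw dphi → ℝ := ∑ j, L.xi j • L.QPsiX j

theorem QPX_comp_inr : L.QPX ∘ Sum.inr = L.QPhiX := by
  ext l
  simp [QPX, QPhiX, QPhiXj]

variable {L}

theorem Regular.QPhiPhi_posDef (hL : L.Regular) : L.QPhiPhi.PosDef :=
  hL.QPP_posDef.submatrix (e := Sum.inr) Sum.inr_injective

theorem Regular.QPP_inl_inr (hL : L.Regular) (k : Fin dw) (l : Fin dphi) :
    L.QPP (Sum.inl k) (Sum.inr l) = 0 := by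
  have h : ∀ j, L.QPsiPsi j (Sum.inl k) (Sum.inr l) = 0 := fun j =>
    congrFun (congrFun (hL.orthogonality j) k) l
  simp [QPP, Matrix.sum_apply, h]

theorem Regular.QPP_inr_inl (hL : L.Regular) (k : Fin dw) (l : Fin dphi) :
    L.QPP (Sum.inr l) (Sum.inl k) = 0 := by
  have h := hL.QPP_posDef.isHermitian.apply (Sum.inr l) (Sum.inl k)
  rw [hL.QPP_inl_inr] at h
  simpa using h.symm

theorem Regular.QPP_mulVec_comp_inr (hL : L.Regular) (z : Idx dw dphi → ℝ) :
    (L.QPP *ᵥ z) ∘ Sum.inr = L.QPhiPhi *ᵥ (z ∘ Sum.inr) := by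
  ext l
  simp [mulVec, dotProduct, Fintype.sum_sum_type, hL.QPP_inr_inl, QPhiPhi, toBlocks₂₂]

theorem Regular.QPhiX_ne_zero (hL : L.Regular) : L.QPhiX ≠ 0 := fun h => by
  have := hL.strength_pos
  simp [strength, h] at this

end Limits

/-! ### Linearized first-order conditions and the rate of the estimators -/

namespace Model

section FirstOrder

open _root_.Asymptotics

variable {J dw dphi dz : ℕ} {Ω : Type*} {M : Model J dw dphi dz Ω}

/-- The scaled average over the whole sample of the score at the true parameters. -/
noncomputable def scoreN (M : Model J dw dphi dz Ω) (τ : ℝ) (n : ℕ) (ω : Ω) : Idx dw dphi → ℝ :=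
  fun k => M.rate n * ∑ j, (M.size n j : ℝ) / (M.total n : ℝ)
    * M.emp τ n j ω (M.betaN n) (M.gammaTrue n) 0 k

variable [MeasurableSpace Ω] {P : Measure Ω} {τ : ℝ}
  {L : Limits J dw dphi} {A : ℕ → Set Ω} {h : ℕ × Ω → Idx dw dphi → ℝ}
  {xs : ℕ × Ω → ℝ → Idx dw dphi → ℝ} {bs : ℕ × Ω → ℝ}

theorem tendsto_rate' (hX : M.Assumptions P τ L) :
    Tendsto (fun p : ℕ × Ω => M.rate p.1) (probFilter P A) atTop :=
  hX.asymptotics.rate_tendsto.comp tendsto_fst_probFilter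

theorem tendsto_share' (hX : M.Assumptions P τ L) (j : Fin J) :
    Tendsto (fun p : ℕ × Ω => (M.size p.1 j : ℝ) / (M.total p.1 : ℝ)) (probFilter P A)
      (𝓝 (L.xi j)) :=
  (hX.asymptotics.share j).comp tendsto_fst_probFilter

omit [MeasurableSpace Ω] in
theorem isBigO_one_add {u : ℕ × Ω → ℝ} {ℓ : Filter (ℕ × Ω)} (hu : ∀ᶠ p in ℓ, 0 ≤ u p) :
    (fun _ : ℕ × Ω => (1 : ℝ)) =O[ℓ] (fun p => 1 + u p) ∧ u =O[ℓ] fun p => 1 + u p := by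
  constructor <;> refine IsBigO.of_bound 1 (hu.mono fun p hp => ?_)
  · rw [norm_one, one_mul, Real.norm_of_nonneg (by linarith)]
    linarith
  · rw [one_mul, Real.norm_of_nonneg (by linarith), Real.norm_of_nonneg (by linarith)]
    linarith

theorem rate_mul_nonneg (hX : M.Assumptions P τ L) (u : ℕ × Ω → ℝ) (hu : ∀ p, 0 ≤ u p) :
    ∀ᶠ p in probFilter P A, 0 ≤ M.rate p.1 * u p :=
  ((tendsto_rate' hX).eventually_ge_atTop 0).mono fun p hp => mul_nonneg hp (hu p)

variable [IsProbabilityMeasure P]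

/-- Local expansion of the average of the estimated score around the truth. -/
theorem isLittleO_scoreHat (hτ : τ ∈ Set.Ioo (0 : ℝ) 1) (hX : M.Assumptions P τ L)
    {vb : ℕ × Ω → ℝ} {z : ℕ × Ω → Idx dw dphi → ℝ} (hvb : Tendsto vb (probFilter P A) (𝓝 0))
    (hz : Tendsto z (probFilter P A) (𝓝 0)) (k : Idx dw dphi) :
    (fun p => M.rate p.1 * M.scoreHat τ p.1 p.2 (M.betaN p.1 + vb p) (M.truth p.1 + z p) k
        - M.scoreN τ p.1 p.2 k + M.rate p.1 * (vb p * L.QPX k + (L.QPP *ᵥ z p) k))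
      =o[probFilter P A] fun p => 1 + M.rate p.1 * (|vb p| + ‖z p‖) := by
  have hnn := rate_mul_nonneg (A := A) hX (fun p => |vb p| + ‖z p‖) fun p => by positivity
  have h1 : ∀ j : Fin J, (fun p : ℕ × Ω => (M.size p.1 j : ℝ) / (M.total p.1 : ℝ) *
      (M.rate p.1 * M.empHat τ p.1 j p.2 (M.betaN p.1 + vb p)
          (M.gammaTrue p.1 + z p ∘ Sum.inl) (z p ∘ Sum.inr) k
        - M.rate p.1 * M.emp τ p.1 j p.2 (M.betaN p.1) (M.gammaTrue p.1) 0 k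
        + M.rate p.1 * (vb p * L.QPsiX j k + (L.QPsiPsi j *ᵥ z p) k)))
      =o[probFilter P A] fun p => 1 + M.rate p.1 * (|vb p| + ‖z p‖) := fun j => by
    simpa using ((tendsto_share' hX j).isBigO_one ℝ).mul_isLittleO
      (isLittleO_empHat hτ hX.meas hX.basic hX.finite hX.asymptotics hvb hz j k)
  have h2 : ∀ j : Fin J, (fun p : ℕ × Ω => ((M.size p.1 j : ℝ) / (M.total p.1 : ℝ) - L.xi j) *
      (M.rate p.1 * (vb p * L.QPsiX j k + (L.QPsiPsi j *ᵥ z p) k)))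
      =o[probFilter P A] fun p => 1 + M.rate p.1 * (|vb p| + ‖z p‖) := fun j => by
    have g1 : (fun p : ℕ × Ω => (M.size p.1 j : ℝ) / (M.total p.1 : ℝ) - L.xi j)
        =o[probFilter P A] fun _ => (1 : ℝ) := by
      rw [isLittleO_one_iff]
      simpa using (tendsto_share' (A := A) hX j).sub_const (L.xi j)
    have g2 : (fun p : ℕ × Ω => vb p * L.QPsiX j k + (L.QPsiPsi j *ᵥ z p) k)
        =O[probFilter P A] fun p => |vb p| + ‖z p‖ := by
      refine IsBigO.of_bound (|L.QPsiX j k| + Fintype.card (Idx dw dphi) * opNorm (L.QPsiPsi j))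
        (Eventually.of_forall fun p => ?_)
      have e1 : |(L.QPsiPsi j *ᵥ z p) k|
          ≤ Fintype.card (Idx dw dphi) * (opNorm (L.QPsiPsi j) * ‖z p‖) :=
        (norm_le_pi_norm (L.QPsiPsi j *ᵥ z p) k).trans (norm_mulVec_le _ _)
      rw [Real.norm_eq_abs, Real.norm_of_nonneg (by positivity : (0 : ℝ) ≤ |vb p| + ‖z p‖)]
      refine (abs_add_le _ _).trans ?_
      rw [abs_mul]
      have e2 := opNorm_nonneg (L.QPsiPsi j)
      have e3 : 0 ≤ (Fintype.card (Idx dw dphi) * opNorm (L.QPsiPsi j)) * |vb p| := by positivity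
      have e4 : 0 ≤ |L.QPsiX j k| * ‖z p‖ := by positivity
      nlinarith
    have g3 := g1.mul_isBigO
      ((isBigO_refl (fun p : ℕ × Ω => M.rate p.1) (probFilter P A)).mul g2)
    simp only [one_mul] at g3
    exact g3.trans_isBigO (isBigO_one_add hnn).2
  have h3 := (IsLittleO.sum fun j (_ : j ∈ Finset.univ) => h1 j).sub
    (IsLittleO.sum fun j (_ : j ∈ Finset.univ) => h2 j)
  refine h3.congr_left fun p => ?_
  have e1 : (M.truth p.1 + z p) ∘ Sum.inl = M.gammaTrue p.1 + z p ∘ Sum.inl := by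
    ext i; simp [truth]
  have e2 : (M.truth p.1 + z p) ∘ Sum.inr = z p ∘ Sum.inr := by
    ext i; simp [truth]
  have e3 : L.QPX k = ∑ j, L.xi j * L.QPsiX j k := by simp [Limits.QPX]
  have e4 : (L.QPP *ᵥ z p) k = ∑ j, L.xi j * (L.QPsiPsi j *ᵥ z p) k := by
    simp [Limits.QPP, Matrix.sum_mulVec, smul_mulVec]
  rw [scoreHat_eq, e1, e2, e3, e4, scoreN]
  simp only [Finset.sum_apply, Finset.mul_sum, ← Finset.sum_sub_distrib,
    ← Finset.sum_add_distrib]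
  exact Finset.sum_congr rfl fun j _ => by ring

/-- First-order condition of the perturbed minimization problem, linearized at the truth. -/
theorem IsMinimizer.isLittleO_firstOrder_aux (hmin : M.IsMinimizer τ (probFilter P A) h xs)
    (hτ : τ ∈ Set.Ioo (0 : ℝ) 1) (hX : M.Assumptions P τ L)
    (hh : Tendsto h (probFilter P A) (𝓝 0)) (hbs : Tendsto bs (probFilter P A) (𝓝 M.beta0))
    (hB : ∀ᶠ p in probFilter P A, bs p ∈ M.B) (k : Idx dw dphi) :
    (fun p => M.scoreN τ p.1 p.2 k + M.rate p.1 * h p k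
        - M.rate p.1 * ((bs p - M.betaN p.1) * L.QPX k
          + (L.QPP *ᵥ (xs p (bs p) - M.truth p.1)) k))
      =o[probFilter P A] fun p => 1 + M.rate p.1 *
        (|bs p - M.betaN p.1| + ‖xs p (bs p) - M.truth p.1‖) := by
  have hvb : Tendsto (fun p : ℕ × Ω => bs p - M.betaN p.1) (probFilter P A) (𝓝 0) := by
    simpa using hbs.sub (tendsto_betaN' hX)
  have hvx := hmin.tendsto_sub_truth hτ hX hh hbs hB
  have hr := tendsto_rate' (A := A) hX
  set u : ℕ × Ω → ℝ := fun p => M.rate p.1 *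
    (|bs p - M.betaN p.1| + ‖xs p (bs p) - M.truth p.1‖) with hu
  have hun : ∀ᶠ p in probFilter P A, 0 ≤ u p :=
    rate_mul_nonneg hX _ fun p => by positivity
  -- The sample score is discontinuous, so it need not vanish at a minimizer. It is evaluated
  -- instead at steps `± r_n⁻²` along a coordinate; after multiplication by `r_n` this displacement
  -- is still negligible.
  have hs0 : Tendsto (fun p : ℕ × Ω => (M.rate p.1)⁻¹ ^ 2) (probFilter P A) (𝓝 0) := by
    simpa using (tendsto_inv_atTop_zero.comp hr).pow 2
  have hrs : Tendsto (fun p : ℕ × Ω => M.rate p.1 * (M.rate p.1)⁻¹ ^ 2) (probFilter P A)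
      (𝓝 0) := by
    refine (tendsto_inv_atTop_zero.comp hr).congr' ?_
    filter_upwards [hr.eventually_gt_atTop 0] with p hp
    simp only [Function.comp_apply]
    field_simp
  have hexp : ∀ σ : ℝ, |σ| = 1 → (fun p => M.rate p.1 * M.scoreHat τ p.1 p.2 (bs p)
        (xs p (bs p) + (σ * (M.rate p.1)⁻¹ ^ 2) • Pi.single k 1) k
        - M.scoreN τ p.1 p.2 k + M.rate p.1 * ((bs p - M.betaN p.1) * L.QPX k
        + (L.QPP *ᵥ (xs p (bs p) - M.truth p.1 + (σ * (M.rate p.1)⁻¹ ^ 2) • Pi.single k 1)) k))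
      =o[probFilter P A] fun p => 1 + u p := by
    intro σ hσ
    have hz : Tendsto (fun p : ℕ × Ω => xs p (bs p) - M.truth p.1
        + (σ * (M.rate p.1)⁻¹ ^ 2) • (Pi.single k 1 : Idx dw dphi → ℝ))
        (probFilter P A) (𝓝 0) := by
      simpa using hvx.add ((hs0.const_mul σ).smul_const (Pi.single k 1 : Idx dw dphi → ℝ))
    refine ((isLittleO_scoreHat hτ hX hvb hz k).congr_left fun p => ?_).trans_isBigO ?_
    · rw [add_sub_cancel, ← add_assoc, add_sub_cancel]
    · refine IsBigO.of_bound 2 ?_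
      filter_upwards [hrs.eventually_lt_const one_pos, hr.eventually_gt_atTop 0, hun]
        with p h1 h2 h3
      have h4 : ‖xs p (bs p) - M.truth p.1
          + (σ * (M.rate p.1)⁻¹ ^ 2) • (Pi.single k 1 : Idx dw dphi → ℝ)‖
          ≤ ‖xs p (bs p) - M.truth p.1‖ + (M.rate p.1)⁻¹ ^ 2 := by
        refine (norm_add_le _ _).trans (le_of_eq ?_)
        rw [norm_smul, Pi.norm_single, norm_one, mul_one, Real.norm_eq_abs, abs_mul, hσ, one_mul,
          abs_of_nonneg (by positivity)]
      have h5 := mul_le_mul_of_nonneg_left h4 h2.le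
      rw [Real.norm_of_nonneg (by positivity), Real.norm_of_nonneg (by linarith)]
      simp only [hu] at h3 ⊢
      nlinarith
  have hplus := hexp 1 (by simp)
  have hminus := hexp (-1) (by simp)
  have hrem : (fun p : ℕ × Ω => M.rate p.1 * (M.rate p.1)⁻¹ ^ 2 * L.QPP k k)
      =o[probFilter P A] fun p => 1 + u p := by
    have : (fun p : ℕ × Ω => M.rate p.1 * (M.rate p.1)⁻¹ ^ 2 * L.QPP k k)
      =o[probFilter P A] fun _ => (1 : ℝ) := by
      rw [isLittleO_one_iff]
      simpa using hrs.mul_const (L.QPP k k)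
    exact this.trans_isBigO (isBigO_one_add hun).1
  refine IsBigO.trans_isLittleO (IsBigO.of_bound 1 ?_)
    ((hplus.norm_left.add hminus.norm_left).add hrem.norm_left)
  filter_upwards [hmin, hB, hr.eventually_gt_atTop 0] with p h1 h2 h3
  have hs : 0 < (M.rate p.1)⁻¹ ^ 2 := by positivity
  -- At a point displaced from a minimizer in direction `σ e_k`, the slope of the convex objective
  -- in that direction is nonnegative. The two signs bracket the linearized score at the minimizer
  -- between two remainders.
  have hsub : ∀ σ : ℝ, |σ| = 1 → σ * (M.scoreHat τ p.1 p.2 (bs p)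
      (xs p (bs p) + (σ * (M.rate p.1)⁻¹ ^ 2) • Pi.single k 1) k + h p k) ≤ 0 := by
    intro σ hσ
    have k1 := perturbed_ge hτ hX.meas p.1 p.2 (bs p) (h p)
      (xs p (bs p) + (σ * (M.rate p.1)⁻¹ ^ 2) • Pi.single k 1) (xs p (bs p))
    have k2 := h1 _ h2 (xs p (bs p) + (σ * (M.rate p.1)⁻¹ ^ 2) • Pi.single k 1)
    rw [sub_add_cancel_left, dotProduct_neg, dotProduct_smul, dotProduct_single, mul_one,
      smul_eq_mul, Pi.add_apply] at k1
    by_contra! k3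
    nlinarith [mul_pos hs k3]
  have hp := hsub 1 (by simp)
  have hm := hsub (-1) (by simp)
  have hmv : ∀ σ : ℝ, (L.QPP *ᵥ (xs p (bs p) - M.truth p.1
      + (σ * (M.rate p.1)⁻¹ ^ 2) • Pi.single k 1)) k
      = (L.QPP *ᵥ (xs p (bs p) - M.truth p.1)) k + σ * (M.rate p.1)⁻¹ ^ 2 * L.QPP k k := by
    intro σ
    rw [mulVec_add, mulVec_smul, mulVec_single_one]
    simp
  rw [hmv, hmv]
  set s := (M.rate p.1)⁻¹ ^ 2
  set Dp := M.scoreHat τ p.1 p.2 (bs p) (xs p (bs p) + (1 * s) • Pi.single k 1) k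
  set Dm := M.scoreHat τ p.1 p.2 (bs p) (xs p (bs p) + (-1 * s) • Pi.single k 1) k
  set V := (bs p - M.betaN p.1) * L.QPX k
  set Q := (L.QPP *ᵥ (xs p (bs p) - M.truth p.1)) k
  set Ep := M.rate p.1 * Dp - M.scoreN τ p.1 p.2 k + M.rate p.1 * (V + (Q + 1 * s * L.QPP k k))
    with hEp
  set Em := M.rate p.1 * Dm - M.scoreN τ p.1 p.2 k + M.rate p.1 * (V + (Q + -1 * s * L.QPP k k))
    with hEm
  have hp' := mul_le_mul_of_nonneg_left hp h3.le
  have hm' := mul_le_mul_of_nonneg_left hm h3.le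
  rw [one_mul, Real.norm_eq_abs, Real.norm_eq_abs, abs_of_nonneg (by positivity :
    0 ≤ ‖Ep‖ + ‖Em‖ + ‖M.rate p.1 * s * L.QPP k k‖)]
  simp only [Real.norm_eq_abs]
  have a1 := neg_abs_le Ep
  have a2 := le_abs_self Em
  have a3 := le_abs_self (M.rate p.1 * s * L.QPP k k)
  have a4 := abs_nonneg Ep
  have a5 := abs_nonneg Em
  have a6 := neg_abs_le Em
  rw [abs_le]
  constructor <;> nlinarith

omit [IsProbabilityMeasure P] in
theorem tendsto_zero_of_rate_smul (hX : M.Assumptions P τ L)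
    (hh : (fun p => M.rate p.1 • h p) =O[probFilter P A] fun _ => (1 : ℝ)) :
    Tendsto h (probFilter P A) (𝓝 0) := by
  have hr := tendsto_rate' (A := A) hX
  have h1 : (fun p : ℕ × Ω => (M.rate p.1)⁻¹) =o[probFilter P A] fun _ => (1 : ℝ) :=
    (isLittleO_one_iff ℝ).mpr (tendsto_inv_atTop_zero.comp hr)
  have h2 := h1.smul_isBigO hh
  simp only [smul_eq_mul, mul_one] at h2
  refine ((isLittleO_one_iff ℝ).mp h2).congr' ?_
  filter_upwards [hr.eventually_gt_atTop 0] with p hp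
  rw [inv_smul_smul₀ hp.ne']

/-- The distance of the estimator to the truth is at most of the order of the distance of `b` to
`β_n`. -/
theorem IsMinimizer.isBigO_sub_truth (hmin : M.IsMinimizer τ (probFilter P A) h xs)
    (hτ : τ ∈ Set.Ioo (0 : ℝ) 1) (hL : L.Regular) (hX : M.Assumptions P τ L)
    (hS : (fun p : ℕ × Ω => M.scoreN τ p.1 p.2) =O[probFilter P A] fun _ => (1 : ℝ))
    (hh : (fun p => M.rate p.1 • h p) =O[probFilter P A] fun _ => (1 : ℝ))
    (hbs : Tendsto bs (probFilter P A) (𝓝 M.beta0)) (hB : ∀ᶠ p in probFilter P A, bs p ∈ M.B) :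
    (fun p => M.rate p.1 * ‖xs p (bs p) - M.truth p.1‖)
      =O[probFilter P A] fun p => 1 + M.rate p.1 * |bs p - M.betaN p.1| := by
  obtain ⟨c, hc, hlow⟩ := exists_le_norm_mulVec hL.QPP_posDef
  have hfoc := isLittleO_pi.mpr (hmin.isLittleO_firstOrder_aux hτ hX
    (tendsto_zero_of_rate_smul hX hh) hbs hB)
  obtain ⟨C, hC0, hC⟩ := hS.exists_nonneg
  obtain ⟨D, hD0, hD⟩ := hh.exists_nonneg
  refine IsBigO.of_bound (2 / c * (C + D + c / 2 + ‖L.QPX‖)) ?_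
  -- The remainder contains `‖x‖` itself. Taking its factor to be `c / 2` lets the lower bound `c
  -- ‖x‖` for the image under `Q_{Ψ,Ψ}` absorb it.
  filter_upwards [hC.bound, hD.bound, hfoc.bound (half_pos hc),
    (tendsto_rate' hX).eventually_gt_atTop 0] with p h1 h2 h3 hr
  set x := xs p (bs p) - M.truth p.1
  set vb := bs p - M.betaN p.1
  rw [norm_one, mul_one] at h1 h2
  rw [Real.norm_of_nonneg (by positivity : 0 ≤ 1 + M.rate p.1 * (|vb| + ‖x‖))] at h3
  rw [Real.norm_of_nonneg (by positivity), Real.norm_of_nonneg (by positivity)]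
  set e : Idx dw dphi → ℝ := fun k => M.scoreN τ p.1 p.2 k + M.rate p.1 * h p k
    - M.rate p.1 * (vb * L.QPX k + (L.QPP *ᵥ x) k)
  have he : M.rate p.1 • (L.QPP *ᵥ x) = M.scoreN τ p.1 p.2 + M.rate p.1 • h p
      - (M.rate p.1 * vb) • L.QPX - e := by
    ext k
    simp only [e, Pi.smul_apply, Pi.sub_apply, Pi.add_apply, smul_eq_mul]
    ring
  have h4 : M.rate p.1 * ‖L.QPP *ᵥ x‖ ≤ C + D + M.rate p.1 * |vb| * ‖L.QPX‖
      + c / 2 * (1 + M.rate p.1 * (|vb| + ‖x‖)) := by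
    calc M.rate p.1 * ‖L.QPP *ᵥ x‖ = ‖M.rate p.1 • (L.QPP *ᵥ x)‖ := by
          rw [norm_smul, Real.norm_of_nonneg hr.le]
      _ ≤ ‖M.scoreN τ p.1 p.2‖ + ‖M.rate p.1 • h p‖ + ‖(M.rate p.1 * vb) • L.QPX‖ + ‖e‖ := by
          rw [he]
          exact (norm_sub_le _ _).trans (add_le_add_left ((norm_sub_le _ _).trans
            (add_le_add_left (norm_add_le _ _) _)) _)
      _ ≤ _ := by
          rw [norm_smul _ L.QPX, Real.norm_eq_abs, abs_mul, abs_of_pos hr]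
          gcongr
  have h5 := mul_le_mul_of_nonneg_left (hlow x) hr.le
  have h6 : 0 ≤ M.rate p.1 * |vb| := by positivity
  have h7 := norm_nonneg L.QPX
  have h8 : c / 2 * (M.rate p.1 * ‖x‖) ≤ (C + D + c / 2 + ‖L.QPX‖) * (1 + M.rate p.1 * |vb|) := by
    nlinarith [mul_nonneg h6 hC0, mul_nonneg h6 hD0]
  calc M.rate p.1 * ‖x‖ = 2 / c * (c / 2 * (M.rate p.1 * ‖x‖)) := by field_simp
    _ ≤ 2 / c * ((C + D + c / 2 + ‖L.QPX‖) * (1 + M.rate p.1 * |vb|)) := by gcongr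
    _ = _ := by ring

/-- The second block of the linearized first-order condition. -/
theorem IsMinimizer.isLittleO_firstOrder (hmin : M.IsMinimizer τ (probFilter P A) h xs)
    (hτ : τ ∈ Set.Ioo (0 : ℝ) 1) (hL : L.Regular) (hX : M.Assumptions P τ L)
    (hS : (fun p : ℕ × Ω => M.scoreN τ p.1 p.2) =O[probFilter P A] fun _ => (1 : ℝ))
    (hh : (fun p => M.rate p.1 • h p) =O[probFilter P A] fun _ => (1 : ℝ))
    (hbs : Tendsto bs (probFilter P A) (𝓝 M.beta0)) (hB : ∀ᶠ p in probFilter P A, bs p ∈ M.B) :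
    (fun p => (M.scoreN τ p.1 p.2 + M.rate p.1 • h p) ∘ Sum.inr
        - (M.rate p.1 * (bs p - M.betaN p.1)) • L.QPhiX
        - L.QPhiPhi *ᵥ (M.rate p.1 • (xs p (bs p) ∘ Sum.inr)))
      =o[probFilter P A] fun p => 1 + M.rate p.1 * |bs p - M.betaN p.1| := by
  have h1 := hmin.isBigO_sub_truth hτ hL hX hS hh hbs hB
  have hnn := rate_mul_nonneg (A := A) hX (fun p => |bs p - M.betaN p.1|) fun p => abs_nonneg _
  have h2 : (fun p => 1 + M.rate p.1 * (|bs p - M.betaN p.1| + ‖xs p (bs p) - M.truth p.1‖))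
      =O[probFilter P A] fun p => 1 + M.rate p.1 * |bs p - M.betaN p.1| :=
    ((isBigO_refl _ _).add h1).congr_left fun p => by ring
  refine isLittleO_pi.mpr fun l => ((hmin.isLittleO_firstOrder_aux hτ hX
    (tendsto_zero_of_rate_smul hX hh) hbs hB (Sum.inr l)).trans_isBigO h2).congr_left fun p => ?_
  have e1 : (xs p (bs p) - M.truth p.1) ∘ Sum.inr = xs p (bs p) ∘ Sum.inr := by
    ext i; simp [truth]
  -- Orthogonality removes the deviation of `γ` from the `Φ`-block.
  have e2 := congrFun (hL.QPP_mulVec_comp_inr (xs p (bs p) - M.truth p.1)) l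
  rw [e1, Function.comp_apply] at e2
  have e3 := congrFun L.QPX_comp_inr l
  rw [Function.comp_apply] at e3
  rw [e2, e3, mulVec_smul]
  simp only [Pi.sub_apply, Function.comp_apply, Pi.add_apply, Pi.smul_apply, smul_eq_mul]
  ring

end FirstOrder

open _root_.Asymptotics in
/-- Bound of the estimator of `β_n` by the scores, with a constant that depends only on the
limits. -/
theorem IsSelector.exists_rate_mul_le {J dw dphi : ℕ} {L : Limits J dw dphi} (hL : L.Regular) :
    ∃ C : ℝ, 0 < C ∧ ∀ (dz : ℕ) (Ω : Type*) [MeasurableSpace Ω] (P : Measure Ω)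
      [IsProbabilityMeasure P] (A : ℕ → Set Ω) (M : Model J dw dphi dz Ω) (τ : ℝ)
      (h : ℕ × Ω → Idx dw dphi → ℝ) (xs : ℕ × Ω → ℝ → Idx dw dphi → ℝ) (bs : ℕ × Ω → ℝ),
      τ ∈ Set.Ioo (0 : ℝ) 1 → M.Assumptions P τ L →
      (fun p : ℕ × Ω => M.scoreN τ p.1 p.2) =O[probFilter P A] (fun _ => (1 : ℝ)) →
      (fun p => M.rate p.1 • h p) =O[probFilter P A] (fun _ => (1 : ℝ)) →
      M.IsMinimizer τ (probFilter P A) h xs → M.IsSelector (probFilter P A) xs bs →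
      ∀ᶠ p in probFilter P A, M.rate p.1 * |bs p - M.betaN p.1|
        ≤ C * (‖(M.scoreN τ p.1 p.2 + M.rate p.1 • h p) ∘ Sum.inr‖ + 1) := by
  obtain ⟨κ, hκ, hnorm⟩ := IsSelector.exists_norm_le hL
  obtain ⟨c, hc, hlow⟩ := exists_le_norm_mulVec hL.QPhiPhi_posDef
  have hq : 0 < ‖L.QPhiX‖ := norm_pos_iff.mpr hL.QPhiX_ne_zero
  set D : ℝ := ((Fintype.card (Fin dphi) : ℕ) : ℝ) * opNorm L.QPhiPhi with hD_def
  have hD : 0 ≤ D := mul_nonneg (Nat.cast_nonneg _) (opNorm_nonneg _)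
  have hup : ∀ x : Fin dphi → ℝ, ‖L.QPhiPhi *ᵥ x‖ ≤ D * ‖x‖ := fun x =>
    (norm_mulVec_le _ x).trans_eq (by rw [hD_def]; ring)
  -- The condition at `β_n` bounds the scaled second block there by `(‖U‖ + 1) / c`, the selection
  -- property costs `κ`, and the condition at the selected point is solved for `b` since `Q_{Φ,X} ≠
  -- 0`. The factor 2 absorbs the remainder, taken with constant `‖Q_{Φ,X}‖ / 2`.
  refine ⟨2 / ‖L.QPhiX‖ * (1 + D * κ / c) + 1, by positivity,
    fun dz Ω _ P _ A M τ h xs bs hτ hX hS hh hmin hsel => ?_⟩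
  have hh0 := tendsto_zero_of_rate_smul hX hh
  have hbs := hsel.tendsto hmin hτ hL hX hh0
  have hBN : ∀ᶠ p in probFilter P A, M.betaN p.1 ∈ M.B := eventually_betaN_mem' hX
  have e1 := hmin.isLittleO_firstOrder hτ hL hX hS hh hbs (hsel.mono fun _ hp => hp.1)
  have e0 := hmin.isLittleO_firstOrder hτ hL hX hS hh (tendsto_betaN' hX) hBN
  filter_upwards [hnorm dz Ω P A M τ xs bs hX hsel, e1.bound (half_pos hq), e0.bound one_pos,
    (tendsto_rate' hX).eventually_gt_atTop 0] with p h1 h2 h3 hr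
  set U : Fin dphi → ℝ := (M.scoreN τ p.1 p.2 + M.rate p.1 • h p) ∘ Sum.inr
  set t := M.rate p.1 * |bs p - M.betaN p.1| with ht
  have ht0 : 0 ≤ t := by positivity
  set θ := M.rate p.1 • (xs p (bs p) ∘ Sum.inr)
  set θ₀ := M.rate p.1 • (xs p (M.betaN p.1) ∘ Sum.inr)
  have h4 : ‖θ‖ ≤ κ * ‖θ₀‖ := by
    simp only [θ, θ₀, norm_smul]
    have := mul_le_mul_of_nonneg_left h1 (norm_nonneg (M.rate p.1))
    linarith
  simp only [sub_self, abs_zero, mul_zero, add_zero, norm_one, mul_one, zero_smul, sub_zero] at h3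
  rw [Real.norm_of_nonneg (by positivity : 0 ≤ 1 + t)] at h2
  have h5 : c * ‖θ₀‖ ≤ ‖U‖ + 1 := by
    have := norm_sub_norm_le (L.QPhiPhi *ᵥ θ₀) U
    rw [norm_sub_rev] at this
    linarith [hlow θ₀]
  have h6 : t * ‖L.QPhiX‖ ≤ ‖U‖ + D * ‖θ‖ + ‖L.QPhiX‖ / 2 * (1 + t) := by
    calc t * ‖L.QPhiX‖ = ‖(M.rate p.1 * (bs p - M.betaN p.1)) • L.QPhiX‖ := by
          rw [norm_smul, Real.norm_eq_abs, abs_mul, abs_of_pos hr]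
      _ = ‖U - L.QPhiPhi *ᵥ θ - (U - (M.rate p.1 * (bs p - M.betaN p.1)) • L.QPhiX
            - L.QPhiPhi *ᵥ θ)‖ := by congr 1; abel
      _ ≤ _ := (norm_sub_le _ _).trans (add_le_add ((norm_sub_le _ _).trans
          (add_le_add le_rfl (hup θ))) h2)
  have h7 : D * ‖θ‖ ≤ D * κ / c * (‖U‖ + 1) := by
    calc D * ‖θ‖ ≤ D * (κ * ‖θ₀‖) := by gcongr
      _ = D * κ / c * (c * ‖θ₀‖) := by field_simp
      _ ≤ _ := by gcongr
  have h8 : ‖L.QPhiX‖ / 2 * t ≤ (1 + D * κ / c) * (‖U‖ + 1) + ‖L.QPhiX‖ / 2 := by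
    linarith
  calc t = 2 / ‖L.QPhiX‖ * (‖L.QPhiX‖ / 2 * t) := by field_simp
    _ ≤ 2 / ‖L.QPhiX‖ * ((1 + D * κ / c) * (‖U‖ + 1) + ‖L.QPhiX‖ / 2) := by gcongr
    _ = 2 / ‖L.QPhiX‖ * (1 + D * κ / c) * (‖U‖ + 1) + 1 := by field_simp
    _ ≤ _ := by linarith [norm_nonneg U]

/-! ### Cluster scores at the estimators -/

section Clusters

open _root_.Asymptotics

variable {J dw dphi dz : ℕ} {Ω : Type*} {M : Model J dw dphi dz Ω}

/-- The scaled cluster average of the score at the true parameters. -/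
noncomputable def clusterScoreN (M : Model J dw dphi dz Ω) (τ : ℝ) (n : ℕ) (j : Fin J) (ω : Ω) :
    Idx dw dphi → ℝ :=
  M.rate n • M.emp τ n j ω (M.betaN n) (M.gammaTrue n) 0

theorem scoreN_eq (τ : ℝ) (n : ℕ) (ω : Ω) :
    M.scoreN τ n ω
      = ∑ j, ((M.size n j : ℝ) / (M.total n : ℝ)) • M.clusterScoreN τ n j ω := by
  ext k
  simp only [scoreN, clusterScoreN, Finset.sum_apply, Pi.smul_apply, smul_eq_mul, Finset.mul_sum]
  exact Finset.sum_congr rfl fun j _ => by ring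

/-- The pair of estimators `(γ̂(b), θ̂(b))`. -/
noncomputable def estimator (M : Model J dw dphi dz Ω) (p : ℕ × Ω) (b : ℝ) : Idx dw dphi → ℝ :=
  Sum.elim (M.gammaHat p.1 p.2 b) (M.thetaHat p.1 p.2 b)

/-- The pair of bootstrap estimators `(γ̂*_g(b), θ̂*_g(b))`. -/
noncomputable def estimatorStar (M : Model J dw dphi dz Ω) (g : Signs J) (p : ℕ × Ω) (b : ℝ) :
    Idx dw dphi → ℝ :=
  Sum.elim (M.gammaStar p.1 g p.2 b) (M.thetaStar p.1 g p.2 b)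

/-- The linear perturbation in the bootstrap objective. -/
noncomputable def perturbation (M : Model J dw dphi dz Ω) (τ : ℝ) (g : Signs J) (p : ℕ × Ω) :
    Idx dw dphi → ℝ :=
  ∑ j, (sgn g j * ((M.size p.1 j : ℝ) / (M.total p.1 : ℝ)))
    • M.empHat τ p.1 j p.2 M.beta0 (M.gammaR p.1 p.2) 0

theorem size_mul_empHat (τ : ℝ) (n : ℕ) (j : Fin J) (ω : Ω) (b : ℝ) (r : Vec dw) (t : Vec dphi)
    (k : Idx dw dphi) :
    (M.size n j : ℝ) * M.empHat τ n j ω b r t k = ∑ i, M.fHat τ n j i ω ω b r t k := by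
  rw [empHat]
  rcases Nat.eq_zero_or_pos (M.size n j) with h | h
  · have : IsEmpty (Fin (M.size n j)) := by rw [h]; infer_instance
    simp
  · have : (M.size n j : ℝ) ≠ 0 := by positivity
    field_simp

/-- The bootstrap problem is the original one with a linear tilt, so both are instances of
`IsMinimizer`. -/
theorem objectiveStar_eq (τ : ℝ) (g : Signs J) (p : ℕ × Ω) (b : ℝ) (z : Idx dw dphi → ℝ) :
    (M.total p.1 : ℝ)⁻¹ * M.objectiveStar τ p.1 g p.2 b (z ∘ Sum.inl) (z ∘ Sum.inr)
      = M.QHat τ p.1 p.2 b (z ∘ Sum.inl) (z ∘ Sum.inr) - M.perturbation τ g p ⬝ᵥ z := by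
  have h1 : ∀ j, ∑ i, M.fHat τ p.1 j i p.2 p.2 M.beta0 (M.gammaR p.1 p.2) 0 ⬝ᵥ z
      = (M.size p.1 j : ℝ) * (M.empHat τ p.1 j p.2 M.beta0 (M.gammaR p.1 p.2) 0 ⬝ᵥ z) := by
    intro j
    simp only [dotProduct, Finset.mul_sum, ← mul_assoc, size_mul_empHat]
    rw [Finset.sum_comm]
    exact Finset.sum_congr rfl fun k _ => by rw [Finset.sum_mul]
  rw [objectiveStar, QHat, mul_sub, perturbation, sum_dotProduct, Finset.mul_sum]
  congr 1
  refine Finset.sum_congr rfl fun j _ => ?_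
  rw [Sum.elim_comp_inl_inr, h1, smul_dotProduct, smul_eq_mul]
  ring

variable [MeasurableSpace Ω] {P : Measure Ω} {τ : ℝ}
  {L : Limits J dw dphi} {A : ℕ → Set Ω} {h : ℕ × Ω → Idx dw dphi → ℝ}
  {xs : ℕ × Ω → ℝ → Idx dw dphi → ℝ} {bs : ℕ × Ω → ℝ}

theorem isMinimizer_estimator (hX : M.Assumptions P τ L) :
    M.IsMinimizer τ (probFilter P A) 0 M.estimator := by
  filter_upwards [hX.estimator.quantreg.eventually (A := A)] with p hp b hb z
  simp only [Pi.zero_apply, zero_dotProduct, sub_zero, QHat]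
  exact mul_le_mul_of_nonneg_left (hp b hb _ _) (by positivity)

theorem isSelector_estimator (hX : M.Assumptions P τ L) :
    M.IsSelector (probFilter P A) M.estimator fun p => M.betaHat p.1 p.2 :=
  hX.estimator.beta.eventually

theorem isMinimizer_estimatorStar (hX : M.Assumptions P τ L) (g : Signs J) :
    M.IsMinimizer τ (probFilter P A) (M.perturbation τ g) (M.estimatorStar g) := by
  filter_upwards [(hX.estimator.quantregStar g).eventually (A := A)] with p hp b hb z
  rw [← objectiveStar_eq, ← objectiveStar_eq]
  exact mul_le_mul_of_nonneg_left (hp b hb _ _) (by positivity)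

theorem isSelector_estimatorStar (hX : M.Assumptions P τ L) (g : Signs J) :
    M.IsSelector (probFilter P A) (M.estimatorStar g) fun p => M.betaStar p.1 g p.2 :=
  (hX.estimator.betaStar g).eventually

/-- Orthogonality is assumed for one off-diagonal block; the other follows because the finite-stage
Jacobians are symmetric and converge. -/
theorem QPsiPsi_inr_inl (hL : L.Regular) (hX : M.Assumptions P τ L) (j : Fin J) (k : Fin dw)
    (l : Fin dphi) : L.QPsiPsi j (Sum.inr l) (Sum.inl k) = 0 := by
  have h1 : ∀ a b, Tendsto (fun n => M.jacPsi P n j a b) atTop (𝓝 (L.QPsiPsi j a b)) := fun a b =>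
    tendsto_pi_nhds.mp (tendsto_pi_nhds.mp (hX.asymptotics.jacPsi j) a) b
  have h2 : ∀ n, M.jacPsi P n j (Sum.inr l) (Sum.inl k) = M.jacPsi P n j (Sum.inl k) (Sum.inr l) :=
    fun n => by
      simp only [jacPsi, Matrix.of_apply]
      congr 1
      exact Finset.sum_congr rfl fun i _ => integral_congr_ae
        (Eventually.of_forall fun ω => by ring_nf)
  have h3 := tendsto_nhds_unique (h1 (Sum.inr l) (Sum.inl k))
    ((h1 (Sum.inl k) (Sum.inr l)).congr fun n => (h2 n).symm)
  rw [h3]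
  exact congrFun (congrFun (hL.orthogonality j) k) l

theorem isBigO_scoreN (hX : M.Assumptions P τ L)
    (hS : ∀ j, (fun p : ℕ × Ω => M.clusterScoreN τ p.1 j p.2) =O[probFilter P A] fun _ => (1 : ℝ)) :
    (fun p : ℕ × Ω => M.scoreN τ p.1 p.2) =O[probFilter P A] fun _ => (1 : ℝ) := by
  simp only [scoreN_eq]
  refine IsBigO.fun_sum fun j _ => ?_
  simpa using ((tendsto_share' hX j).isBigO_one ℝ).smul (hS j)

theorem tendsto_of_rate_mul (hX : M.Assumptions P τ L)
    (hbs : (fun p => M.rate p.1 * (bs p - M.betaN p.1)) =O[probFilter P A] fun _ => (1 : ℝ)) :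
    Tendsto bs (probFilter P A) (𝓝 M.beta0) := by
  have hr := tendsto_rate' (A := A) hX
  have h1 : (fun p : ℕ × Ω => (M.rate p.1)⁻¹) =o[probFilter P A] fun _ => (1 : ℝ) :=
    (isLittleO_one_iff ℝ).mpr (tendsto_inv_atTop_zero.comp hr)
  have h2 := (isLittleO_one_iff ℝ).mp (by simpa using h1.mul_isBigO hbs)
  have h3 := h2.add (tendsto_betaN' (A := A) hX)
  rw [zero_add] at h3
  refine h3.congr' ?_
  filter_upwards [hr.eventually_gt_atTop 0] with p hp
  field_simp
  ring

variable [IsProbabilityMeasure P]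

/-- The scores that enter the variance estimators are taken at `t = 0`, so the expansion is applied
with the deviation of `γ` alone and a zero second block. The rate bounds make its remainder `o(1)`.
-/
theorem IsMinimizer.tendsto_empHat_aux (hmin : M.IsMinimizer τ (probFilter P A) h xs)
    (hτ : τ ∈ Set.Ioo (0 : ℝ) 1) (hL : L.Regular) (hX : M.Assumptions P τ L)
    (hS : ∀ j, (fun p : ℕ × Ω => M.clusterScoreN τ p.1 j p.2) =O[probFilter P A] fun _ => (1 : ℝ))
    (hh : (fun p => M.rate p.1 • h p) =O[probFilter P A] fun _ => (1 : ℝ))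
    (hbs : (fun p => M.rate p.1 * (bs p - M.betaN p.1)) =O[probFilter P A] fun _ => (1 : ℝ))
    (hB : ∀ᶠ p in probFilter P A, bs p ∈ M.B) (j : Fin J) (k : Idx dw dphi) :
    (fun p => M.rate p.1 * ‖xs p (bs p) ∘ Sum.inl - M.gammaTrue p.1‖)
      =O[probFilter P A] (fun _ => (1 : ℝ)) ∧
    Tendsto (fun p => M.rate p.1 * M.empHat τ p.1 j p.2 (bs p) (xs p (bs p) ∘ Sum.inl) 0 k
      - M.clusterScoreN τ p.1 j p.2 k + M.rate p.1 * ((bs p - M.betaN p.1) * L.QPsiX j k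
      + (L.QPsiPsi j *ᵥ Sum.elim (xs p (bs p) ∘ Sum.inl - M.gammaTrue p.1) 0) k))
      (probFilter P A) (𝓝 0) := by
  have hr := tendsto_rate' (A := A) hX
  have hb0 := tendsto_of_rate_mul hX hbs
  have hvb : Tendsto (fun p : ℕ × Ω => bs p - M.betaN p.1) (probFilter P A) (𝓝 0) := by
    simpa using hb0.sub (tendsto_betaN' hX)
  have hvx := hmin.tendsto_sub_truth hτ hX (tendsto_zero_of_rate_smul hX hh) hb0 hB
  have hle : ∀ p : ℕ × Ω, ‖xs p (bs p) ∘ Sum.inl - M.gammaTrue p.1‖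
      ≤ ‖xs p (bs p) - M.truth p.1‖ := fun p => by
    have : xs p (bs p) ∘ Sum.inl - M.gammaTrue p.1 = (xs p (bs p) - M.truth p.1) ∘ Sum.inl := by
      ext i; simp [truth]
    rw [this]
    exact norm_comp_le _ _
  have hz : ∀ p : ℕ × Ω, ‖(Sum.elim (xs p (bs p) ∘ Sum.inl - M.gammaTrue p.1) 0 :
      Idx dw dphi → ℝ)‖ ≤ ‖xs p (bs p) ∘ Sum.inl - M.gammaTrue p.1‖ := fun p => by
    refine (pi_norm_le_iff_of_nonneg (norm_nonneg _)).mpr fun k => ?_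
    cases k with
    | inl k => exact norm_le_pi_norm (xs p (bs p) ∘ Sum.inl - M.gammaTrue p.1) k
    | inr k => simp
  have hz0 : Tendsto (fun p : ℕ × Ω => (Sum.elim (xs p (bs p) ∘ Sum.inl - M.gammaTrue p.1) 0 :
      Idx dw dphi → ℝ)) (probFilter P A) (𝓝 0) :=
    squeeze_zero_norm (fun p => (hz p).trans (hle p)) (by simpa using hvx.norm)
  have hbs' : (fun p => M.rate p.1 * |bs p - M.betaN p.1|) =O[probFilter P A]
      fun _ => (1 : ℝ) := by
    refine (IsBigO.of_bound 1 (Eventually.of_forall fun p => ?_)).trans hbs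
    rw [one_mul, norm_mul, norm_mul, Real.norm_eq_abs |bs p - M.betaN p.1|, abs_abs,
      Real.norm_eq_abs (bs p - M.betaN p.1)]
  have hrx : (fun p => M.rate p.1 * ‖xs p (bs p) ∘ Sum.inl - M.gammaTrue p.1‖)
      =O[probFilter P A] fun _ => (1 : ℝ) := by
    have h1 := (hmin.isBigO_sub_truth hτ hL hX (isBigO_scoreN hX hS) hh hb0 hB).trans
      ((isBigO_refl (fun _ : ℕ × Ω => (1 : ℝ)) _).add hbs')
    refine (IsBigO.of_bound 1 ?_).trans h1
    filter_upwards [hr.eventually_gt_atTop 0] with p hp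
    rw [one_mul, Real.norm_of_nonneg (by positivity), Real.norm_of_nonneg (by positivity)]
    exact mul_le_mul_of_nonneg_left (hle p) hp.le
  refine ⟨hrx, ?_⟩
  have hexp := isLittleO_empHat hτ hX.meas hX.basic hX.finite hX.asymptotics hvb hz0 j k
  have hbig : (fun p => 1 + M.rate p.1 * (|bs p - M.betaN p.1|
      + ‖(Sum.elim (xs p (bs p) ∘ Sum.inl - M.gammaTrue p.1) 0 : Idx dw dphi → ℝ)‖))
      =O[probFilter P A] fun _ => (1 : ℝ) := by
    refine IsBigO.trans (IsBigO.of_bound 1 ?_)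
      (((isBigO_refl (fun _ : ℕ × Ω => (1 : ℝ)) _).add hbs').add hrx)
    filter_upwards [hr.eventually_gt_atTop 0] with p hp
    rw [one_mul, Real.norm_of_nonneg (by positivity), Real.norm_of_nonneg (by positivity)]
    have := mul_le_mul_of_nonneg_left (hz p) hp.le
    linarith
  refine ((isLittleO_one_iff ℝ).mp (hexp.trans_isBigO hbig)).congr fun p => ?_
  rw [add_sub_cancel, Sum.elim_comp_inl, Sum.elim_comp_inr, add_sub_cancel]
  rfl

theorem IsMinimizer.isBigO_empHat (hmin : M.IsMinimizer τ (probFilter P A) h xs)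
    (hτ : τ ∈ Set.Ioo (0 : ℝ) 1) (hL : L.Regular) (hX : M.Assumptions P τ L)
    (hS : ∀ j, (fun p : ℕ × Ω => M.clusterScoreN τ p.1 j p.2) =O[probFilter P A] fun _ => (1 : ℝ))
    (hh : (fun p => M.rate p.1 • h p) =O[probFilter P A] fun _ => (1 : ℝ))
    (hbs : (fun p => M.rate p.1 * (bs p - M.betaN p.1)) =O[probFilter P A] fun _ => (1 : ℝ))
    (hB : ∀ᶠ p in probFilter P A, bs p ∈ M.B) (j : Fin J) :
    (fun p => M.rate p.1 • M.empHat τ p.1 j p.2 (bs p) (xs p (bs p) ∘ Sum.inl) 0)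
      =O[probFilter P A] fun _ => (1 : ℝ) := by
  refine isBigO_pi.mpr fun k => ?_
  obtain ⟨h1, h2⟩ := hmin.tendsto_empHat_aux hτ hL hX hS hh hbs hB j k
  have h3 : (fun p => M.rate p.1 * (L.QPsiPsi j *ᵥ
      (Sum.elim (xs p (bs p) ∘ Sum.inl - M.gammaTrue p.1) 0 : Idx dw dphi → ℝ)) k)
      =O[probFilter P A] fun _ => (1 : ℝ) := by
    refine (IsBigO.of_bound (Fintype.card (Idx dw dphi) * opNorm (L.QPsiPsi j)) ?_).trans h1
    filter_upwards [(tendsto_rate' hX).eventually_gt_atTop 0] with p hp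
    rw [norm_mul, norm_mul, norm_norm, ← mul_assoc, mul_comm _ ‖M.rate p.1‖, mul_assoc]
    refine mul_le_mul_of_nonneg_left ?_ (norm_nonneg _)
    refine (norm_le_pi_norm _ k).trans ((norm_mulVec_le _ _).trans ?_)
    rw [mul_assoc]
    refine mul_le_mul_of_nonneg_left (mul_le_mul_of_nonneg_left ?_ (opNorm_nonneg _))
      (Nat.cast_nonneg _)
    refine (pi_norm_le_iff_of_nonneg (norm_nonneg _)).mpr fun k => ?_
    cases k with
    | inl k => exact norm_le_pi_norm (xs p (bs p) ∘ Sum.inl - M.gammaTrue p.1) k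
    | inr k => simp
  refine (((h2.isBigO_one ℝ).add (isBigO_pi.mp (hS j) k)).sub
    ((hbs.mul (isBigO_refl (fun _ => L.QPsiX j k) _)).trans
      (isBigO_const_const _ one_ne_zero _) |>.add h3)).congr_left fun p => ?_
  simp only [Pi.smul_apply, smul_eq_mul]
  ring

/-- Expansion of the second block of the cluster scores. -/
theorem IsMinimizer.tendsto_empHat (hmin : M.IsMinimizer τ (probFilter P A) h xs)
    (hτ : τ ∈ Set.Ioo (0 : ℝ) 1) (hL : L.Regular) (hX : M.Assumptions P τ L)
    (hS : ∀ j, (fun p : ℕ × Ω => M.clusterScoreN τ p.1 j p.2) =O[probFilter P A] fun _ => (1 : ℝ))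
    (hh : (fun p => M.rate p.1 • h p) =O[probFilter P A] fun _ => (1 : ℝ))
    (hbs : (fun p => M.rate p.1 * (bs p - M.betaN p.1)) =O[probFilter P A] fun _ => (1 : ℝ))
    (hB : ∀ᶠ p in probFilter P A, bs p ∈ M.B) (j : Fin J) :
    Tendsto (fun p => (M.rate p.1 • M.empHat τ p.1 j p.2 (bs p) (xs p (bs p) ∘ Sum.inl) 0)
        ∘ Sum.inr - M.clusterScoreN τ p.1 j p.2 ∘ Sum.inr
        + (M.rate p.1 * (bs p - M.betaN p.1)) • L.QPhiXj j) (probFilter P A) (𝓝 0) := by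
  refine tendsto_pi_nhds.mpr fun l => ?_
  refine (hmin.tendsto_empHat_aux hτ hL hX hS hh hbs hB j (Sum.inr l)).2.congr fun p => ?_
  -- Cluster-wise orthogonality: the error in `γ` has no first-order effect on the `Φ`-scores of any
  -- single cluster.
  have h0 : (L.QPsiPsi j *ᵥ (Sum.elim (xs p (bs p) ∘ Sum.inl - M.gammaTrue p.1) 0 :
      Idx dw dphi → ℝ)) (Sum.inr l) = 0 := by
    simp [mulVec, dotProduct, Fintype.sum_sum_type, QPsiPsi_inr_inl hL hX]
  rw [h0]
  simp only [Pi.add_apply, Pi.sub_apply, Function.comp_apply, Pi.smul_apply, smul_eq_mul,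
    Limits.QPhiXj]
  ring

end Clusters

/-! ### Expansions for the sample and bootstrap estimators -/

section Scores

open _root_.Asymptotics

variable {J dw dphi dz : ℕ} {Ω : Type*} {M : Model J dw dphi dz Ω} [MeasurableSpace Ω]
  {P : Measure Ω} {τ : ℝ} {L : Limits J dw dphi} {A : ℕ → Set Ω}

theorem rate_mul_beta0_sub (hX : M.Assumptions P τ L) :
    ∀ᶠ p in probFilter P A, M.rate p.1 * (M.beta0 - M.betaN p.1) = -M.muBeta := by
  filter_upwards [(tendsto_rate' hX).eventually_gt_atTop 0] with p hp
  rw [betaN]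
  field_simp
  ring

theorem isBigO_rate_mul_beta0_sub (hX : M.Assumptions P τ L) :
    (fun p : ℕ × Ω => M.rate p.1 * (M.beta0 - M.betaN p.1)) =O[probFilter P A]
      fun _ => (1 : ℝ) :=
  (isBigO_const_const (-M.muBeta) one_ne_zero _).congr'
    ((rate_mul_beta0_sub hX).mono fun _ hp => hp.symm) EventuallyEq.rfl

theorem isBigO_rate_smul_zero :
    (fun p : ℕ × Ω => M.rate p.1 • (0 : ℕ × Ω → Idx dw dphi → ℝ) p) =O[probFilter P A]
      fun _ => (1 : ℝ) :=
  (isBigO_const_const (0 : Idx dw dphi → ℝ) (one_ne_zero (α := ℝ)) _).congr_left fun p => by simp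

omit [MeasurableSpace Ω] in
theorem isBigO_one_smul {E : Type*} [NormedAddCommGroup E] [NormedSpace ℝ E] {ℓ : Filter (ℕ × Ω)}
    {f : ℕ × Ω → ℝ} {v : ℕ × Ω → E} (hf : f =O[ℓ] fun _ => (1 : ℝ))
    (hv : v =O[ℓ] fun _ => (1 : ℝ)) : (fun p => f p • v p) =O[ℓ] fun _ => (1 : ℝ) := by
  simpa only [smul_eq_mul, mul_one] using hf.smul hv

variable [IsProbabilityMeasure P]

omit [IsProbabilityMeasure P] in
theorem isBigO_rate_mul_of_bound {C : ℝ} {U : ℕ × Ω → Idx dw dphi → ℝ} {bs : ℕ × Ω → ℝ}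
    (hX : M.Assumptions P τ L)
    (hU : U =O[probFilter P A] fun _ => (1 : ℝ)) (hC : 0 < C)
    (h : ∀ᶠ p in probFilter P A, M.rate p.1 * |bs p - M.betaN p.1|
        ≤ C * (‖U p ∘ Sum.inr‖ + 1)) :
    (fun p : ℕ × Ω => M.rate p.1 * (bs p - M.betaN p.1)) =O[probFilter P A]
      fun _ => (1 : ℝ) := by
  refine IsBigO.trans (IsBigO.of_bound C ?_) (hU.norm_left.add (isBigO_refl (fun _ => (1 : ℝ)) _))
  filter_upwards [h, (tendsto_rate' hX).eventually_gt_atTop 0] with p h1 h2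
  rw [norm_mul, Real.norm_of_nonneg h2.le, Real.norm_eq_abs,
    Real.norm_of_nonneg (by positivity : 0 ≤ ‖U p‖ + 1)]
  refine h1.trans ?_
  gcongr
  exact norm_comp_le _ _

variable (hτ : τ ∈ Set.Ioo (0 : ℝ) 1) (hL : L.Regular) (hX : M.Assumptions P τ L)
  (hS : ∀ j, (fun p : ℕ × Ω => M.clusterScoreN τ p.1 j p.2) =O[probFilter P A] fun _ => (1 : ℝ))
include hτ hL hX hS

theorem isBigO_betaHat :
    (fun p : ℕ × Ω => M.rate p.1 * (M.betaHat p.1 p.2 - M.betaN p.1)) =O[probFilter P A]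
      fun _ => (1 : ℝ) := by
  obtain ⟨C, hC, h⟩ := IsSelector.exists_rate_mul_le hL
  have h1 := h dz Ω P A M τ 0 M.estimator (fun p => M.betaHat p.1 p.2) hτ hX (isBigO_scoreN hX hS)
    isBigO_rate_smul_zero (isMinimizer_estimator hX) (isSelector_estimator hX)
  exact isBigO_rate_mul_of_bound hX ((isBigO_scoreN hX hS).add isBigO_rate_smul_zero) hC h1

theorem tendsto_empHat_betaHat (j : Fin J) :
    Tendsto (fun p : ℕ × Ω => (M.rate p.1 • M.empHat τ p.1 j p.2 (M.betaHat p.1 p.2)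
        (M.gammaFin p.1 p.2) 0) ∘ Sum.inr - M.clusterScoreN τ p.1 j p.2 ∘ Sum.inr
        + (M.rate p.1 * (M.betaHat p.1 p.2 - M.betaN p.1)) • L.QPhiXj j)
      (probFilter P A) (𝓝 0) :=
  (isMinimizer_estimator hX).tendsto_empHat (bs := fun p => M.betaHat p.1 p.2) hτ hL hX hS
    isBigO_rate_smul_zero (isBigO_betaHat hτ hL hX hS)
    ((isSelector_estimator hX).mono fun _ hp => hp.1) j

theorem tendsto_empHat_beta0 (j : Fin J) :
    Tendsto (fun p : ℕ × Ω => (M.rate p.1 • M.empHat τ p.1 j p.2 M.beta0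
        (M.gammaR p.1 p.2) 0) ∘ Sum.inr - M.clusterScoreN τ p.1 j p.2 ∘ Sum.inr
        + (M.rate p.1 * (M.beta0 - M.betaN p.1)) • L.QPhiXj j)
      (probFilter P A) (𝓝 0) :=
  (isMinimizer_estimator hX).tendsto_empHat (bs := fun _ => M.beta0) hτ hL hX hS
    isBigO_rate_smul_zero (isBigO_rate_mul_beta0_sub hX)
    (Eventually.of_forall fun _ => beta0_mem hX.asymptotics hX.basic) j

/-- The restricted cluster scores are of order `1 / r_n` because `r_n (β_0 - β_n)` is the constant
`-μ_β`. This is the size of the tilt that the rate bounds require. -/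
theorem isBigO_perturbation (g : Signs J) :
    (fun p : ℕ × Ω => M.rate p.1 • M.perturbation τ g p) =O[probFilter P A]
      fun _ => (1 : ℝ) := by
  have h1 : ∀ j, (fun p : ℕ × Ω => (sgn g j * ((M.size p.1 j : ℝ) / (M.total p.1 : ℝ))) •
      (M.rate p.1 • M.empHat τ p.1 j p.2 M.beta0 (M.gammaR p.1 p.2) 0)) =O[probFilter P A]
      fun _ => (1 : ℝ) := fun j =>
    isBigO_one_smul (((tendsto_share' hX j).const_mul (sgn g j)).isBigO_one ℝ)
      ((isMinimizer_estimator hX).isBigO_empHat (bs := fun _ => M.beta0) hτ hL hX hS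
        isBigO_rate_smul_zero (isBigO_rate_mul_beta0_sub hX)
        (Eventually.of_forall fun _ => beta0_mem hX.asymptotics hX.basic) j)
  refine (IsBigO.fun_sum fun j (_ : j ∈ Finset.univ) => h1 j).congr_left fun p => ?_
  rw [perturbation, Finset.smul_sum]
  exact Finset.sum_congr rfl fun j _ => smul_comm _ _ _

theorem isBigO_betaStar (g : Signs J) :
    (fun p : ℕ × Ω => M.rate p.1 * (M.betaStar p.1 g p.2 - M.betaN p.1)) =O[probFilter P A]
      fun _ => (1 : ℝ) := by
  obtain ⟨C, hC, h⟩ := IsSelector.exists_rate_mul_le hL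
  have h1 := h dz Ω P A M τ _ (M.estimatorStar g) (fun p => M.betaStar p.1 g p.2) hτ hX
    (isBigO_scoreN hX hS) (isBigO_perturbation hτ hL hX hS g) (isMinimizer_estimatorStar hX g)
    (isSelector_estimatorStar hX g)
  exact isBigO_rate_mul_of_bound hX
    ((isBigO_scoreN hX hS).add (isBigO_perturbation hτ hL hX hS g)) hC h1

theorem tendsto_empHat_betaStar (g : Signs J) (j : Fin J) :
    Tendsto (fun p : ℕ × Ω => (M.rate p.1 • M.empHat τ p.1 j p.2 (M.betaStar p.1 g p.2)
        (M.gammaStarFin p.1 g p.2) 0) ∘ Sum.inr - M.clusterScoreN τ p.1 j p.2 ∘ Sum.inr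
        + (M.rate p.1 * (M.betaStar p.1 g p.2 - M.betaN p.1)) • L.QPhiXj j)
      (probFilter P A) (𝓝 0) :=
  (isMinimizer_estimatorStar hX g).tendsto_empHat (bs := fun p => M.betaStar p.1 g p.2) hτ hL hX hS
    (isBigO_perturbation hτ hL hX hS g) (isBigO_betaStar hτ hL hX hS g)
    ((isSelector_estimatorStar hX g).mono fun _ hp => hp.1) j

omit hτ hL hS [IsProbabilityMeasure P] in
theorem tendsto_GHat_dotProduct {V W : ℕ × Ω → Vec dphi}
    (hVW : Tendsto (fun p => V p - W p) (probFilter P A) (𝓝 0))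
    (hW : W =O[probFilter P A] fun _ => (1 : ℝ)) :
    Tendsto (fun p => M.GHat p.1 p.2 ⬝ᵥ V p - L.G ⬝ᵥ W p) (probFilter P A) (𝓝 0) := by
  have hG : Tendsto (fun p : ℕ × Ω => M.GHat p.1 p.2 - L.G) (probFilter P A) (𝓝 0) :=
    squeeze_zero_norm (fun p => norm_le_norm2 _) hX.weight.tendsto
  have hV : V =O[probFilter P A] fun _ => (1 : ℝ) :=
    ((hVW.isBigO_one ℝ).add hW).congr_left fun p => by simp
  have hdot : ∀ {x y : ℕ × Ω → Vec dphi}, x =o[probFilter P A] (fun _ => (1 : ℝ)) →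
      y =O[probFilter P A] (fun _ => (1 : ℝ)) →
      Tendsto (fun p => x p ⬝ᵥ y p) (probFilter P A) (𝓝 0) := by
    intro x y hx hy
    rw [← isLittleO_one_iff ℝ]
    have := (hx.norm_left.mul_isBigO hy.norm_left)
    simp only [mul_one] at this
    refine (IsBigO.of_bound (Fintype.card (Fin dphi)) (Eventually.of_forall fun p => ?_)).trans_isLittleO
      this
    rw [Real.norm_of_nonneg (by positivity : 0 ≤ ‖x p‖ * ‖y p‖)]
    exact abs_dotProduct_le _ _
  have h1 := (hdot ((isLittleO_one_iff ℝ).mpr hG) hV).add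
    (hdot ((isLittleO_one_iff ℝ).mpr hVW) (isBigO_const_const L.G one_ne_zero _))
  rw [add_zero] at h1
  refine h1.congr fun p => ?_
  rw [sub_dotProduct, sub_dotProduct, dotProduct_comm (V p) L.G, dotProduct_comm (W p) L.G]
  ring

omit hτ hL hX [IsProbabilityMeasure P] in
theorem isBigO_clusterScoreN_comp_inr (j : Fin J) :
    (fun p : ℕ × Ω => M.clusterScoreN τ p.1 j p.2 ∘ Sum.inr) =O[probFilter P A]
      fun _ => (1 : ℝ) :=
  (IsBigO.of_bound 1 (Eventually.of_forall fun p => by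
    rw [one_mul]; exact norm_comp_le _ _)).trans (hS j)

/-- Expansion of the studentizing cluster scores. -/
theorem tendsto_GHat_dotProduct_empHat (j : Fin J) :
    Tendsto (fun p : ℕ × Ω => M.GHat p.1 p.2 ⬝ᵥ ((M.rate p.1 • M.empHat τ p.1 j p.2
        (M.betaHat p.1 p.2) (M.gammaFin p.1 p.2) 0) ∘ Sum.inr)
      - (L.G ⬝ᵥ (M.clusterScoreN τ p.1 j p.2 ∘ Sum.inr)
        - L.b j * (M.rate p.1 * (M.betaHat p.1 p.2 - M.betaN p.1)))) (probFilter P A) (𝓝 0) := by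
  have h1 := tendsto_GHat_dotProduct hX (V := fun p => (M.rate p.1 • M.empHat τ p.1 j p.2
        (M.betaHat p.1 p.2) (M.gammaFin p.1 p.2) 0) ∘ Sum.inr)
    (W := fun p => M.clusterScoreN τ p.1 j p.2 ∘ Sum.inr - (M.rate p.1 * (M.betaHat p.1 p.2 - M.betaN p.1)) • L.QPhiXj j)
    ((tendsto_empHat_betaHat hτ hL hX hS j).congr fun p => by abel)
    ((isBigO_clusterScoreN_comp_inr hS j).sub
      (isBigO_one_smul (isBigO_betaHat hτ hL hX hS)
        (isBigO_const_const (L.QPhiXj j) one_ne_zero _)))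
  refine h1.congr fun p => ?_
  rw [dotProduct_sub, dotProduct_smul, smul_eq_mul, Limits.b]
  ring

/-- Expansion of the studentizing bootstrap cluster scores. -/
theorem tendsto_GHat_dotProduct_star (g : Signs J) (j : Fin J) :
    Tendsto (fun p : ℕ × Ω => M.GHat p.1 p.2 ⬝ᵥ
        (sgn g j • (M.rate p.1 • M.empHat τ p.1 j p.2 M.beta0 (M.gammaR p.1 p.2) 0) ∘ Sum.inr
        + (M.rate p.1 • M.empHat τ p.1 j p.2 (M.betaStar p.1 g p.2)
            (M.gammaStarFin p.1 g p.2) 0) ∘ Sum.inr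
        - (M.rate p.1 • M.empHat τ p.1 j p.2 (M.betaHat p.1 p.2) (M.gammaFin p.1 p.2) 0)
            ∘ Sum.inr)
      - (sgn g j * (L.G ⬝ᵥ (M.clusterScoreN τ p.1 j p.2 ∘ Sum.inr) + M.muBeta * L.b j)
        - L.b j * (M.rate p.1 * (M.betaStar p.1 g p.2 - M.betaHat p.1 p.2))))
      (probFilter P A) (𝓝 0) := by
  have hb : (fun p : ℕ × Ω => M.rate p.1 * (M.betaStar p.1 g p.2 - M.betaHat p.1 p.2))
      =O[probFilter P A] fun _ => (1 : ℝ) :=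
    ((isBigO_betaStar hτ hL hX hS g).sub (isBigO_betaHat hτ hL hX hS)).congr_left
      fun p => by ring
  -- The cluster scores at the truth cancel between the terms at `β̂*_g` and `β̂`. What remains is
  -- the signed restricted score, shifted by `μ_β`, and the difference of the two estimators.
  have h0 := (((tendsto_empHat_beta0 hτ hL hX hS j).const_smul (sgn g j)).add
    (tendsto_empHat_betaStar hτ hL hX hS g j)).sub (tendsto_empHat_betaHat hτ hL hX hS j)
  rw [smul_zero, add_zero, sub_zero] at h0
  have h1 := tendsto_GHat_dotProduct hX (V := fun p =>
      sgn g j • (M.rate p.1 • M.empHat τ p.1 j p.2 M.beta0 (M.gammaR p.1 p.2) 0) ∘ Sum.inr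
        + (M.rate p.1 • M.empHat τ p.1 j p.2 (M.betaStar p.1 g p.2)
            (M.gammaStarFin p.1 g p.2) 0) ∘ Sum.inr
        - (M.rate p.1 • M.empHat τ p.1 j p.2 (M.betaHat p.1 p.2) (M.gammaFin p.1 p.2) 0)
            ∘ Sum.inr)
    (W := fun p =>
      sgn g j • (M.clusterScoreN τ p.1 j p.2 ∘ Sum.inr + M.muBeta • L.QPhiXj j)
      - (M.rate p.1 * (M.betaStar p.1 g p.2 - M.betaHat p.1 p.2)) • L.QPhiXj j)
    (h0.congr' ((rate_mul_beta0_sub hX).mono fun p hp => ?_))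
    ((((isBigO_clusterScoreN_comp_inr hS j).add
      (isBigO_const_const (M.muBeta • L.QPhiXj j) (one_ne_zero (α := ℝ)) _)).const_smul_left
        (sgn g j)).sub
      (isBigO_one_smul hb (isBigO_const_const (L.QPhiXj j) one_ne_zero _)))
  · refine h1.congr fun p => ?_
    rw [dotProduct_sub L.G, dotProduct_smul _ L.G, dotProduct_smul _ L.G, dotProduct_add L.G,
      dotProduct_smul _ L.G, smul_eq_mul, smul_eq_mul, smul_eq_mul, Limits.b]
    ring
  · rw [hp]
    module

omit hτ hL hS [IsProbabilityMeasure P] in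
theorem tendsto_clusterScoreN_sub_gauss (j : Fin J) :
    Tendsto (fun p : ℕ × Ω => M.clusterScoreN τ p.1 j p.2 ∘ Sum.inr
      - WithLp.ofLp (M.gauss p.1 j p.2)) (probFilter P A) (𝓝 0) := by
  refine squeeze_zero_norm (fun p => ?_) (hX.normality.approx j).tendsto
  refine (norm_le_norm2 _).trans_eq ?_
  rw [norm2, WithLp.toLp_sub, WithLp.toLp_ofLp]
  rfl

end Scores

end Model

/-! ### Counting sign vectors and bounding the critical value -/

section Signs

variable {J : ℕ}

theorem sgn_eq_one_or (g : Signs J) (j : Fin J) : sgn g j = 1 ∨ sgn g j = -1 := by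
  rcases Int.units_eq_one_or (g j) with h | h <;> simp [sgn, h]

/-- The number of sign vectors that are constant on a set of clusters. -/
theorem card_constant_signs_le (Js : Finset (Fin J)) (j₀ : Fin J) :
    (Finset.univ.filter fun g : Signs J => ∀ j ∈ Js, g j = g j₀).card ≤ 2 ^ (J - Js.card + 1) := by
  classical
  -- A sign vector constant on the set is determined by the common sign and by its values on the
  -- complement.
  have h := Finset.card_le_card_of_injOn (s := Finset.univ.filter fun g : Signs J =>
      ∀ j ∈ Js, g j = g j₀) (t := (Finset.univ : Finset (ℤˣ × ({j // j ∉ Js} → ℤˣ))))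
    (fun g => (g j₀, fun j => g j)) (fun _ _ => Finset.mem_univ _) ?_
  · refine h.trans_eq ?_
    have hc : Fintype.card {j // j ∉ Js} = J - Js.card := by
      rw [Fintype.card_subtype_compl, Fintype.card_fin, Fintype.card_coe]
    rw [Finset.card_univ, Fintype.card_prod, Fintype.card_fun, Fintype.card_units_int, hc, pow_succ]
    ring
  · intro g hg g' hg' hgg'
    simp only [Finset.coe_filter, Finset.mem_univ, true_and, Set.mem_ofPred_eq] at hg hg'
    obtain ⟨h1, h2⟩ := Prod.mk.inj hgg'
    ext j
    by_cases hj : j ∈ Js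
    · rw [hg j hj, hg' j hj, h1]
    · rw [congrFun h2 ⟨j, hj⟩]

theorem card_signs : Fintype.card (Signs J) = 2 ^ J := by
  simp [Fintype.card_units_int]

theorem exists_one_and_neg_one {Js : Finset (Fin J)} {j₀ : Fin J} (hj₀ : j₀ ∈ Js) {g : Signs J}
    (hg : ¬ ∀ j ∈ Js, g j = g j₀) : (∃ j ∈ Js, sgn g j = 1) ∧ ∃ j ∈ Js, sgn g j = -1 := by
  push Not at hg
  obtain ⟨j₁, hj₁, h⟩ := hg
  have h' : sgn g j₁ ≠ sgn g j₀ := fun h'' => h (Units.ext (Int.cast_injective (α := ℝ) h''))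
  rcases sgn_eq_one_or g j₀ with h0 | h0 <;> rcases sgn_eq_one_or g j₁ with h1 | h1
  · exact absurd (h1.trans h0.symm) h'
  · exact ⟨⟨j₀, hj₀, h0⟩, ⟨j₁, hj₁, h1⟩⟩
  · exact ⟨⟨j₁, hj₁, h1⟩, ⟨j₀, hj₀, h0⟩⟩
  · exact absurd (h1.trans h0.symm) h'

/-- The critical value is at most any bound of the statistics that holds for all sign vectors that
are not constant on the strong clusters. -/
theorem quantile_le_of_nonconstant {dw dphi : ℕ} {L : Limits J dw dphi} {Js : Finset (Fin J)}
    {α : ℝ} (hα : α ∈ Set.Ioo (0 : ℝ) 1) (hJs : L.StrongClusters Js α) {j₀ : Fin J}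
    {T : Signs J → ℝ} (hT : ∀ g, 0 ≤ T g) {t : ℝ}
    (h : ∀ g, (¬ ∀ j ∈ Js, g j = g j₀) → T g ≤ t) : quantile T (1 - α) ≤ t := by
  classical
  -- Boundedness below is needed for the infimum: since `1 - α > 0`, every admissible `x` exceeds or
  -- equals at least one of the nonnegative statistics.
  refine csInf_le ⟨0, fun x hx => ?_⟩ ?_
  · simp only [Set.mem_ofPred_eq] at hx
    have h1 : 0 < (1 - α) * (Fintype.card (Signs J) : ℝ) :=
      mul_pos (by linarith [hα.2]) (by exact_mod_cast Fintype.card_pos)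
    have h2 : 0 < (Finset.univ.filter fun g => T g ≤ x).card := by
      exact_mod_cast h1.trans_le hx
    obtain ⟨g, hg⟩ := Finset.card_pos.mp h2
    exact (hT g).trans (Finset.mem_filter.mp hg).2
  · simp only [Set.mem_ofPred_eq, card_signs]
    have h1 : (Finset.univ.filter fun g : Signs J => ¬ ∀ j ∈ Js, g j = g j₀).card
        ≤ (Finset.univ.filter fun g => T g ≤ t).card :=
      Finset.card_le_card fun g hg => by
        rw [Finset.mem_filter] at hg ⊢
        exact ⟨hg.1, h g hg.2⟩
    have h2 := Finset.card_filter_add_card_filter_not (s := (Finset.univ : Finset (Signs J)))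
      (fun g : Signs J => ∀ j ∈ Js, g j = g j₀)
    rw [Finset.card_univ, card_signs] at h2
    have h3 := card_constant_signs_le Js j₀
    have h4 := hJs.enough
    have h5 : ⌈(2 : ℝ) ^ J * (1 - α)⌉₊ ≤ (Finset.univ.filter fun g => T g ≤ t).card := by omega
    have h6 := Nat.le_ceil ((2 : ℝ) ^ J * (1 - α))
    calc (1 - α) * ((2 ^ J : ℕ) : ℝ) = (2 : ℝ) ^ J * (1 - α) := by push_cast; ring
      _ ≤ _ := h6.trans (by exact_mod_cast h5)

/-- With at most one strong cluster the subtracted power would already be `2 ^ J`, leaving no room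
for a positive order index. -/
theorem Limits.StrongClusters.one_lt_card {dw dphi : ℕ} {L : Limits J dw dphi}
    {Js : Finset (Fin J)} {α : ℝ} (hα : α ∈ Set.Ioo (0 : ℝ) 1) (hJs : L.StrongClusters Js α) :
    1 < Js.card := by
  have h1 : 0 < ⌈(2 : ℝ) ^ J * (1 - α)⌉₊ :=
    Nat.ceil_pos.mpr (mul_pos (by positivity) (by linarith [hα.2]))
  have h2 := hJs.enough
  by_contra! h3
  have h4 : 2 ^ J ≤ 2 ^ (J - Js.card + 1) := Nat.pow_le_pow_right (by norm_num) (by omega)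
  omega

end Signs

/-! ### Bounds for studentized ratios -/

section Studentized

variable {J : ℕ}

theorem wabs_nonneg (a u : ℝ) : 0 ≤ wabs a u := Real.sqrt_nonneg _

/-- Multiplication by `√N` frees the statistic from the scales of `r` and `N`, and affects the
statistic and its critical value alike. -/
theorem sqrt_mul_wabs {N r : ℝ} (hN : 0 < N) (hr : 0 < r) (s e : Fin J → ℝ) (u : ℝ) :
    √N * wabs ((N⁻¹ * ∑ j, (s j / r * e j) ^ 2)⁻¹) u
      = |r * u| / √(∑ j, (s j / N * e j) ^ 2) := by
  have h1 : N⁻¹ * ∑ j, (s j / r * e j) ^ 2 = N / r ^ 2 * ∑ j, (s j / N * e j) ^ 2 := by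
    rw [Finset.mul_sum, Finset.mul_sum]
    refine Finset.sum_congr rfl fun j _ => ?_
    field_simp
  rw [wabs, h1, ← Real.sqrt_mul hN.le, ← Real.sqrt_sq_eq_abs, ← Real.sqrt_div (sq_nonneg _)]
  congr 1
  -- For a vanishing studentizer both sides are zero, by the conventions for inversion and division.
  rcases eq_or_ne (∑ j, (s j / N * e j) ^ 2) 0 with h | h
  · simp [h]
  · field_simp

/-- The studentized bootstrap statistics are bounded if the signs vary over the strong clusters. -/
theorem div_sqrt_sum_le {g : Signs J} {j₁ j₂ : Fin J} (h₁ : sgn g j₁ = 1) (h₂ : sgn g j₂ = -1)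
    {w b s e : Fin J → ℝ} {μ k c ξ K : ℝ} (hc : 0 < c) (hξ : 0 < ξ)
    (hw : ∀ j, ξ ≤ w j) (hb₁ : c ≤ |b j₁|) (hb₂ : c ≤ |b j₂|) (hs : ∀ j, |s j| ≤ K)
    (he : ∀ j, |e j - (sgn g j * (s j + μ * b j) - b j * k)| ≤ 1)
    (hμ : K + 1 ≤ c * |μ|) :
    |k| / √(∑ j, (w j * e j) ^ 2) ≤ (ξ * c)⁻¹ := by
  -- When the two terms reinforce each other, `|e j|` is at least `c (|μ| + |k|) - K - 1`, and `hμ`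
  -- lets `c |μ|` pay for `K + 1`.
  have key : ∀ j, |sgn g j * μ - k| = |μ| + |k| → c ≤ |b j| →
      c * |k| ≤ |e j| := by
    intro j h3 hb
    have hs1 : |sgn g j * s j| ≤ K := by
      rw [abs_mul]
      rcases sgn_eq_one_or g j with h | h <;> simpa [h] using hs j
    have h4 : |b j * (sgn g j * μ - k)| ≤ |e j| + 1 + K := by
      have h5 : b j * (sgn g j * μ - k)
          = e j - (e j - (sgn g j * (s j + μ * b j) - b j * k)) - sgn g j * s j := by ring
      rw [h5]
      exact (abs_sub _ _).trans (add_le_add ((abs_sub _ _).trans (add_le_add le_rfl (he j))) hs1)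
    rw [abs_mul, h3] at h4
    have h6 := mul_le_mul_of_nonneg_right hb (by positivity : 0 ≤ |μ| + |k|)
    linarith
  -- Both signs occur, so a cluster can be chosen whose sign makes `sgn g j * μ` and `k` opposite.
  obtain ⟨j, hj⟩ : ∃ j, c * |k| ≤ |e j| := by
    rcases le_total (μ * k) 0 with h | h
    · refine ⟨j₁, key j₁ ?_ hb₁⟩
      rw [h₁, one_mul]
      rcases mul_nonpos_iff.mp h with ⟨h3, h4⟩ | ⟨h3, h4⟩
      · rw [abs_of_nonneg h3, abs_of_nonpos h4, abs_of_nonneg (by linarith)]; ring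
      · rw [abs_of_nonpos h3, abs_of_nonneg h4, abs_of_nonpos (by linarith)]; ring
    · refine ⟨j₂, key j₂ ?_ hb₂⟩
      rw [h₂]
      rcases mul_nonneg_iff.mp h with ⟨h3, h4⟩ | ⟨h3, h4⟩
      · rw [abs_of_nonneg h3, abs_of_nonneg h4, abs_of_nonpos (by linarith)]; ring
      · rw [abs_of_nonpos h3, abs_of_nonpos h4, abs_of_nonneg (by linarith)]; ring
  have h7 : w j * |e j| ≤ √(∑ j, (w j * e j) ^ 2) := by
    refine Real.le_sqrt_of_sq_le ?_
    calc (w j * |e j|) ^ 2 = (w j * e j) ^ 2 := by rw [mul_pow, sq_abs, mul_pow]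
      _ ≤ _ := Finset.single_le_sum (f := fun j => (w j * e j) ^ 2) (fun _ _ => sq_nonneg _)
          (Finset.mem_univ j)
  have h8 : ξ * (c * |k|) ≤ √(∑ j, (w j * e j) ^ 2) :=
    (mul_le_mul (hw j) hj (by positivity) (hξ.le.trans (hw j))).trans h7
  rcases (Real.sqrt_nonneg (∑ j, (w j * e j) ^ 2)).eq_or_lt with h9 | h9
  · rw [← h9, div_zero]; positivity
  · rw [div_le_iff₀ h9, inv_mul_eq_div, le_div_iff₀ (by positivity)]
    linarith

end Studentized

/-! ### The test statistics in scaled form -/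

namespace Model

variable {J dw dphi dz : ℕ} {Ω : Type*} {M : Model J dw dphi dz Ω}

theorem dotProduct_vecMulVec_mulVec (G s : Vec dphi) :
    G ⬝ᵥ vecMulVec s s *ᵥ G = (G ⬝ᵥ s) ^ 2 := by
  rw [vecMulVec_mulVec, dotProduct_smul, dotProduct_comm s G]
  simp [sq]

theorem clusterScore_eq (τ : ℝ) (n : ℕ) (j : Fin J) (ω : Ω) (hr : M.rate n ≠ 0) :
    M.clusterScore τ n j ω = ((M.size n j : ℝ) / M.rate n) •
      ((M.rate n • M.empHat τ n j ω (M.betaHat n ω) (M.gammaFin n ω) 0) ∘ Sum.inr) := by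
  ext l
  simp only [clusterScore, Pi.smul_apply, Function.comp_apply, smul_eq_mul, ← size_mul_empHat]
  field_simp

theorem clusterScoreStar_eq (τ : ℝ) (n : ℕ) (g : Signs J) (j : Fin J) (ω : Ω)
    (hr : M.rate n ≠ 0) :
    M.clusterScoreStar τ n g j ω = ((M.size n j : ℝ) / M.rate n) •
      (sgn g j • (M.rate n • M.empHat τ n j ω M.beta0 (M.gammaR n ω) 0) ∘ Sum.inr
        + (M.rate n • M.empHat τ n j ω (M.betaStar n g ω) (M.gammaStarFin n g ω) 0) ∘ Sum.inr
        - (M.rate n • M.empHat τ n j ω (M.betaHat n ω) (M.gammaFin n ω) 0) ∘ Sum.inr) := by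
  ext l
  simp only [clusterScoreStar, Pi.smul_apply, Function.comp_apply, smul_eq_mul, Pi.add_apply,
    Pi.sub_apply, Finset.sum_add_distrib, Finset.sum_sub_distrib, ← Finset.mul_sum,
    ← size_mul_empHat]
  field_simp

theorem sqrt_mul_TCR (τ : ℝ) (n : ℕ) (ω : Ω) (hr : 0 < M.rate n) (hN : 0 < (M.total n : ℝ)) :
    √(M.total n : ℝ) * M.TCR τ n ω = |M.rate n * (M.betaHat n ω - M.beta0)| /
      √(∑ j, ((M.size n j : ℝ) / (M.total n : ℝ) * (M.GHat n ω ⬝ᵥ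
        ((M.rate n • M.empHat τ n j ω (M.betaHat n ω) (M.gammaFin n ω) 0) ∘ Sum.inr))) ^ 2) := by
  rw [← sqrt_mul_wabs hN hr, TCR, ACR, OmegaHat, smul_mulVec, sum_mulVec, dotProduct_smul,
    dotProduct_sum, smul_eq_mul]
  simp only [dotProduct_vecMulVec_mulVec, clusterScore_eq τ n _ ω hr.ne', dotProduct_smul,
    smul_eq_mul]

theorem sqrt_mul_TCRStar (τ : ℝ) (n : ℕ) (g : Signs J) (ω : Ω) (hr : 0 < M.rate n)
    (hN : 0 < (M.total n : ℝ)) :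
    √(M.total n : ℝ) * M.TCRStar τ n g ω = |M.rate n * (M.betaStar n g ω - M.betaHat n ω)| /
      √(∑ j, ((M.size n j : ℝ) / (M.total n : ℝ) * (M.GHat n ω ⬝ᵥ
        (sgn g j • (M.rate n • M.empHat τ n j ω M.beta0 (M.gammaR n ω) 0) ∘ Sum.inr
        + (M.rate n • M.empHat τ n j ω (M.betaStar n g ω) (M.gammaStarFin n g ω) 0) ∘ Sum.inr
        - (M.rate n • M.empHat τ n j ω (M.betaHat n ω) (M.gammaFin n ω) 0) ∘ Sum.inr))) ^ 2) := by
  rw [← sqrt_mul_wabs hN hr, TCRStar, ACRStar, OmegaStar, smul_mulVec, sum_mulVec,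
    dotProduct_smul, dotProduct_sum, smul_eq_mul]
  simp only [dotProduct_vecMulVec_mulVec, clusterScoreStar_eq τ n g _ ω hr.ne', dotProduct_smul,
    smul_eq_mul]

/-! ### Power of the studentized test -/

section Power

open _root_.Asymptotics

variable {J dw dphi dz : ℕ} {Ω : Type*} {M : Model J dw dphi dz Ω}

theorem norm_scoreN_comp_inr_le (τ : ℝ) (n : ℕ) (ω : Ω) (hN : 0 < (M.total n : ℝ)) {K : ℝ}
    (hK : ∀ j, ‖M.clusterScoreN τ n j ω ∘ Sum.inr‖ ≤ K) : ‖M.scoreN τ n ω ∘ Sum.inr‖ ≤ K := by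
  have h1 : M.scoreN τ n ω ∘ Sum.inr
      = ∑ j, ((M.size n j : ℝ) / (M.total n : ℝ)) • (M.clusterScoreN τ n j ω ∘ Sum.inr) := by
    rw [scoreN_eq]
    ext l
    simp
  have h2 : ∑ j, (M.size n j : ℝ) / (M.total n : ℝ) = 1 := by
    rw [← Finset.sum_div, div_eq_one_iff_eq hN.ne', total]
    push_cast
    rfl
  rw [h1]
  calc _ ≤ ∑ j, (M.size n j : ℝ) / (M.total n : ℝ) * K :=
        norm_sum_le_of_le _ fun j _ => by
          rw [norm_smul, Real.norm_of_nonneg (by positivity)]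
          exact mul_le_mul_of_nonneg_left (hK j) (by positivity)
    _ = K := by rw [← Finset.sum_mul, h2, one_mul]

theorem share_le_one (n : ℕ) (j : Fin J) (hN : 0 < (M.total n : ℝ)) :
    (M.size n j : ℝ) / (M.total n : ℝ) ≤ 1 := by
  rw [div_le_one hN]
  exact_mod_cast Finset.single_le_sum (f := fun j => M.size n j) (fun _ _ => Nat.zero_le _)
    (Finset.mem_univ j)

variable [MeasurableSpace Ω] {P : Measure Ω} [IsProbabilityMeasure P] {τ α : ℝ}
  {L : Limits J dw dphi} {A : ℕ → Set Ω} {Js : Finset (Fin J)}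

/-- The error of `β̂` enters the score of cluster `j` with factor `b_j`, so this combination
eliminates it and only the Gaussian vectors remain. -/
theorem tendsto_GHat_combination (hτ : τ ∈ Set.Ioo (0 : ℝ) 1) (hL : L.Regular)
    (hX : M.Assumptions P τ L)
    (hS : ∀ j, (fun p : ℕ × Ω => M.clusterScoreN τ p.1 j p.2) =O[probFilter P A] fun _ => (1 : ℝ))
    (j₁ j₂ : Fin J) :
    Tendsto (fun p : ℕ × Ω => (L.b j₁ * (M.GHat p.1 p.2 ⬝ᵥ ((M.rate p.1 • M.empHat τ p.1 j₂ p.2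
        (M.betaHat p.1 p.2) (M.gammaFin p.1 p.2) 0) ∘ Sum.inr))
      - L.b j₂ * (M.GHat p.1 p.2 ⬝ᵥ ((M.rate p.1 • M.empHat τ p.1 j₁ p.2
        (M.betaHat p.1 p.2) (M.gammaFin p.1 p.2) 0) ∘ Sum.inr)))
      - (L.b j₁ * (L.G ⬝ᵥ WithLp.ofLp (M.gauss p.1 j₂ p.2))
        - L.b j₂ * (L.G ⬝ᵥ WithLp.ofLp (M.gauss p.1 j₁ p.2)))) (probFilter P A) (𝓝 0) := by
  have h1 : ∀ j, Tendsto (fun p : ℕ × Ω => L.G ⬝ᵥ (M.clusterScoreN τ p.1 j p.2 ∘ Sum.inr)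
      - L.G ⬝ᵥ WithLp.ofLp (M.gauss p.1 j p.2)) (probFilter P A) (𝓝 0) := by
    intro j
    have hc : Continuous fun w : Vec dphi => L.G ⬝ᵥ w := by
      unfold dotProduct; fun_prop
    have := (hc.tendsto 0).comp (tendsto_clusterScoreN_sub_gauss (A := A) hX j)
    rw [dotProduct_zero] at this
    exact this.congr fun p => dotProduct_sub _ _ _
  have h2 := tendsto_GHat_dotProduct_empHat hτ hL hX hS
  have h3 := ((((h2 j₂).add (h1 j₂)).const_mul (L.b j₁)).sub
    (((h2 j₁).add (h1 j₁)).const_mul (L.b j₂)))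
  simp only [add_zero, mul_zero, sub_zero] at h3
  exact h3.congr fun p => by ring

/-- For a large local parameter the critical value of the cluster-robust test is eventually
exceeded. -/
theorem eventually_quantile_lt_TCR (hα : α ∈ Set.Ioo (0 : ℝ) 1) (hτ : τ ∈ Set.Ioo (0 : ℝ) 1)
    (hL : L.Regular) (hJs : L.StrongClusters Js α) (hX : M.Assumptions P τ L)
    {C K K₁ K₂ E κ ξ c : ℝ} (hξ : 0 < ξ) (hξj : ∀ j, ξ < L.xi j) (hc : 0 < c)
    (hcb : ∀ j ∈ Js, c ≤ |L.b j|) {j₁ j₂ : Fin J} (hj₁ : j₁ ∈ Js) (hC : 0 < C)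
    (hbound : ∀ᶠ p in probFilter P A, M.rate p.1 * |M.betaHat p.1 p.2 - M.betaN p.1|
      ≤ C * (‖M.scoreN τ p.1 p.2 ∘ Sum.inr‖ + 1))
    (hS : ∀ j, (fun p : ℕ × Ω => M.clusterScoreN τ p.1 j p.2) =O[probFilter P A] fun _ => (1 : ℝ))
    (hK : ∀ n, ∀ ω ∈ A n, ∀ j, ‖M.gauss n j ω‖ ≤ K) (hκ : 0 < κ)
    (hκA : ∀ n, ∀ ω ∈ A n, κ ≤ |L.b j₁ * (L.G ⬝ᵥ WithLp.ofLp (M.gauss n j₂ ω))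
        - L.b j₂ * (L.G ⬝ᵥ WithLp.ofLp (M.gauss n j₁ ω))|)
    (hK₁ : C * (K + 2) ≤ K₁) (hK₂ : dphi * (‖L.G‖ * (K + 1)) ≤ K₂)
    (hE : K₂ + (∑ j, |L.b j|) * K₁ + 1 ≤ E) (hμ : K₂ + 1 ≤ c * |M.muBeta|)
    (hμ' : K₁ + (ξ * c)⁻¹ * ((J + 1) * E) < |M.muBeta|) :
    ∀ᶠ p in probFilter P A, quantile (fun g => M.TCRStar τ p.1 g p.2) (1 - α) < M.TCR τ p.1 p.2 := by
  have hw : ∀ᶠ p in probFilter P A, ∀ j, ξ < (M.size p.1 j : ℝ) / (M.total p.1 : ℝ) :=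
    eventually_all.mpr fun j => (tendsto_share' hX j).eventually_const_lt (hξj j)
  have hN : ∀ᶠ p in probFilter P A, 0 < M.total p.1 :=
    (tendsto_fst_probFilter (P := P) (A := A)).eventually (p := fun n => 0 < M.total n)
      (hX.asymptotics.total_tendsto.eventually_gt_atTop 0)
  have hZ : ∀ᶠ p in probFilter P A, ∀ j, ‖M.clusterScoreN τ p.1 j p.2 ∘ Sum.inr
      - WithLp.ofLp (M.gauss p.1 j p.2)‖ < 1 :=
    eventually_all.mpr fun j => (tendsto_clusterScoreN_sub_gauss hX j).norm.eventually_lt_const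
      (by simp)
  have he : ∀ᶠ p in probFilter P A, ∀ j, |M.GHat p.1 p.2 ⬝ᵥ ((M.rate p.1 • M.empHat τ p.1 j p.2
        (M.betaHat p.1 p.2) (M.gammaFin p.1 p.2) 0) ∘ Sum.inr)
      - (L.G ⬝ᵥ (M.clusterScoreN τ p.1 j p.2 ∘ Sum.inr)
        - L.b j * (M.rate p.1 * (M.betaHat p.1 p.2 - M.betaN p.1)))| < 1 :=
    eventually_all.mpr fun j => (tendsto_GHat_dotProduct_empHat hτ hL hX hS j).abs.eventually_lt_const
      (by simp)
  have hes : ∀ᶠ p in probFilter P A, ∀ g j, |M.GHat p.1 p.2 ⬝ᵥ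
        (sgn g j • (M.rate p.1 • M.empHat τ p.1 j p.2 M.beta0 (M.gammaR p.1 p.2) 0) ∘ Sum.inr
        + (M.rate p.1 • M.empHat τ p.1 j p.2 (M.betaStar p.1 g p.2)
            (M.gammaStarFin p.1 g p.2) 0) ∘ Sum.inr
        - (M.rate p.1 • M.empHat τ p.1 j p.2 (M.betaHat p.1 p.2) (M.gammaFin p.1 p.2) 0)
            ∘ Sum.inr)
      - (sgn g j * (L.G ⬝ᵥ (M.clusterScoreN τ p.1 j p.2 ∘ Sum.inr) + M.muBeta * L.b j)
        - L.b j * (M.rate p.1 * (M.betaStar p.1 g p.2 - M.betaHat p.1 p.2)))| < 1 :=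
    eventually_all.mpr fun g => eventually_all.mpr fun j =>
      (tendsto_GHat_dotProduct_star hτ hL hX hS g j).abs.eventually_lt_const (by simp)
  filter_upwards [hw, hN, hZ, he, hes, hbound, eventually_mem_probFilter,
    (tendsto_GHat_combination hτ hL hX hS j₁ j₂).abs.eventually_lt_const (u := κ) (by simpa),
    rate_mul_beta0_sub hX, (tendsto_rate' hX).eventually_gt_atTop 0]
    with p hw hN hZ he hes hbound hA hcomb hbeta0 hr
  have hN' : 0 < (M.total p.1 : ℝ) := by exact_mod_cast hN
  have hK0 : 0 ≤ K := (norm_nonneg _).trans (hK _ _ hA j₁)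
  have hSj : ∀ j, ‖M.clusterScoreN τ p.1 j p.2 ∘ Sum.inr‖ ≤ K + 1 := fun j => by
    have h1 := norm_sub_norm_le (M.clusterScoreN τ p.1 j p.2 ∘ Sum.inr)
      (WithLp.ofLp (M.gauss p.1 j p.2))
    have h2 : ‖WithLp.ofLp (M.gauss p.1 j p.2)‖ ≤ K := (norm_le_norm2 _).trans (hK _ _ hA j)
    linarith [hZ j]
  have hGS : ∀ j, |L.G ⬝ᵥ (M.clusterScoreN τ p.1 j p.2 ∘ Sum.inr)| ≤ K₂ := fun j => by
    refine (abs_dotProduct_le _ _).trans (le_trans ?_ hK₂)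
    rw [Fintype.card_fin]
    gcongr
    exact hSj j
  have hh : |M.rate p.1 * (M.betaHat p.1 p.2 - M.betaN p.1)| ≤ K₁ := by
    rw [abs_mul, abs_of_pos hr]
    refine hbound.trans (le_trans ?_ hK₁)
    have := norm_scoreN_comp_inr_le τ p.1 p.2 hN' hSj
    exact mul_le_mul_of_nonneg_left (by linarith) hC.le
  have hE0 : ∀ j, |M.GHat p.1 p.2 ⬝ᵥ ((M.rate p.1 • M.empHat τ p.1 j p.2
      (M.betaHat p.1 p.2) (M.gammaFin p.1 p.2) 0) ∘ Sum.inr)| ≤ E := fun j => by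
    set e := M.GHat p.1 p.2 ⬝ᵥ ((M.rate p.1 • M.empHat τ p.1 j p.2
      (M.betaHat p.1 p.2) (M.gammaFin p.1 p.2) 0) ∘ Sum.inr)
    have h1 : |L.b j * (M.rate p.1 * (M.betaHat p.1 p.2 - M.betaN p.1))|
        ≤ (∑ j, |L.b j|) * K₁ := by
      rw [abs_mul]
      exact mul_le_mul (Finset.single_le_sum (f := fun j => |L.b j|) (fun _ _ => abs_nonneg _)
        (Finset.mem_univ j)) hh (abs_nonneg _) (Finset.sum_nonneg fun _ _ => abs_nonneg _)
    have h2 := abs_sub_abs_le_abs_sub e (L.G ⬝ᵥ (M.clusterScoreN τ p.1 j p.2 ∘ Sum.inr)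
        - L.b j * (M.rate p.1 * (M.betaHat p.1 p.2 - M.betaN p.1)))
    have h3 := abs_sub (L.G ⬝ᵥ (M.clusterScoreN τ p.1 j p.2 ∘ Sum.inr))
      (L.b j * (M.rate p.1 * (M.betaHat p.1 p.2 - M.betaN p.1)))
    linarith [he j, hGS j]
  have hT := sqrt_mul_TCR τ p.1 p.2 hr hN'
  set e : Fin J → ℝ := fun j => M.GHat p.1 p.2 ⬝ᵥ ((M.rate p.1 • M.empHat τ p.1 j p.2
      (M.betaHat p.1 p.2) (M.gammaFin p.1 p.2) 0) ∘ Sum.inr)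
  set w : Fin J → ℝ := fun j => (M.size p.1 j : ℝ) / (M.total p.1 : ℝ)
  have hEnn : 0 ≤ E := (abs_nonneg _).trans (hE0 j₁)
  -- A zero studentizer would make the statistic zero by the division convention. It would force all
  -- `e j` to vanish, and with them a combination that is close to a Gaussian quantity of size at
  -- least `κ`.
  have hpos : 0 < √(∑ j, (w j * e j) ^ 2) := by
    rw [Real.sqrt_pos]
    have h1 : L.b j₁ * e j₂ - L.b j₂ * e j₁ ≠ 0 := fun h0 => by
      have h2 := hκA _ _ hA
      change |L.b j₁ * e j₂ - L.b j₂ * e j₁ - _| < κ at hcomb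
      rw [h0, zero_sub, abs_neg] at hcomb
      linarith
    refine (Finset.sum_nonneg fun j _ => sq_nonneg _).lt_of_ne' fun h0 => h1 ?_
    have h2 := (Finset.sum_eq_zero_iff_of_nonneg fun j _ => sq_nonneg (w j * e j)).mp h0
    have h3 : ∀ j, e j = 0 := fun j =>
      (mul_eq_zero.mp (pow_eq_zero_iff (two_ne_zero)|>.mp (h2 j (Finset.mem_univ j)))).resolve_left
        (hξ.trans (hw j)).ne'
    rw [h3, h3, mul_zero, mul_zero, sub_zero]
  -- The shares are at most one and the scores at most `E`, so the sum is at most `J E²`; the factor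
  -- `J + 1` is a crude bound for `√J`.
  have hup : √(∑ j, (w j * e j) ^ 2) ≤ (J + 1) * E := by
    refine Real.sqrt_le_iff.mpr ⟨by positivity, ?_⟩
    have h1 : ∀ j ∈ Finset.univ, (w j * e j) ^ 2 ≤ E ^ 2 := fun j _ => by
      have h2 : 0 ≤ w j := (hξ.trans (hw j)).le
      have h3 : w j ≤ 1 := share_le_one p.1 j hN'
      rw [← sq_abs, abs_mul, abs_of_nonneg h2]
      refine pow_le_pow_left₀ (by positivity) ?_ 2
      calc w j * |e j| ≤ 1 * E := mul_le_mul h3 (hE0 j) (abs_nonneg _) zero_le_one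
        _ = E := one_mul E
    refine (Finset.sum_le_card_nsmul _ _ _ h1).trans ?_
    rw [Finset.card_univ, Fintype.card_fin, nsmul_eq_mul, mul_pow]
    have h4 : (0 : ℝ) ≤ J := Nat.cast_nonneg J
    exact mul_le_mul_of_nonneg_right (by nlinarith) (sq_nonneg E)
  -- The numerator is `μ_β` plus a term bounded by `K₁`, and the studentizer is at most `(J + 1) E`;
  -- `hμ'` compares the two.
  have hbig : (ξ * c)⁻¹ < √(M.total p.1 : ℝ) * M.TCR τ p.1 p.2 := by
    rw [hT, lt_div_iff₀ hpos]
    have h1 : M.rate p.1 * (M.betaHat p.1 p.2 - M.beta0)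
        = M.muBeta - -(M.rate p.1 * (M.betaHat p.1 p.2 - M.betaN p.1)) := by
      linear_combination -hbeta0
    have h2 := abs_sub_abs_le_abs_sub M.muBeta
      (-(M.rate p.1 * (M.betaHat p.1 p.2 - M.betaN p.1)))
    rw [abs_neg] at h2
    rw [h1]
    have h3 : (ξ * c)⁻¹ * √(∑ j, (w j * e j) ^ 2) ≤ (ξ * c)⁻¹ * ((J + 1) * E) := by gcongr
    linarith
  have hq : quantile (fun g => M.TCRStar τ p.1 g p.2) (1 - α)
      ≤ (ξ * c)⁻¹ / √(M.total p.1 : ℝ) := by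
    refine quantile_le_of_nonconstant (j₀ := j₁) hα hJs (fun g => wabs_nonneg _ _) fun g hg => ?_
    obtain ⟨⟨i₁, hi₁, h1⟩, i₂, hi₂, h2⟩ := exists_one_and_neg_one hj₁ hg
    change M.TCRStar τ p.1 g p.2 ≤ _
    rw [le_div_iff₀ (Real.sqrt_pos.mpr hN'), mul_comm, sqrt_mul_TCRStar τ p.1 g p.2 hr hN']
    exact div_sqrt_sum_le h1 h2 hc hξ (fun j => (hw j).le) (hcb _ hi₁) (hcb _ hi₂) hGS
      (fun j => (hes g j).le) hμ
  refine hq.trans_lt ?_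
  rw [div_lt_iff₀ (Real.sqrt_pos.mpr hN'), mul_comm (M.TCR τ p.1 p.2)]
  exact hbig

end Power

end Model

/-! ### Events of large probability and conclusion -/

open _root_.Asymptotics in
/-- Tightness of the cluster scores along the events on which they are bounded. -/
theorem Model.isBigO_clusterScoreN_of_mem {J dw dphi dz : ℕ} {Ω : Type*}
    {M : Model J dw dphi dz Ω} [MeasurableSpace Ω] {P : Measure Ω} {τ : ℝ} {A : ℕ → Set Ω} {j : Fin J}
    {C : ℝ} (h : ∀ n, ∀ ω ∈ A n,
      |M.rate n * norm2 (M.emp τ n j ω (M.betaN n) (M.gammaTrue n) 0)| ≤ C) :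
    (fun p : ℕ × Ω => M.clusterScoreN τ p.1 j p.2) =O[probFilter P A] fun _ => (1 : ℝ) := by
  refine IsBigO.of_bound C ?_
  filter_upwards [eventually_mem_probFilter] with p hp
  rw [norm_one, mul_one]
  refine le_trans ?_ (h _ _ hp)
  rw [Model.clusterScoreN, norm_smul, abs_mul, Real.norm_eq_abs]
  exact mul_le_mul_of_nonneg_left ((norm_le_norm2 _).trans (le_abs_self _)) (abs_nonneg _)

theorem inner_smul_toLp {d : ℕ} (a : ℝ) (G : Vec d) (z : EuclideanSpace ℝ (Fin d)) :
    inner ℝ (a • WithLp.toLp 2 G) z = a * (G ⬝ᵥ WithLp.ofLp z) := by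
  rw [real_inner_smul_left, EuclideanSpace.inner_eq_star_dotProduct]
  simp [dotProduct_comm]

/-- Bounds of the Gaussian vectors that hold with high probability, with constants that depend only
on the covariance matrices. -/
theorem exists_gauss_bounds {J dw dphi : ℕ} {L : Limits J dw dphi} (hL : L.Regular)
    {j₁ j₂ : Fin J} (h₁₂ : j₁ ≠ j₂) (hb : L.b j₁ ≠ 0) {ε : ENNReal} (hε : 0 < ε) :
    ∃ K κ : ℝ, 0 < K ∧ 0 < κ ∧ ∀ (dz : ℕ) (Ω : Type*) [MeasurableSpace Ω] (P : Measure Ω)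
      [IsProbabilityMeasure P] (M : Model J dw dphi dz Ω) (τ : ℝ), M.Normality P τ L → ∀ n,
        (∀ j, P {ω | K ≤ ‖M.gauss n j ω‖} ≤ ε) ∧
        P {ω | |L.b j₁ * (L.G ⬝ᵥ WithLp.ofLp (M.gauss n j₂ ω))
          - L.b j₂ * (L.G ⬝ᵥ WithLp.ofLp (M.gauss n j₁ ω))| < κ} ≤ ε := by
  choose K hK0 hK using fun j =>
    exists_measure_norm_ge_le (multivariateGaussian (0 : EuclideanSpace ℝ (Fin dphi)) (L.Sig j)) hε
  have hG : L.b j₁ • WithLp.toLp 2 L.G ≠ 0 := by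
    refine smul_ne_zero hb fun h => ?_
    have h2 : L.G = 0 := by simpa using congrArg WithLp.ofLp h
    have h3 := hL.G_ne
    rw [h2, dotProduct_zero] at h3
    exact h3.false
  -- Nondegeneracy comes from cluster `j₂` alone, whose coefficient is `b_{j₁} G ≠ 0`.
  obtain ⟨κ, hκ, hκ'⟩ := exists_forall_measure_inner_add_inner_lt_le (S₂ := L.Sig j₁)
    (hL.Sig_posDef j₂) hG (-L.b j₂ • WithLp.toLp 2 L.G) hε
  refine ⟨∑ j, K j, κ, Finset.sum_pos (fun j _ => hK0 j) ⟨j₁, Finset.mem_univ _⟩, hκ,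
    fun dz Ω _ P _ M τ hN n => ⟨fun j => ?_, ?_⟩⟩
  · have hle : K j ≤ ∑ j, K j :=
      Finset.single_le_sum (fun i _ => (hK0 i).le) (Finset.mem_univ j)
    refine le_trans ?_ (hK j)
    rw [← hN.law n j, Measure.map_apply (hN.measurable n j)
      (measurableSet_le measurable_const measurable_norm)]
    exact measure_mono fun ω hω => hle.trans hω
  · have h := hκ' Ω P (M.gauss n j₂) (M.gauss n j₁) (hN.measurable n j₂) (hN.measurable n j₁)
      (hN.law n j₂) (hN.law n j₁) ((hN.indep n).indepFun h₁₂.symm)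
    simp only [inner_smul_toLp] at h
    refine le_trans (le_of_eq ?_) h
    congr 1
    ext ω
    simp only [Set.mem_ofPred_eq, neg_mul, sub_eq_add_neg]

end IVQR

theorem theorem3 {J dw dphi : ℕ} (τ α : ℝ) (hτ : τ ∈ Set.Ioo (0 : ℝ) 1)
    (hα : α ∈ Set.Ioo (0 : ℝ) 1) (L : Limits J dw dphi) (hL : L.Regular)
    (Js : Finset (Fin J)) (hJs : L.StrongClusters Js α)
    (c₀ : ℝ) (hc₀ : 0 < c₀)
    (hG : 2 ^ J < (L.Gset c₀).card + ⌈(2 : ℝ) ^ J * (1 - α)⌉₊)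
    (δ : ℝ) (hδ : 0 < δ) :
    ∃ cμ : ℝ, 0 < cμ ∧
      ∀ (dz : ℕ) (Ω : Type*) [MeasurableSpace Ω] (P : Measure Ω) [IsProbabilityMeasure P]
        (M : Model J dw dphi dz Ω), M.Assumptions P τ L → cμ < |M.muBeta| →
          ENNReal.ofReal (1 - δ) ≤
            liminf (fun n => P {ω | M.test α n ω ≤ M.testCR τ α n ω}) atTop := by
  obtain ⟨j₁, hj₁, j₂, hj₂, h₁₂⟩ := Finset.one_lt_card.mp (hJs.one_lt_card hα)
  obtain ⟨c, hc, hcb⟩ := hJs.strong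
  have hcb' : ∀ j ∈ Js, c ≤ |L.b j| := fun j hj => (hcb j hj).trans (min_le_right _ _)
  have hb₁ : L.b j₁ ≠ 0 := abs_pos.mp (hc.trans_le (hcb' j₁ hj₁))
  obtain ⟨ξ, hξ, hξj⟩ : ∃ ξ : ℝ, 0 < ξ ∧ ∀ j, ξ < L.xi j := by
    obtain ⟨i, _, hi⟩ := Finset.exists_min_image Finset.univ L.xi ⟨j₁, Finset.mem_univ _⟩
    exact ⟨L.xi i / 2, half_pos (hL.xi_pos i), fun j =>
      (half_lt_self (hL.xi_pos i)).trans_le (hi j (Finset.mem_univ j))⟩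
  obtain ⟨C, hC, hbound⟩ := Model.IsSelector.exists_rate_mul_le hL
  -- There are `2 J + 1` bad events: `J` large Gaussian vectors, one small combination, and `J`
  -- large scores. Together they get probability `δ / 2`.
  set ε : ℝ := δ / (2 * (2 * J + 1)) with hε_def
  have hε : 0 < ε := by positivity
  obtain ⟨K, κ, hK, hκ, hgauss⟩ := exists_gauss_bounds hL h₁₂ hb₁ (ENNReal.ofReal_pos.mpr hε)
  set K₁ : ℝ := C * (K + 2)
  set K₂ : ℝ := dphi * (‖L.G‖ * (K + 1))
  set E : ℝ := K₂ + (∑ j, |L.b j|) * K₁ + 1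
  have hK₁ : 0 ≤ K₁ := by positivity
  have hK₂ : 0 ≤ K₂ := by positivity
  have hE : 0 ≤ E := by positivity
  -- The first summand lets the signal dominate the noise in the bootstrap scores, the second lifts
  -- the statistic above the bound for the critical value. Both are fixed before the model is
  -- introduced.
  refine ⟨(K₂ + 1) / c + (K₁ + (ξ * c)⁻¹ * ((J + 1) * E)), by positivity,
    fun dz Ω _ P _ M hX hμ => ?_⟩
  -- These bounds may depend on the model: they serve only to make the full scores, including the
  -- `W`-part, of order one along the filter, and do not enter the constant for `μ_β`.
  choose D hD using fun j => (hX.asymptotics.score_rate j).exists_eventually_le hε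
  set A₁ : ℕ → Fin J → Set Ω := fun n j => {ω | K ≤ ‖M.gauss n j ω‖}
  set A₂ : ℕ → Set Ω := fun n => {ω | |L.b j₁ * (L.G ⬝ᵥ WithLp.ofLp (M.gauss n j₂ ω))
    - L.b j₂ * (L.G ⬝ᵥ WithLp.ofLp (M.gauss n j₁ ω))| < κ}
  set A₃ : ℕ → Fin J → Set Ω := fun n j =>
    {ω | D j ≤ |M.rate n * norm2 (M.emp τ n j ω (M.betaN n) (M.gammaTrue n) 0)|}
  set A : ℕ → Set Ω := fun n => ((⋃ j, A₁ n j) ∪ A₂ n ∪ ⋃ j, A₃ n j)ᶜ with hA_def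
  have hmem : ∀ n, ∀ ω ∈ A n, (∀ j, ω ∉ A₁ n j) ∧ ω ∉ A₂ n ∧ ∀ j, ω ∉ A₃ n j := by
    intro n ω hω
    simp only [hA_def, Set.mem_compl_iff, Set.mem_union, Set.mem_iUnion, not_or, not_exists] at hω
    exact ⟨hω.1.1, hω.1.2, hω.2⟩
  have hS : ∀ j, (fun p : ℕ × Ω => M.clusterScoreN τ p.1 j p.2)
      =O[probFilter P A] fun _ => (1 : ℝ) := fun j =>
    Model.isBigO_clusterScoreN_of_mem (C := D j) fun n ω hω =>
      (not_le.mp ((hmem n ω hω).2.2 j)).le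
  have hP : ∀ᶠ n in atTop, P (A n)ᶜ ≤ ENNReal.ofReal (δ / 2) := by
    filter_upwards [eventually_all.mpr hD] with n hn
    rw [hA_def, compl_compl]
    calc P ((⋃ j, A₁ n j) ∪ A₂ n ∪ ⋃ j, A₃ n j)
        ≤ (∑ j, P (A₁ n j) + P (A₂ n)) + ∑ j, P (A₃ n j) :=
          (measure_union_le _ _).trans (add_le_add ((measure_union_le _ _).trans
            (add_le_add (measure_iUnion_fintype_le _ _) le_rfl)) (measure_iUnion_fintype_le _ _))
      _ ≤ (∑ _j : Fin J, ENNReal.ofReal ε + ENNReal.ofReal ε)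
            + ∑ _j : Fin J, ENNReal.ofReal ε := by
          obtain ⟨h1, h2⟩ := hgauss dz Ω P M τ hX.normality n
          exact add_le_add (add_le_add (Finset.sum_le_sum fun j _ => h1 j) h2)
            (Finset.sum_le_sum fun j _ => hn j)
      _ = ENNReal.ofReal (δ / 2) := by
          rw [Finset.sum_const, Finset.card_univ, Fintype.card_fin, ← ENNReal.ofReal_nsmul,
            ← ENNReal.ofReal_add (by positivity) hε.le,
            ← ENNReal.ofReal_add (by positivity) (by positivity)]
          congr 1
          rw [nsmul_eq_mul, hε_def]
          field_simp
          ring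
  have hb := hbound dz Ω P A M τ 0 M.estimator (fun p => M.betaHat p.1 p.2) hτ hX
    (Model.isBigO_scoreN hX hS) Model.isBigO_rate_smul_zero (Model.isMinimizer_estimator hX)
    (Model.isSelector_estimator hX)
  simp only [Pi.zero_apply, smul_zero, add_zero] at hb
  have hμ₁ : K₂ + 1 ≤ c * |M.muBeta| := by
    have h1 : (K₂ + 1) / c ≤ |M.muBeta| := by
      have : 0 ≤ K₁ + (ξ * c)⁻¹ * ((J + 1) * E) := by positivity
      linarith
    rw [div_le_iff₀ hc] at h1
    linarith
  have hμ₂ : K₁ + (ξ * c)⁻¹ * ((J + 1) * E) < |M.muBeta| := by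
    have : 0 ≤ (K₂ + 1) / c := by positivity
    linarith
  have hmain := Model.eventually_quantile_lt_TCR hα hτ hL hJs hX hξ hξj hc hcb' hj₁ hC hb hS
    (fun n ω hω j => (not_le.mp ((hmem n ω hω).1 j)).le) hκ
    (fun n ω hω => not_lt.mp (hmem n ω hω).2.1) le_rfl le_rfl le_rfl hμ₁ hμ₂
  refine le_liminf_of_eventually_probFilter (A := A) (hmain.mono fun p hp => ?_) hδ hP
  change M.test α p.1 p.2 ≤ M.testCR τ α p.1 p.2
  -- The studentized test equals one here, so the inequality holds for either value of the other
  -- test.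
  rw [Model.testCR, if_pos hp, Model.test]
  split_ifs <;> norm_num
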